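/- Let $p>2$ be a prime, $k=\mathbb F_p$ and $G=SL_2$ over $k$, with coordinate Hopf algebra $k[G]$ and $I\subset k[G]$ the kernel of the counit $\varepsilon_G$. For $n\ge 0$ let $\mathrm{Dist}(G)_n$ be the space of linear forms $k[G]\to k$ that vanish on $I^{n+1}$, and let $\mathrm{Dist}(G)=\bigcup_n \mathrm{Dist}(G)_n$ be the algebra of distributions of $G$ (with the convolution product and unit $\varepsilon_G$). For $m\ge 0$ let $U^{(m)}(\mathcal G)$ be the quotient of the tensor algebra $\mathbb T_k(\mathrm{Dist}(G)_{2p^m-1})$ by the two-sided ideal generated by the elements $\lambda-\lambda\varepsilon_G$ ($\lambda\in k$), $\mu\otimes\mu'-\mu'\otimes\mu-[\mu,\mu']$ ($\mu,\mu'\in \mathrm{Dist}(G)_{p^m}$) and $\mu''\otimes\mu-\mu''\mu$ ($\mu''\in\mathrm{Dist}(G)_{p^m-1}$, $\mu\in\mathrm{Dist}(G)_{p^m}$). The inclusions of the spaces $\mathrm{Dist}(G)_{2p^m-1}$ induce algebra morphisms $U^{(m)}(\mathcal G)\to U^{(m+1)}(\mathcal G)$ and $U^{(m)}(\mathcal G)\to\mathrm{Dist}(G)$.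 For $n\ge0$ let $E^{[n]}$, $F^{[n]}$, $\binom Hn\in\mathrm{Dist}(G)_n$ be the linear forms sending $f\in k[G]$ to the coefficient of $t^n$ in the power series $f\begin{pmatrix}1&t\\0&1\end{pmatrix}$, $f\begin{pmatrix}1&0\\t&1\end{pmatrix}$, $f\begin{pmatrix}1+t&0\\0&(1+t)^{-1}\end{pmatrix}$ respectively (the reductions modulo $p$ of $E^n/n!$, $F^n/n!$ and $H(H-1)\cdots(H-n+1)/n!$), and put $\Delta_T=\sum_{i=0}^{p-1}(-1)^i\binom Hi$ (Haboush's norm), in $\mathrm{Dist}(G)$ and in each $U^{(m+1)}(\mathcal G)$. The Frobenius morphism $Fr:\mathrm{Dist}(G)\to\mathrm{Dist}(G)$, $(Fr\,\mu)(f)=\mu(f^p)$, is an algebra morphism, and it induces algebra morphisms $Fr:U^{(m+1)}(\mathcal G)\to U^{(m)}(\mathcal G)$. **Proposition.** (0) On $\mathrm{Dist}(G)$ and at each level, $Fr(E^{[n]})=E^{[n/p]}$ and $Fr(F^{[n]})=F^{[n/p]}$ if $p\mid n$, and $Fr(E^{[n]})=Fr(F^{[n]})=0$ otherwise (at level $m+1$: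 for all $n\le 2p^{m+1}-1$). (1) For every $m\ge0$ there is exactly one $k$-linear multiplicative (not necessarily unital) map $\varphi_m:U^{(m)}(\mathcal G)\to U^{(m+1)}(\mathcal G)$ such that, for all $0\le i\le 2p^m-1$, $$\varphi_m(E^{[i]})=E^{[ip]}\Delta_T,\qquad \varphi_m(F^{[i]})=F^{[ip]}\Delta_T,\qquad \varphi_m\Bigl(\tbinom Hi\Bigr)=\tbinom H{ip}\Delta_T .$$ It is not unital: $\varphi_m(1)=\Delta_T\ne1$. It splits the Frobenius morphism: $Fr\circ\varphi_m=\mathrm{id}_{U^{(m)}(\mathcal G)}$. (2) There is exactly one $k$-linear multiplicative map $\varphi:\mathrm{Dist}(G)\to\mathrm{Dist}(G)$ given by the same formulas for all $i\ge0$; it satisfies $\varphi(1)=\Delta_T\neq 1$ and $Fr\circ\varphi=\mathrm{id}_{\mathrm{Dist}(G)}$. (3) The maps $\varphi_m$ are compatible with the transition morphisms $U^{(m)}(\mathcal G)\to U^{(m+1)}(\mathcal G)$, and $\varphi$ and the $\varphi_m$ are compatible with the morphisms $U^{(m)}(\mathcal G)\to\mathrm{Dist}(G)$. -/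

import Mathlib

open scoped TensorProduct PowerSeries

noncomputable section

namespace DistSL2

/-! ### Distributions of an affine algebraic group with coordinate bialgebra `A` -/

section Dist

variable (k A : Type*) [CommRing k] [CommRing A] [Bialgebra k A]

/-- The ideal of the unit element: the kernel of the counit. -/
def augIdeal : Ideal A := RingHom.ker (Bialgebra.counitAlgHom k A)

/-- All linear functionals on `A`, with the convolution product
`(μ * ν) f = ∑ μ f₍₁₎ * ν f₍₂₎` and the counit as unit element. -/
abbrev Functional : Type _ := WithConv (A →ₗ[k] k)

/-- Distributions (at the unit element) of order at most `n`: the functionals that vanish on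
the `(n + 1)`-st power of the ideal of the unit element. -/
def distOrder (n : ℕ) : Submodule k (Functional k A) where
  carrier := {μ | ∀ f ∈ augIdeal k A ^ (n + 1), μ f = 0}
  zero_mem' := fun f _ => rfl
  add_mem' := fun {μ ν} hμ hν f hf => by
    change μ f + ν f = 0
    rw [hμ f hf, hν f hf, add_zero]
  smul_mem' := fun c μ hμ f hf => by
    change c • μ f = 0
    rw [hμ f hf, smul_zero]

variable {k A}

theorem distOrder_mono {n n' : ℕ} (h : n ≤ n') : distOrder k A n ≤ distOrder k A n' :=
  fun _ hμ f hf => hμ f (Ideal.pow_le_pow_right (Nat.succ_le_succ h) hf)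

theorem one_mem_distOrder (n : ℕ) : (1 : Functional k A) ∈ distOrder k A n := by
  intro f hf
  have h1 : f ∈ augIdeal k A := Ideal.pow_le_self (Nat.succ_ne_zero n) hf
  have h2 : Coalgebra.counit (R := k) f = 0 := h1
  rw [LinearMap.convOne_apply, h2, map_zero]

variable (k A) in
/-- The ideal of the unit element of the product of the group with itself. -/
def augIdeal₂ : Ideal (A ⊗[k] A) :=
  (augIdeal k A).map (Algebra.TensorProduct.includeLeft : A →ₐ[k] A ⊗[k] A) ⊔
    (augIdeal k A).map (Algebra.TensorProduct.includeRight : A →ₐ[k] A ⊗[k] A)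

theorem sub_counit_mem (a : A) :
    a - algebraMap k A (Coalgebra.counit (R := k) a) ∈ augIdeal k A := by
  change Bialgebra.counitAlgHom k A _ = 0
  simp

theorem tmul_one_mem {a : A} (ha : a ∈ augIdeal k A) : a ⊗ₜ[k] (1 : A) ∈ augIdeal₂ k A :=
  Ideal.mem_sup_left (Ideal.mem_map_of_mem
      (Algebra.TensorProduct.includeLeft : A →ₐ[k] A ⊗[k] A) ha)

theorem one_tmul_mem {a : A} (ha : a ∈ augIdeal k A) : (1 : A) ⊗ₜ[k] a ∈ augIdeal₂ k A :=
  Ideal.mem_sup_right (Ideal.mem_map_of_mem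
      (Algebra.TensorProduct.includeRight : A →ₐ[k] A ⊗[k] A) ha)

theorem tmul_mem_sq {a b : A} (ha : a ∈ augIdeal k A) (hb : b ∈ augIdeal k A) :
    a ⊗ₜ[k] b ∈ augIdeal₂ k A ^ 2 := by
  have : a ⊗ₜ[k] b = (a ⊗ₜ[k] (1 : A)) * ((1 : A) ⊗ₜ[k] b) := by simp
  rw [this, sq]
  exact Ideal.mul_mem_mul (tmul_one_mem ha) (one_tmul_mem hb)

theorem comul_sub_mem {f : A} (hf : f ∈ augIdeal k A) :
    Coalgebra.comul (R := k) f - (f ⊗ₜ[k] (1 : A) + (1 : A) ⊗ₜ[k] f) ∈ augIdeal₂ k A ^ 2 := by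
  have key : ∀ t : A ⊗[k] A,
      t - ((TensorProduct.rid k A ((Coalgebra.counit (R := k) (A := A)).lTensor A t)) ⊗ₜ[k] (1 : A)
        + (1 : A) ⊗ₜ[k] (TensorProduct.lid k A ((Coalgebra.counit (R := k) (A := A)).rTensor A t)))
        + algebraMap k (A ⊗[k] A) (LinearMap.mul' k k (TensorProduct.map
          (Coalgebra.counit (R := k)) (Coalgebra.counit (R := k)) t)) ∈ augIdeal₂ k A ^ 2 := by
    intro t
    induction t with
    | zero => simp
    | add x y hx hy =>
      convert Ideal.add_mem _ hx hy using 1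
      simp only [map_add, TensorProduct.add_tmul, TensorProduct.tmul_add]
      abel
    | tmul a b =>
      convert tmul_mem_sq (sub_counit_mem (k := k) a) (sub_counit_mem (k := k) b) using 1
      simp only [LinearMap.lTensor_tmul, TensorProduct.rid_tmul, LinearMap.rTensor_tmul,
        TensorProduct.lid_tmul, TensorProduct.map_tmul, LinearMap.mul'_apply,
        Algebra.algebraMap_eq_smul_one, TensorProduct.sub_tmul, TensorProduct.tmul_sub,
        TensorProduct.tmul_smul, ← TensorProduct.smul_tmul', Algebra.TensorProduct.one_def,
        mul_smul, smul_sub]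
      rw [smul_comm (Coalgebra.counit (R := k) a)]
      abel
  have h0 : Coalgebra.counit (R := k) f = 0 := hf
  have h := key (Coalgebra.comul (R := k) f)
  have h3 : LinearMap.mul' k k (TensorProduct.map (Coalgebra.counit (R := k))
      (Coalgebra.counit (R := k)) (Coalgebra.comul (R := k) f)) = 0 := by
    have h4 : ((1 : Functional k A) * 1) f = 0 := by
      rw [one_mul, LinearMap.convOne_apply, h0, map_zero]
    exact h4
  rw [h3, Coalgebra.lTensor_counit_comul, Coalgebra.rTensor_counit_comul] at h
  simpa using h

theorem comul_mem {f : A} (hf : f ∈ augIdeal k A) :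
    Coalgebra.comul (R := k) f ∈ augIdeal₂ k A := by
  have h := Ideal.pow_le_self two_ne_zero (comul_sub_mem hf)
  have h2 := Ideal.add_mem _ h (Ideal.add_mem _ (tmul_one_mem (k := k) hf) (one_tmul_mem hf))
  simpa using h2

theorem comul_mem_pow {f : A} {n : ℕ} (hf : f ∈ augIdeal k A ^ n) :
    Coalgebra.comul (R := k) f ∈ augIdeal₂ k A ^ n := by
  have h : augIdeal k A ≤ (augIdeal₂ k A).comap (Bialgebra.comulAlgHom k A) :=
    fun x hx => comul_mem hx
  exact (Ideal.pow_right_mono h n).trans (Ideal.le_comap_pow _ n) hf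

theorem map_eq_zero_of_mem {μ ν : Functional k A} {n n' : ℕ} (hμ : μ ∈ distOrder k A n)
    (hν : ν ∈ distOrder k A n') {t : A ⊗[k] A} (ht : t ∈ augIdeal₂ k A ^ (n + n' + 1)) :
    LinearMap.mul' k k (TensorProduct.map μ.ofConv ν.ofConv t) = 0 := by
  have hle : augIdeal₂ k A ^ (n + n' + 1) ≤
      (augIdeal k A ^ (n + 1)).map (Algebra.TensorProduct.includeLeft : A →ₐ[k] A ⊗[k] A) ⊔
      (augIdeal k A ^ (n' + 1)).map
        (Algebra.TensorProduct.includeRight : A →ₐ[k] A ⊗[k] A) := by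
    rw [augIdeal₂, Ideal.map_pow, Ideal.map_pow, ← Ideal.add_eq_sup, ← Ideal.add_eq_sup, add_pow,
      Ideal.sum_eq_sup]
    apply Finset.sup_le
    intro i hi
    by_cases hn : n + 1 ≤ i
    · exact (Ideal.mul_le_left.trans (Ideal.mul_le_left.trans
        ((Ideal.pow_le_pow_right hn).trans le_sup_left)))
    · refine (Ideal.mul_le_left.trans (Ideal.mul_le_right.trans
        ((Ideal.pow_le_pow_right ?_).trans le_sup_right)))
      lia
  obtain ⟨x, hx, y, hy, rfl⟩ := Submodule.mem_sup.1 (hle ht)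
  rw [map_add, map_add]
  have hx0 : LinearMap.mul' k k (TensorProduct.map μ.ofConv ν.ofConv x) = 0 := by
    refine Submodule.span_induction ?_ (by simp) (fun x y _ _ hx hy => by simp [hx, hy]) ?_
      (Submodule.span_induction (p := fun x _ => x ∈ Submodule.span k
        {z | ∃ a ∈ augIdeal k A ^ (n + 1), ∃ b : A, z = a ⊗ₜ[k] b}) ?_ (Submodule.zero_mem _)
        (fun x y _ _ hx hy => Submodule.add_mem _ hx hy) ?_ hx)
    · rintro _ ⟨a, ha, b, rfl⟩
      simp [hμ a ha]
    · intro c x _ hx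
      simp [hx]
    · rintro _ ⟨a, ha, rfl⟩
      exact Submodule.subset_span ⟨a, ha, 1, rfl⟩
    · intro c z _ hz
      rw [smul_eq_mul]
      induction c with
      | zero => simp
      | add c c' hc hc' => rw [add_mul]; exact Submodule.add_mem _ hc hc'
      | tmul c c' =>
        refine Submodule.span_induction ?_ (by simp) (fun x y _ _ hx hy => ?_) ?_ hz
        · rintro _ ⟨a, ha, b, rfl⟩
          exact Submodule.subset_span ⟨c * a, Ideal.mul_mem_left _ _ ha, c' * b, by simp⟩
        · rw [mul_add]; exact Submodule.add_mem _ hx hy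
        · intro r x _ hx
          rw [mul_smul_comm]; exact Submodule.smul_mem _ _ hx
  have hy0 : LinearMap.mul' k k (TensorProduct.map μ.ofConv ν.ofConv y) = 0 := by
    refine Submodule.span_induction ?_ (by simp) (fun x y _ _ hx hy => by simp [hx, hy]) ?_
      (Submodule.span_induction (p := fun x _ => x ∈ Submodule.span k
        {z | ∃ a ∈ augIdeal k A ^ (n' + 1), ∃ b : A, z = b ⊗ₜ[k] a}) ?_ (Submodule.zero_mem _)
        (fun x y _ _ hx hy => Submodule.add_mem _ hx hy) ?_ hy)
    · rintro _ ⟨a, ha, b, rfl⟩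
      simp [hν a ha]
    · intro c x _ hx
      simp [hx]
    · rintro _ ⟨a, ha, rfl⟩
      exact Submodule.subset_span ⟨a, ha, 1, rfl⟩
    · intro c z _ hz
      rw [smul_eq_mul]
      induction c with
      | zero => simp
      | add c c' hc hc' => rw [add_mul]; exact Submodule.add_mem _ hc hc'
      | tmul c c' =>
        refine Submodule.span_induction ?_ (by simp) (fun x y _ _ hx hy => ?_) ?_ hz
        · rintro _ ⟨a, ha, b, rfl⟩
          exact Submodule.subset_span ⟨c' * a, Ideal.mul_mem_left _ _ ha, c * b, by simp⟩
        · rw [mul_add]; exact Submodule.add_mem _ hx hy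
        · intro r x _ hx
          rw [mul_smul_comm]; exact Submodule.smul_mem _ _ hx
  rw [hx0, hy0, add_zero]

theorem mul_mem_distOrder {μ ν : Functional k A} {n n' : ℕ} (hμ : μ ∈ distOrder k A n)
    (hν : ν ∈ distOrder k A n') : μ * ν ∈ distOrder k A (n + n') := fun f hf => by
  rw [LinearMap.convMul_apply]
  exact map_eq_zero_of_mem hμ hν (comul_mem_pow hf)

theorem comm_mem_pow {t : A ⊗[k] A} {n : ℕ} (ht : t ∈ augIdeal₂ k A ^ n) :
    Algebra.TensorProduct.comm k A A t ∈ augIdeal₂ k A ^ n := by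
  have h : augIdeal₂ k A ≤ (augIdeal₂ k A).comap (Algebra.TensorProduct.comm k A A) := by
    refine sup_le (Ideal.map_le_iff_le_comap.2 ?_) (Ideal.map_le_iff_le_comap.2 ?_)
    · intro a ha
      simpa [Ideal.mem_comap] using one_tmul_mem (k := k) ha
    · intro a ha
      simpa [Ideal.mem_comap] using tmul_one_mem (k := k) ha
  exact (Ideal.pow_right_mono h n).trans (Ideal.le_comap_pow _ n) ht

theorem comul_sub_comm_mem_sq {f : A} (hf : f ∈ augIdeal k A) :
    Coalgebra.comul (R := k) f - Algebra.TensorProduct.comm k A A (Coalgebra.comul (R := k) f) ∈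
      augIdeal₂ k A ^ 2 := by
  have h1 := comul_sub_mem (k := k) hf
  have h2 := comm_mem_pow h1
  convert Ideal.sub_mem _ h1 h2 using 1
  simp only [map_sub, map_add, Algebra.TensorProduct.comm_tmul]
  abel

theorem comul_sub_comm_mem {n : ℕ} : ∀ {f : A}, f ∈ augIdeal k A ^ n →
    Coalgebra.comul (R := k) f - Algebra.TensorProduct.comm k A A (Coalgebra.comul (R := k) f) ∈
      augIdeal₂ k A ^ (n + 1) := by
  induction n with
  | zero =>
    intro f _
    have h := Ideal.pow_le_self two_ne_zero (comul_sub_comm_mem_sq (sub_counit_mem (k := k) f))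
    simpa [Algebra.algebraMap_eq_smul_one, ← TensorProduct.smul_tmul'] using h
  | succ n ih =>
    intro f hf
    rw [pow_succ'] at hf
    refine Submodule.mul_induction_on hf (fun a ha b hb => ?_) (fun x y hx hy => ?_)
    · have h1 := Ideal.mul_mem_mul (comul_mem (k := k) ha) (ih hb)
      have h2 := Ideal.mul_mem_mul (comul_sub_comm_mem_sq (k := k) ha)
        (comm_mem_pow (comul_mem_pow (k := k) hb))
      rw [← pow_succ'] at h1
      rw [← pow_add, add_comm 2 n] at h2
      convert Ideal.add_mem _ h1 h2 using 1
      rw [Bialgebra.comul_mul, map_mul]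
      ring
    · convert Ideal.add_mem _ hx hy using 1
      simp only [map_add]
      ring

/-- Commutators lower the order by one. -/
theorem commutator_mem_distOrder {μ ν : Functional k A} {n n' : ℕ} (hμ : μ ∈ distOrder k A n)
    (hν : ν ∈ distOrder k A n') : μ * ν - ν * μ ∈ distOrder k A (n + n' - 1) := fun f hf => by
  have hcomm : ∀ t : A ⊗[k] A, LinearMap.mul' k k (TensorProduct.map ν.ofConv μ.ofConv t) =
      LinearMap.mul' k k (TensorProduct.map μ.ofConv ν.ofConv
        (Algebra.TensorProduct.comm k A A t)) := by
    intro t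
    induction t with
    | zero => simp
    | add x y hx hy => simp only [map_add, hx, hy]
    | tmul a b => simp [mul_comm]
  change (μ * ν) f - (ν * μ) f = 0
  rw [LinearMap.convMul_apply, LinearMap.convMul_apply, hcomm, ← map_sub, ← map_sub]
  refine map_eq_zero_of_mem hμ hν (Ideal.pow_le_pow_right ?_ (comul_sub_comm_mem hf))
  lia

variable (k A) in
/-- The algebra of distributions: the functionals that are distributions of some finite order. -/
def dist : Subalgebra k (Functional k A) where
  carrier := {μ | ∃ n, μ ∈ distOrder k A n}
  mul_mem' := fun ⟨n, hn⟩ ⟨n', hn'⟩ => ⟨n + n', mul_mem_distOrder hn hn'⟩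
  add_mem' := fun ⟨n, hn⟩ ⟨n', hn'⟩ => ⟨n + n', Submodule.add_mem _
    (distOrder_mono (Nat.le_add_right _ _) hn) (distOrder_mono (Nat.le_add_left _ _) hn')⟩
  algebraMap_mem' := fun c => ⟨0, by
    rw [Algebra.algebraMap_eq_smul_one]
    exact Submodule.smul_mem _ _ (one_mem_distOrder 0)⟩

/-- The inclusion of the distributions of order at most `n` in those of order at most `n'`. -/
def distOrder.incl {n n' : ℕ} (h : n ≤ n') : distOrder k A n →ₗ[k] distOrder k A n' :=
  Submodule.inclusion (distOrder_mono h)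

theorem distOrder.coe_incl {n n' : ℕ} (h : n ≤ n') (μ : distOrder k A n) :
    (distOrder.incl h μ : Functional k A) = μ :=
  Submodule.coe_inclusion (distOrder_mono h) μ

theorem distOrder.incl_one {n n' : ℕ} (h : n ≤ n') :
    distOrder.incl (k := k) (A := A) h ⟨1, one_mem_distOrder n⟩ = ⟨1, one_mem_distOrder n'⟩ := by
  apply Subtype.ext
  rw [distOrder.coe_incl]

/-- A distribution of order at most `n`, as an element of the algebra of distributions. -/
def distOrder.toDist (n : ℕ) : distOrder k A n →ₗ[k] dist k A :=
  Submodule.inclusion (p := distOrder k A n) (p' := Subalgebra.toSubmodule (dist k A))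
    fun _ hμ => ⟨n, hμ⟩

end Dist

/-! ### The level `m` enveloping algebra -/

section Level

variable (k A : Type*) [CommRing k] [CommRing A] [Bialgebra k A] (p m : ℕ)

/-- The relations of the level `m` enveloping algebra, in the tensor algebra of the module of
distributions of order at most `2 p ^ m - 1`.  The products `μ * μ'` are those of the algebra of
distributions.  In `comm` and `mul` the element `ν` always exists (by `commutator_mem_distOrder`
and `mul_mem_distOrder`) and it is unique. -/
inductive LevelRel : TensorAlgebra k (distOrder k A (2 * p ^ m - 1)) →
    TensorAlgebra k (distOrder k A (2 * p ^ m - 1)) → Prop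
  /-- A scalar is identified with the corresponding multiple of the counit. -/
  | unit (c : k) : LevelRel (algebraMap k _ c)
      (TensorAlgebra.ι k (c • ⟨1, one_mem_distOrder (2 * p ^ m - 1)⟩))
  | comm (μ μ' ν : distOrder k A (2 * p ^ m - 1))
      (hμ : (μ : Functional k A) ∈ distOrder k A (p ^ m))
      (hμ' : (μ' : Functional k A) ∈ distOrder k A (p ^ m))
      (hν : (ν : Functional k A) = μ * μ' - μ' * μ) :
      LevelRel (TensorAlgebra.ι k μ * TensorAlgebra.ι k μ' -
        TensorAlgebra.ι k μ' * TensorAlgebra.ι k μ) (TensorAlgebra.ι k ν)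
  | mul (μ μ' ν : distOrder k A (2 * p ^ m - 1))
      (hμ : (μ : Functional k A) ∈ distOrder k A (p ^ m - 1))
      (hμ' : (μ' : Functional k A) ∈ distOrder k A (p ^ m))
      (hν : (ν : Functional k A) = μ * μ') :
      LevelRel (TensorAlgebra.ι k μ * TensorAlgebra.ι k μ') (TensorAlgebra.ι k ν)

/-- The enveloping algebra of level `m`. -/
def LevelAlg : Type _ := RingQuot (LevelRel k A p m)

instance : Ring (LevelAlg k A p m) := inferInstanceAs (Ring (RingQuot _))

instance : Algebra k (LevelAlg k A p m) := inferInstanceAs (Algebra k (RingQuot _))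

/-- The quotient map from the tensor algebra. -/
def LevelAlg.mk : TensorAlgebra k (distOrder k A (2 * p ^ m - 1)) →ₐ[k] LevelAlg k A p m :=
  RingQuot.mkAlgHom k (LevelRel k A p m)

variable {k A}

variable {p m} in
theorem LevelAlg.mk_rel {x y : TensorAlgebra k (distOrder k A (2 * p ^ m - 1))}
    (h : LevelRel k A p m x y) : LevelAlg.mk k A p m x = LevelAlg.mk k A p m y :=
  RingQuot.mkAlgHom_rel k h

/-- The generators of the enveloping algebra of level `m`. -/
def LevelAlg.of : distOrder k A (2 * p ^ m - 1) →ₗ[k] LevelAlg k A p m :=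
  (LevelAlg.mk k A p m).toLinearMap ∘ₗ TensorAlgebra.ι k

variable {p m} in
/-- Universal property of the enveloping algebra of level `m`. -/
def LevelAlg.lift {B : Type*} [Ring B] [Algebra k B]
    (g : distOrder k A (2 * p ^ m - 1) →ₗ[k] B)
    (h1 : g ⟨1, one_mem_distOrder _⟩ = 1)
    (hcomm : ∀ μ μ' ν : distOrder k A (2 * p ^ m - 1),
      (μ : Functional k A) ∈ distOrder k A (p ^ m) →
      (μ' : Functional k A) ∈ distOrder k A (p ^ m) →
      (ν : Functional k A) = μ * μ' - μ' * μ → g μ * g μ' - g μ' * g μ = g ν)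
    (hmul : ∀ μ μ' ν : distOrder k A (2 * p ^ m - 1),
      (μ : Functional k A) ∈ distOrder k A (p ^ m - 1) →
      (μ' : Functional k A) ∈ distOrder k A (p ^ m) →
      (ν : Functional k A) = μ * μ' → g μ * g μ' = g ν) :
    LevelAlg k A p m →ₐ[k] B :=
  RingQuot.liftAlgHom k ⟨TensorAlgebra.lift k g, by
    rintro x y (c | ⟨μ, μ', ν, hμ, hμ', hν⟩ | ⟨μ, μ', ν, hμ, hμ', hν⟩)
    · rw [AlgHom.commutes, TensorAlgebra.lift_ι_apply, map_smul, h1, Algebra.algebraMap_eq_smul_one]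
    · simpa only [map_sub, map_mul, TensorAlgebra.lift_ι_apply] using hcomm μ μ' ν hμ hμ' hν
    · simpa only [map_mul, TensorAlgebra.lift_ι_apply] using hmul μ μ' ν hμ hμ' hν⟩

theorem LevelAlg.of_one : LevelAlg.of p m ⟨1, one_mem_distOrder _⟩ = (1 : LevelAlg k A p m) := by
  have h := LevelAlg.mk_rel (LevelRel.unit (k := k) (A := A) (p := p) (m := m) 1)
  rw [one_smul, map_one, map_one] at h
  exact h.symm

variable {p m} in
theorem LevelAlg.of_comm (μ μ' ν : distOrder k A (2 * p ^ m - 1))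
    (hμ : (μ : Functional k A) ∈ distOrder k A (p ^ m))
    (hμ' : (μ' : Functional k A) ∈ distOrder k A (p ^ m))
    (hν : (ν : Functional k A) = μ * μ' - μ' * μ) :
    LevelAlg.of p m μ * LevelAlg.of p m μ' - LevelAlg.of p m μ' * LevelAlg.of p m μ =
      LevelAlg.of p m ν := by
  have h := LevelAlg.mk_rel (LevelRel.comm μ μ' ν hμ hμ' hν)
  rw [map_sub, map_mul, map_mul] at h
  exact h

variable {p m} in
theorem LevelAlg.of_mul (μ μ' ν : distOrder k A (2 * p ^ m - 1))
    (hμ : (μ : Functional k A) ∈ distOrder k A (p ^ m - 1))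
    (hμ' : (μ' : Functional k A) ∈ distOrder k A (p ^ m))
    (hν : (ν : Functional k A) = μ * μ') :
    LevelAlg.of p m μ * LevelAlg.of p m μ' = LevelAlg.of p m ν := by
  have h := LevelAlg.mk_rel (LevelRel.mul μ μ' ν hμ hμ' hν)
  rw [map_mul] at h
  exact h

/-- The canonical morphism from the enveloping algebra of level `m` to the algebra of
distributions, induced by the inclusion of the distributions of order at most `2 p ^ m - 1`. -/
def LevelAlg.toDist : LevelAlg k A p m →ₐ[k] dist k A :=
  LevelAlg.lift (B := dist k A) (distOrder.toDist (2 * p ^ m - 1)) rfl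
    (fun _ _ _ _ _ hν => Subtype.ext hν.symm) (fun _ _ _ _ _ hν => Subtype.ext hν.symm)

variable [Fact p.Prime]

theorem LevelAlg.next_aux : p ^ m ≤ p ^ (m + 1) :=
  Nat.pow_le_pow_right (Fact.out : p.Prime).pos m.le_succ

theorem LevelAlg.next_aux' : 2 * p ^ m - 1 ≤ 2 * p ^ (m + 1) - 1 :=
  Nat.sub_le_sub_right (Nat.mul_le_mul_left 2 (LevelAlg.next_aux p m)) 1

/-- The transition morphism of the inductive system of the enveloping algebras of level `m`,
induced by the inclusion of the distributions of order at most `2 p ^ m - 1` in those of order at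
most `2 p ^ (m + 1) - 1`. -/
def LevelAlg.next : LevelAlg k A p m →ₐ[k] LevelAlg k A p (m + 1) :=
  LevelAlg.lift (B := LevelAlg k A p (m + 1))
    (LevelAlg.of p (m + 1) ∘ₗ distOrder.incl (LevelAlg.next_aux' p m))
    (by
      rw [LinearMap.comp_apply, distOrder.incl_one, LevelAlg.of_one])
    (fun μ μ' ν hμ hμ' hν => by
      simp only [LinearMap.comp_apply]
      apply LevelAlg.of_comm <;> simp only [distOrder.coe_incl]
      · exact distOrder_mono (LevelAlg.next_aux p m) hμ
      · exact distOrder_mono (LevelAlg.next_aux p m) hμ'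
      · exact hν)
    (fun μ μ' ν hμ hμ' hν => by
      simp only [LinearMap.comp_apply]
      apply LevelAlg.of_mul <;> simp only [distOrder.coe_incl]
      · exact distOrder_mono (Nat.sub_le_sub_right (LevelAlg.next_aux p m) 1) hμ
      · exact distOrder_mono (LevelAlg.next_aux p m) hμ'
      · exact hν)

end Level

/-! ### The Frobenius morphism -/

section Frobenius

variable (p : ℕ) [Fact p.Prime] (A : Type*) [CommRing A] [Bialgebra (ZMod p) A]

/-- The Frobenius endomorphism `f ↦ f ^ p` of a bialgebra over the field with `p` elements. -/
def frobAlgHom : A →ₐ[ZMod p] A := FiniteField.frobeniusAlgHom (ZMod p) A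

variable {A} in
theorem frobAlgHom_apply (f : A) : frobAlgHom p A f = f ^ p := by
  simp [frobAlgHom]

/-- The Frobenius endomorphism is a morphism of bialgebras. -/
def frobBialgHom : A →ₐc[ZMod p] A :=
  BialgHom.ofAlgHom (frobAlgHom p A)
    (AlgHom.ext fun f => by
      change Coalgebra.counit (R := ZMod p) (frobAlgHom p A f) = Coalgebra.counit f
      rw [frobAlgHom_apply, Bialgebra.counit_pow, ZMod.pow_card])
    (AlgHom.ext fun f => by
      have h : Algebra.TensorProduct.map (frobAlgHom p A) (frobAlgHom p A) =
          FiniteField.frobeniusAlgHom (ZMod p) (A ⊗[ZMod p] A) := by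
        ext a <;> simp [frobAlgHom]
      change Algebra.TensorProduct.map (frobAlgHom p A) (frobAlgHom p A) (Coalgebra.comul f) =
        Coalgebra.comul (frobAlgHom p A f)
      rw [h, frobAlgHom_apply, Bialgebra.comul_pow]
      simp)

/-- The transpose of the Frobenius endomorphism on functionals: `(Fr μ) f = μ (f ^ p)`. -/
def frFunctional : Functional (ZMod p) A →ₐ[ZMod p] Functional (ZMod p) A :=
  AlgHom.ofLinearMap
    { toFun := fun μ => WithConv.toConv (μ.ofConv ∘ₗ (frobAlgHom p A).toLinearMap)
      map_add' := fun _ _ => rfl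
      map_smul' := fun _ _ => rfl }
    (by
      ext f
      change (1 : Functional (ZMod p) A) (frobAlgHom p A f) = (1 : Functional (ZMod p) A) f
      simp [LinearMap.convOne_apply, frobAlgHom_apply])
    (fun μ ν => WithConv.ext (LinearMap.convMul_comp_coalgHom_distrib μ ν
      (frobBialgHom p A).toCoalgHom))

variable {A}

theorem frFunctional_apply (μ : Functional (ZMod p) A) (f : A) :
    frFunctional p A μ f = μ (f ^ p) :=
  congrArg μ.ofConv (frobAlgHom_apply p f)

theorem frFunctional_mem {μ : Functional (ZMod p) A} {n n' : ℕ} (h : n < p * (n' + 1))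
    (hμ : μ ∈ distOrder (ZMod p) A n) : frFunctional p A μ ∈ distOrder (ZMod p) A n' := by
  have hle : augIdeal (ZMod p) A ^ (n' + 1) ≤
      (augIdeal (ZMod p) A ^ (n + 1)).comap (frobAlgHom p A) := by
    have h1 : augIdeal (ZMod p) A ≤ (augIdeal (ZMod p) A ^ p).comap (frobAlgHom p A) := by
      intro f hf
      rw [Ideal.mem_comap, frobAlgHom_apply]
      exact Ideal.pow_mem_pow hf p
    refine (Ideal.pow_right_mono h1 _).trans ((Ideal.le_comap_pow _ _).trans
      (Ideal.comap_mono ?_))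
    rw [← pow_mul]
    exact Ideal.pow_le_pow_right h
  exact fun f hf => hμ _ (hle hf)

/-- The Frobenius endomorphism of the algebra of distributions. -/
def frDist : dist (ZMod p) A →ₐ[ZMod p] dist (ZMod p) A :=
  ((frFunctional p A).comp (dist (ZMod p) A).val).codRestrict (dist (ZMod p) A) fun μ => by
    obtain ⟨n, hn⟩ := μ.2
    exact ⟨n, frFunctional_mem p (by nlinarith [(Fact.out : p.Prime).pos]) hn⟩

/-- The Frobenius morphism from the enveloping algebra of level `m + 1` to that of level `m`,
induced by the Frobenius endomorphism of the algebra of distributions. -/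
def frLevel (m : ℕ) : LevelAlg (ZMod p) A p (m + 1) →ₐ[ZMod p] LevelAlg (ZMod p) A p m :=
  have hp : 0 < p := (Fact.out : p.Prime).pos
  have hpm : 0 < p ^ m := Nat.pow_pos hp
  have hs : p ^ (m + 1) = p * p ^ m := pow_succ' p m
  LevelAlg.lift
    (LevelAlg.of p m ∘ₗ (frFunctional p A).toLinearMap.restrict
      (fun _ hμ => frFunctional_mem p
        (by
          rw [hs, Nat.sub_add_cancel (by lia), mul_left_comm]
          have := Nat.mul_pos hp hpm
          lia) hμ))
    ((congrArg (LevelAlg.of p m) (Subtype.ext (map_one (frFunctional p A)))).trans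
      (LevelAlg.of_one p m))
    (fun _ _ _ hμ hμ' hν => LevelAlg.of_comm _ _ _
      (frFunctional_mem p (by rw [hs]; nlinarith) hμ)
      (frFunctional_mem p (by rw [hs]; nlinarith) hμ')
      ((congrArg (frFunctional p A) hν).trans (by simp only [map_sub, map_mul]; rfl)))
    (fun _ _ _ hμ hμ' hν => LevelAlg.of_mul _ _ _
      (frFunctional_mem p
        (by
          rw [hs, Nat.sub_add_cancel hpm]
          have := Nat.mul_pos hp hpm
          lia) hμ)
      (frFunctional_mem p (by rw [hs]; nlinarith) hμ')
      ((congrArg (frFunctional p A) hν).trans (by simp only [map_mul]; rfl)))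

end Frobenius

/-! ### The group `SL₂` -/

section SL2

variable (k : Type*) [CommRing k]

open Matrix in
/-- The coordinate ring of `SL₂`: polynomials in the four matrix entries modulo `det - 1`. -/
def CoordRing : Type _ :=
  MvPolynomial (Fin 2 × Fin 2) k ⧸ Ideal.span {(mvPolynomialX (Fin 2) (Fin 2) k).det - 1}

instance : CommRing (CoordRing k) := inferInstanceAs (CommRing (_ ⧸ _))

instance : Algebra k (CoordRing k) :=
  inferInstanceAs (Algebra k (MvPolynomial (Fin 2 × Fin 2) k ⧸ _))

/-- The universal point of `SL₂`, whose entries are the four coordinate functions. -/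
def univPoint : Matrix.SpecialLinearGroup (Fin 2) (CoordRing k) :=
  ⟨(Ideal.Quotient.mk (Ideal.span {(Matrix.mvPolynomialX (Fin 2) (Fin 2) k).det - 1})).mapMatrix
      (Matrix.mvPolynomialX (Fin 2) (Fin 2) k), by
    have h : Ideal.Quotient.mk (Ideal.span {(Matrix.mvPolynomialX (Fin 2) (Fin 2) k).det - 1})
        ((Matrix.mvPolynomialX (Fin 2) (Fin 2) k).det - 1) = 0 :=
      Ideal.Quotient.eq_zero_iff_mem.2 (Ideal.subset_span rfl)
    rw [map_sub, sub_eq_zero, map_one, RingHom.map_det] at h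
    exact h⟩

variable {k}

/-- Evaluation of functions on `SL₂` at a point with values in a `k`-algebra. -/
def evalAt {R : Type*} [CommRing R] [Algebra k R] (g : Matrix.SpecialLinearGroup (Fin 2) R) :
    CoordRing k →ₐ[k] R :=
  Ideal.Quotient.liftₐ _ (MvPolynomial.aeval fun ij : Fin 2 × Fin 2 => g ij.1 ij.2) (by
    intro a ha
    refine Submodule.span_induction ?_ (map_zero _) (fun x y _ _ hx hy => ?_)
      (fun c x _ hx => ?_) ha
    · rintro _ rfl
      have h := g.2
      rw [Matrix.det_fin_two] at h
      simp [Matrix.det_fin_two, Matrix.mvPolynomialX, h]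
    · rw [map_add, hx, hy, add_zero]
    · rw [smul_eq_mul, map_mul, hx, mul_zero])

theorem evalAt_univPoint {R : Type*} [CommRing R] [Algebra k R]
    (g : Matrix.SpecialLinearGroup (Fin 2) R) (i j : Fin 2) :
    evalAt g (univPoint k i j) = g i j :=
  (MvPolynomial.aeval_X (fun ij : Fin 2 × Fin 2 => g ij.1 ij.2) (i, j))

theorem coordRing_algHom_ext {R : Type*} [CommRing R] [Algebra k R] {u v : CoordRing k →ₐ[k] R}
    (h : ∀ i j, u (univPoint k i j) = v (univPoint k i j)) : u = v :=
  Ideal.Quotient.algHom_ext _ (MvPolynomial.algHom_ext fun ij => h ij.1 ij.2)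

open Algebra.TensorProduct in
/-- Comultiplication: `x i j ↦ ∑ l, x i l ⊗ x l j`, that is, `(Δ f) (g, h) = f (g * h)`. -/
def coordComul : CoordRing k →ₐ[k] CoordRing k ⊗[k] CoordRing k :=
  evalAt
    ((univPoint k).map
        (includeLeft : CoordRing k →ₐ[k] CoordRing k ⊗[k] CoordRing k).toRingHom *
      (univPoint k).map
        (includeRight : CoordRing k →ₐ[k] CoordRing k ⊗[k] CoordRing k).toRingHom)

theorem coordComul_univPoint (i j : Fin 2) :
    coordComul (univPoint k i j) =
      ∑ l, univPoint k i l ⊗ₜ[k] univPoint k l j := by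
  rw [coordComul, evalAt_univPoint]
  simp [Matrix.mul_apply]

instance : Bialgebra k (CoordRing k) :=
  Bialgebra.ofAlgHom coordComul (evalAt 1)
    (coordRing_algHom_ext fun i j => by
      simp [coordComul_univPoint, TensorProduct.add_tmul, TensorProduct.tmul_add]
      abel)
    (coordRing_algHom_ext fun i j => by
      fin_cases i <;> fin_cases j <;> simp [coordComul_univPoint, evalAt_univPoint])
    (coordRing_algHom_ext fun i j => by
      fin_cases i <;> fin_cases j <;> simp [coordComul_univPoint, evalAt_univPoint])

theorem counit_eq_evalAt (f : CoordRing k) : Coalgebra.counit (R := k) f = evalAt 1 f := rfl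

/-- The functional `f ↦` coefficient of `t ^ n` in `f (g t)`, for a point `g` of `SL₂` with values
in power series in a variable `t`. -/
def coeffAt (g : Matrix.SpecialLinearGroup (Fin 2) k⟦X⟧) (n : ℕ) : Functional k (CoordRing k) :=
  WithConv.toConv (PowerSeries.coeff n ∘ₗ (evalAt g).toLinearMap)

theorem coeffAt_mem {g : Matrix.SpecialLinearGroup (Fin 2) k⟦X⟧}
    (hg : ∀ i j, PowerSeries.constantCoeff (g i j) = (1 : Matrix (Fin 2) (Fin 2) k) i j) (n : ℕ) :
    coeffAt g n ∈ distOrder k (CoordRing k) n := by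
  have h : augIdeal k (CoordRing k) ≤
      (Ideal.span {(PowerSeries.X : k⟦X⟧)}).comap (evalAt g) := by
    intro f hf
    rw [Ideal.mem_comap, Ideal.mem_span_singleton, PowerSeries.X_dvd_iff]
    have h2 : (evalAt 1 : CoordRing k →ₐ[k] k) =
        (AlgHom.mk (PowerSeries.constantCoeff (R := k)) fun c => by simp : k⟦X⟧ →ₐ[k] k).comp (evalAt g) := by
      refine coordRing_algHom_ext fun i j => ?_
      rw [AlgHom.comp_apply, evalAt_univPoint, evalAt_univPoint]
      exact (hg i j).symm
    have h3 := DFunLike.congr_fun h2 f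
    exact h3.symm.trans hf
  intro f hf
  have h2 := (Ideal.pow_right_mono h _).trans (Ideal.le_comap_pow _ _) hf
  rw [Ideal.mem_comap, Ideal.span_singleton_pow, Ideal.mem_span_singleton,
    PowerSeries.X_pow_dvd_iff] at h2
  exact h2 n n.lt_succ_self

end SL2

section Generators

variable (k : Type*) [Field k]

/-- The one-parameter subgroup `t ↦ !![1, t; 0, 1]`. -/
def upper : Matrix.SpecialLinearGroup (Fin 2) k⟦X⟧ :=
  ⟨!![1, PowerSeries.X; 0, 1], by simp [Matrix.det_fin_two]⟩

/-- The one-parameter subgroup `t ↦ !![1, 0; t, 1]`. -/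
def lower : Matrix.SpecialLinearGroup (Fin 2) k⟦X⟧ :=
  ⟨!![1, 0; PowerSeries.X, 1], by simp [Matrix.det_fin_two]⟩

/-- The diagonal torus, with the coordinate `t` centred at the unit element:
`t ↦ !![1 + t, 0; 0, (1 + t)⁻¹]`. -/
def diagonal : Matrix.SpecialLinearGroup (Fin 2) k⟦X⟧ :=
  ⟨!![1 + PowerSeries.X, 0; 0, (1 + PowerSeries.X)⁻¹], by
    simp [Matrix.det_fin_two, PowerSeries.mul_inv_cancel]⟩

/-- The divided power `E ^ [n]`, of the standard nilpotent `E = !![0, 1; 0, 0]`. -/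
def divE (n : ℕ) : Functional k (CoordRing k) := coeffAt (upper k) n

/-- The divided power `F ^ [n]`, of the standard nilpotent `F = !![0, 0; 1, 0]`. -/
def divF (n : ℕ) : Functional k (CoordRing k) := coeffAt (lower k) n

/-- The binomial `binom(H, n)`, for `H = !![1, 0; 0, -1]`. -/
def binomH (n : ℕ) : Functional k (CoordRing k) := coeffAt (diagonal k) n

theorem divE_mem (n : ℕ) : divE k n ∈ distOrder k (CoordRing k) n :=
  coeffAt_mem (by intro i j; fin_cases i <;> fin_cases j <;> simp [upper]) n

theorem divF_mem (n : ℕ) : divF k n ∈ distOrder k (CoordRing k) n :=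
  coeffAt_mem (by intro i j; fin_cases i <;> fin_cases j <;> simp [lower]) n

theorem binomH_mem (n : ℕ) : binomH k n ∈ distOrder k (CoordRing k) n :=
  coeffAt_mem (by intro i j; fin_cases i <;> fin_cases j <;> simp [diagonal]) n

end Generators

/-! ### The algebras over the field with `p` elements, and the norm of the torus -/

section Norm

theorem div_prime_lt {p m n : ℕ} (hn : n < 2 * p ^ (m + 1)) : n / p < 2 * p ^ m := by
  apply Nat.div_lt_of_lt_mul
  rw [pow_succ] at hn
  lia

variable (p : ℕ) [Fact p.Prime]

/-- The algebra of distributions of `SL₂` over the field with `p` elements. -/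
abbrev DistAlg : Type := dist (ZMod p) (CoordRing (ZMod p))

/-- The enveloping algebra of level `m` of `SL₂` over the field with `p` elements. -/
abbrev U (m : ℕ) : Type := LevelAlg (ZMod p) (CoordRing (ZMod p)) p m

/-- `E ^ [n]` in the algebra of distributions. -/
def distE (n : ℕ) : DistAlg p := ⟨divE (ZMod p) n, n, divE_mem (ZMod p) n⟩

/-- `F ^ [n]` in the algebra of distributions. -/
def distF (n : ℕ) : DistAlg p := ⟨divF (ZMod p) n, n, divF_mem (ZMod p) n⟩

/-- `binom(H, n)` in the algebra of distributions. -/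
def distH (n : ℕ) : DistAlg p := ⟨binomH (ZMod p) n, n, binomH_mem (ZMod p) n⟩

/-- The norm `∑_{i < p} (-1) ^ i binom(H, i)` in the algebra of distributions. -/
def distNorm : DistAlg p := ∑ i ∈ Finset.range p, (-1 : ZMod p) ^ i • distH p i

/-- `E ^ [n]` in the enveloping algebra of level `m`, for `n ≤ 2 p ^ m - 1`. -/
def levelE (m : ℕ) {n : ℕ} (hn : n < 2 * p ^ m) : U p m :=
  LevelAlg.of p m ⟨divE (ZMod p) n, distOrder_mono (Nat.le_sub_one_of_lt hn) (divE_mem (ZMod p) n)⟩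

/-- `F ^ [n]` in the enveloping algebra of level `m`, for `n ≤ 2 p ^ m - 1`. -/
def levelF (m : ℕ) {n : ℕ} (hn : n < 2 * p ^ m) : U p m :=
  LevelAlg.of p m ⟨divF (ZMod p) n, distOrder_mono (Nat.le_sub_one_of_lt hn) (divF_mem (ZMod p) n)⟩

/-- `binom(H, n)` in the enveloping algebra of level `m`, for `n ≤ 2 p ^ m - 1`. -/
def levelH (m : ℕ) {n : ℕ} (hn : n < 2 * p ^ m) : U p m :=
  LevelAlg.of p m
    ⟨binomH (ZMod p) n, distOrder_mono (Nat.le_sub_one_of_lt hn) (binomH_mem (ZMod p) n)⟩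

variable {p}

theorem lt_of_lt_prime (m : ℕ) (i : Fin p) : (i : ℕ) < 2 * p ^ (m + 1) := by
  have hm : 0 < p ^ m := Nat.pow_pos (Fact.out : p.Prime).pos
  have hi := i.2
  rw [pow_succ]
  nlinarith

theorem mul_prime_lt {m n : ℕ} (hn : n < 2 * p ^ m) : n * p < 2 * p ^ (m + 1) := by
  have hp : 0 < p := (Fact.out : p.Prime).pos
  rw [pow_succ, ← mul_assoc]
  exact Nat.mul_lt_mul_of_pos_right hn hp

variable (p)

/-- The norm `∑_{i < p} (-1) ^ i binom(H, i)` in the enveloping algebra of level `m + 1`. -/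
def levelNorm (m : ℕ) : U p (m + 1) :=
  ∑ i : Fin p, (-1 : ZMod p) ^ (i : ℕ) • levelH p (m + 1) (lt_of_lt_prime m i)

/-- The formulas that prescribe the splitting at level `m`. -/
def LevelFormulas (m : ℕ) (ψ : U p m →ₙₐ[ZMod p] U p (m + 1)) : Prop :=
  ∀ (i : ℕ) (hi : i < 2 * p ^ m),
    ψ (levelE p m hi) = levelE p (m + 1) (mul_prime_lt hi) * levelNorm p m ∧
    ψ (levelF p m hi) = levelF p (m + 1) (mul_prime_lt hi) * levelNorm p m ∧
    ψ (levelH p m hi) = levelH p (m + 1) (mul_prime_lt hi) * levelNorm p m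

/-- The formulas that prescribe the splitting on the algebra of distributions. -/
def DistFormulas (ψ : DistAlg p →ₙₐ[ZMod p] DistAlg p) : Prop :=
  ∀ i : ℕ,
    ψ (distE p i) = distE p (i * p) * distNorm p ∧
    ψ (distF p i) = distF p (i * p) * distNorm p ∧
    ψ (distH p i) = distH p (i * p) * distNorm p

end Norm

end DistSL2

end

/-! A functional on `SL₂` that factors through restriction to the torus is a function `u` on the
weights `ℤ`: it sends the character of weight `h` to `u h` (`torusFunctional`). Convolution becomes
the pointwise product, binom(H, n) becomes h ↦ binom(h, n), and passing E^[c] or F^[a] shifts the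
argument by 2c or -2a. Modulo `p` the norm becomes the indicator function of `pℤ`
(`sum_zbinom_eq_primeIndicator`), hence an idempotent e that commutes with all E^[pc], F^[pa] and
torus functionals.

The ordered monomials F^[a] binom(H, b) E^[c] of degree at most `n` form a basis of the
distributions of order at most `n` (`pbw_linearIndependent`, `distOrder_eq_span`). The splitting
sends F^[a] u E^[c] to F^[pa] û E^[pc], where û(ph) = u(h) and û vanishes off `pℤ`. It is
multiplicative (`frobSplit_mul`): in the expansion of E^[pc] F^[pa] the coefficients binom(h, K) are
evaluated at multiples of `p`, where they vanish modulo `p` unless `p` divides `K`, and then equal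
binom(h/p, K/p); Lucas' congruence treats the other coefficients.

At level `m` only few products are imposed, so each identity of distributions used must be shown to
hold in the enveloping algebra. The main tool is `levelOf_mul`: products of total order less than
2p^m are respected. It follows from `distOrder_le_mul`, a factorization of the distributions of
order between p^m and 2p^m - 1, which rests on the divided power structure of the graded algebra and
the digit argument `exists_split`. With it the product relations for the splitting are immediate.
The commutator relations reduce to the three generators of order p^m
(`map_commutator_of_generators`), where the question is whether multiplying a commutator by e stays
within the admissible orders: either the commutator has order lower by `p`, or the offending terms
are killed by e.

The universal property yields unital morphisms, whereas the splitting sends 1 to e. So μ ↦ φ(μ) +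
ε(μ)(1 - e) is extended first, with ε(μ) the value of μ at the function 1, and the result is
multiplied by e. -/

open scoped TensorProduct PowerSeries

noncomputable section

namespace DistSL2

/-! ### Functionals attached to points of `SL₂` with values in an algebra. -/

section Points

variable {k : Type*} [CommRing k]

/-- The functional `f ↦ l (f g)` on `SL₂`, for a point `g` with values in `R` and a linear form `l`
on `R`. -/
def pointFunctional {R : Type*} [CommRing R] [Algebra k R]
    (g : Matrix.SpecialLinearGroup (Fin 2) R) (l : R →ₗ[k] k) : Functional k (CoordRing k) :=
  WithConv.toConv (l ∘ₗ (evalAt g).toLinearMap)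

theorem pointFunctional_apply {R : Type*} [CommRing R] [Algebra k R]
    (g : Matrix.SpecialLinearGroup (Fin 2) R) (l : R →ₗ[k] k) (f : CoordRing k) :
    pointFunctional g l f = l (evalAt g f) := rfl

/-- The image of a point of `SL₂` under a morphism of algebras. -/
def mapPoint {R S : Type*} [CommRing R] [Algebra k R] [CommRing S] [Algebra k S]
    (g : Matrix.SpecialLinearGroup (Fin 2) R) (π : R →ₐ[k] S) :
    Matrix.SpecialLinearGroup (Fin 2) S := g.map π.toRingHom

theorem mapPoint_apply {R S : Type*} [CommRing R] [Algebra k R] [CommRing S] [Algebra k S]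
    (g : Matrix.SpecialLinearGroup (Fin 2) R) (π : R →ₐ[k] S) (i j : Fin 2) :
    mapPoint g π i j = π (g i j) := rfl

theorem evalAt_map {R S : Type*} [CommRing R] [Algebra k R] [CommRing S] [Algebra k S]
    (g : Matrix.SpecialLinearGroup (Fin 2) R) (π : R →ₐ[k] S) :
    evalAt (mapPoint g π) = π.comp (evalAt g) :=
  coordRing_algHom_ext fun i j => by
    rw [AlgHom.comp_apply, evalAt_univPoint, evalAt_univPoint]
    rfl

theorem pointFunctional_map {R S : Type*} [CommRing R] [Algebra k R] [CommRing S] [Algebra k S]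
    (g : Matrix.SpecialLinearGroup (Fin 2) R) (π : R →ₐ[k] S) (l : S →ₗ[k] k) :
    pointFunctional (mapPoint g π) l = pointFunctional g (l ∘ₗ π.toLinearMap) := by
  ext f
  simp only [pointFunctional_apply, evalAt_map]
  rfl

theorem productMap_comul {R R' S : Type*} [CommRing R] [Algebra k R] [CommRing R'] [Algebra k R']
    [CommRing S] [Algebra k S] (g : Matrix.SpecialLinearGroup (Fin 2) R)
    (g' : Matrix.SpecialLinearGroup (Fin 2) R') (i : R →ₐ[k] S) (j : R' →ₐ[k] S) :
    (Algebra.TensorProduct.productMap (i.comp (evalAt g)) (j.comp (evalAt g'))).comp coordComul =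
      evalAt (mapPoint g i * mapPoint g' j) :=
  coordRing_algHom_ext fun a b => by
    rw [AlgHom.comp_apply, coordComul_univPoint, evalAt_univPoint, map_sum]
    simp [Matrix.mul_apply, evalAt_univPoint, mapPoint_apply]

/-- The comultiplication is evaluation at a product of points. Allowing any common target `S`
instead of the tensor product makes it possible to compute in power series, where an element outside
the big cell coordinates can be rewritten in them. -/
theorem pointFunctional_mul {R R' S : Type*} [CommRing R] [Algebra k R] [CommRing R']
    [Algebra k R'] [CommRing S] [Algebra k S] (g : Matrix.SpecialLinearGroup (Fin 2) R)
    (g' : Matrix.SpecialLinearGroup (Fin 2) R') (l : R →ₗ[k] k) (l' : R' →ₗ[k] k)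
    (i : R →ₐ[k] S) (j : R' →ₐ[k] S) (L : S →ₗ[k] k) (hL : ∀ x y, L (i x * j y) = l x * l' y) :
    pointFunctional g l * pointFunctional g' l' =
      pointFunctional (mapPoint g i * mapPoint g' j) L := by
  ext f
  rw [LinearMap.convMul_apply, pointFunctional_apply, ← productMap_comul, AlgHom.comp_apply]
  change _ = L (Algebra.TensorProduct.productMap (i.comp (evalAt g)) (j.comp (evalAt g'))
    (Coalgebra.comul (R := k) f))
  induction Coalgebra.comul (R := k) f with
  | zero => simp
  | add x y hx hy => simp only [map_add, hx, hy]
  | tmul x y => simp [hL, pointFunctional]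

end Points

/-! ### Linear forms on monoid algebras. -/

section Weights

variable {k : Type*} [CommRing k] {M M' : Type*}

/-- The linear form on a monoid algebra with prescribed values on the monoid. -/
def weightForm (w : M → k) : AddMonoidAlgebra k M →ₗ[k] k :=
  Finsupp.linearCombination k w ∘ₗ (AddMonoidAlgebra.coeffLinearEquiv k).toLinearMap

@[simp]
theorem weightForm_single (w : M → k) (m : M) (c : k) :
    weightForm w (AddMonoidAlgebra.single m c) = c * w m := by
  simp [weightForm]

theorem weightForm_eq {w : M → k} {l : AddMonoidAlgebra k M →ₗ[k] k}
    (h : ∀ m, l (AddMonoidAlgebra.single m 1) = w m) : l = weightForm w := by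
  refine AddMonoidAlgebra.lhom_ext' fun m => LinearMap.ext_ring ?_
  simp [h]

variable [AddCommMonoid M] [AddCommMonoid M']

theorem weightForm_map (f : M →+ M') (w : M' → k) :
    weightForm w ∘ₗ (AddMonoidAlgebra.mapDomainAlgHom k k f).toLinearMap =
      weightForm (w ∘ f) := by
  refine weightForm_eq fun m => ?_
  simp

/-- The algebra of `M × M'` plays the role of the tensor product of the two monoid algebras, so an
identity between functionals becomes a matrix identity plus a comparison of weights. -/
theorem pointFunctional_weight_mul (g : Matrix.SpecialLinearGroup (Fin 2) (AddMonoidAlgebra k M))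
    (g' : Matrix.SpecialLinearGroup (Fin 2) (AddMonoidAlgebra k M')) (w : M → k) (w' : M' → k) :
    pointFunctional g (weightForm w) * pointFunctional g' (weightForm w') =
      pointFunctional
        (mapPoint g (AddMonoidAlgebra.mapDomainAlgHom k k (AddMonoidHom.inl M M')) *
          mapPoint g' (AddMonoidAlgebra.mapDomainAlgHom k k (AddMonoidHom.inr M M')))
        (weightForm fun m => w m.1 * w' m.2) := by
  refine pointFunctional_mul _ _ _ _ _ _ _ fun x y => ?_
  induction x using AddMonoidAlgebra.induction_linear with
  | zero => simp
  | add x x' hx hx' => simp only [map_add, add_mul, hx, hx']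
  | single m c =>
    induction y using AddMonoidAlgebra.induction_linear with
    | zero => simp
    | add x x' hx hx' => simp only [map_add, mul_add, hx, hx']
    | single m' c' =>
      simp [AddMonoidAlgebra.single_mul_single]
      ring

end Weights

/-! ### Binomial coefficients of integers as functions on the weights. -/

section Torus

variable (k : Type*) [Field k]

/-- `1 + X`, as a unit of the ring of power series. -/
def onePlusX : (k⟦X⟧)ˣ where
  val := 1 + PowerSeries.X
  inv := (1 + PowerSeries.X)⁻¹
  val_inv := PowerSeries.mul_inv_cancel _ (by simp)
  inv_val := PowerSeries.inv_mul_cancel _ (by simp)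

/-- The reduction of the binomial coefficient of an integer, as the coefficient of `X ^ n` in
`(1 + X) ^ h`. -/
def zbinom (n : ℕ) (h : ℤ) : k := PowerSeries.coeff n ((onePlusX k ^ h : (k⟦X⟧)ˣ) : k⟦X⟧)

theorem onePlusX_val : (onePlusX k : k⟦X⟧) = 1 + PowerSeries.X := rfl

theorem zbinom_zero_left (h : ℤ) : zbinom k 0 h = 1 := by
  have h1 : Units.map (PowerSeries.constantCoeff (R := k)).toMonoidHom (onePlusX k) = 1 :=
    Units.ext (by simp [onePlusX_val])
  have h2 := congrArg Units.val
    (map_zpow (Units.map (PowerSeries.constantCoeff (R := k)).toMonoidHom) (onePlusX k) h)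
  rw [h1, one_zpow] at h2
  rw [zbinom, PowerSeries.coeff_zero_eq_constantCoeff_apply]
  exact h2

/-- Vandermonde's identity, valid for negative arguments too because 1 + X is a unit. -/
theorem zbinom_add (n : ℕ) (h h' : ℤ) :
    zbinom k n (h + h') = ∑ ij ∈ Finset.HasAntidiagonal.antidiagonal n,
      zbinom k ij.1 h * zbinom k ij.2 h' := by
  rw [zbinom, zpow_add, Units.val_mul, PowerSeries.coeff_mul]
  rfl

theorem zbinom_natCast (n m : ℕ) : zbinom k n m = (m.choose n : k) := by
  have : (1 + PowerSeries.X : k⟦X⟧) = ((1 + Polynomial.X : Polynomial k) : k⟦X⟧) := by simp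
  rw [zbinom, zpow_natCast, Units.val_pow_eq_pow_val, onePlusX_val, this, ← Polynomial.coe_pow,
    Polynomial.coeff_coe, add_comm, Polynomial.coeff_X_add_one_pow]

theorem zbinom_succ (n : ℕ) (h : ℤ) :
    zbinom k (n + 1) (h + 1) = zbinom k (n + 1) h + zbinom k n h := by
  rw [zbinom, zpow_add_one, Units.val_mul, onePlusX_val, mul_add, mul_one, map_add,
    PowerSeries.coeff_succ_mul_X]
  rfl

end Torus

/-! ### The generators as functionals at points, and their simple commutation rules. -/

section Generators

variable {k : Type*} [Field k]

theorem specialLinear_ext {R : Type*} [CommRing R] {g g' : Matrix.SpecialLinearGroup (Fin 2) R}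
    (h00 : g 0 0 = g' 0 0) (h01 : g 0 1 = g' 0 1) (h10 : g 1 0 = g' 1 0) (h11 : g 1 1 = g' 1 1) :
    g = g' := by
  ext i j : 2
  fin_cases i <;> fin_cases j <;> assumption

theorem specialLinear_mul_apply {R : Type*} [CommRing R]
    (g g' : Matrix.SpecialLinearGroup (Fin 2) R) (i j : Fin 2) :
    (g * g') i j = g i 0 * g' 0 j + g i 1 * g' 1 j := by
  simp [Matrix.SpecialLinearGroup.coe_mul, Matrix.mul_apply, Fin.sum_univ_two]

/-- The upper unipotent subgroup, with polynomial entries. -/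
def upperPoint : Matrix.SpecialLinearGroup (Fin 2) (AddMonoidAlgebra k ℕ) :=
  ⟨!![1, .single 1 1; 0, 1], by simp [Matrix.det_fin_two]⟩

theorem upperPoint_apply (i j : Fin 2) : (upperPoint (k := k)) i j =
    (!![1, .single 1 1; 0, 1] :
      Matrix (Fin 2) (Fin 2) (AddMonoidAlgebra k ℕ)) i j := rfl

/-- The lower unipotent subgroup, with polynomial entries. -/
def lowerPoint : Matrix.SpecialLinearGroup (Fin 2) (AddMonoidAlgebra k ℕ) :=
  ⟨!![1, 0; .single 1 1, 1], by simp [Matrix.det_fin_two]⟩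

theorem lowerPoint_apply (i j : Fin 2) : (lowerPoint (k := k)) i j =
    (!![1, 0; .single 1 1, 1] :
      Matrix (Fin 2) (Fin 2) (AddMonoidAlgebra k ℕ)) i j := rfl

/-- The diagonal torus, with Laurent polynomial entries. -/
def diagPoint : Matrix.SpecialLinearGroup (Fin 2) (AddMonoidAlgebra k ℤ) :=
  ⟨!![.single 1 1, 0; 0, .single (-1) 1], by
    simp [-LaurentPolynomial.single_eq_C_mul_T, Matrix.det_fin_two,
      AddMonoidAlgebra.single_mul_single, AddMonoidAlgebra.one_def]⟩

theorem diagPoint_apply (i j : Fin 2) : (diagPoint (k := k)) i j =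
    (!![.single 1 1, 0; 0, .single (-1) 1] :
      Matrix (Fin 2) (Fin 2) (AddMonoidAlgebra k ℤ)) i j := rfl

/-- The universal point of the big cell. -/
def cellPoint : Matrix.SpecialLinearGroup (Fin 2) (AddMonoidAlgebra k ((ℕ × ℤ) × ℕ)) :=
  ⟨!![.single ((0, 1), 0) 1, .single ((0, 1), 1) 1;
    .single ((1, 1), 0) 1, .single ((1, 1), 1) 1 + .single ((0, -1), 0) 1], by
    simp [Matrix.det_fin_two, AddMonoidAlgebra.single_mul_single, AddMonoidAlgebra.one_def,
      mul_add, Prod.zero_eq_mk]⟩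

theorem cellPoint_apply (i j : Fin 2) : (cellPoint (k := k)) i j =
    (!![.single ((0, 1), 0) 1, .single ((0, 1), 1) 1;
      .single ((1, 1), 0) 1, .single ((1, 1), 1) 1 + .single ((0, -1), 0) 1] :
      Matrix (Fin 2) (Fin 2) (AddMonoidAlgebra k ((ℕ × ℤ) × ℕ))) i j := rfl

/-- The functional that integrates a function against the restriction to the torus, whose points
are identified with the weights. -/
def torusFunctional (u : ℤ → k) : Functional k (CoordRing k) :=
  pointFunctional diagPoint (weightForm u)

/-- The functional with prescribed values on the monomials of the big cell. -/
def cellFunctional (w : ((ℕ × ℤ) × ℕ) → k) : Functional k (CoordRing k) :=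
  pointFunctional cellPoint (weightForm w)

/-- The power series points come from points over monoid algebras, where the calculus of weights
applies. -/
theorem upper_eq_map : upper k = mapPoint upperPoint
    (AddMonoidAlgebra.lift k k⟦X⟧ ℕ (powersHom _ PowerSeries.X)) := by
  apply specialLinear_ext <;> simp [mapPoint_apply, upper, upperPoint_apply]

theorem lower_eq_map : lower k = mapPoint lowerPoint
    (AddMonoidAlgebra.lift k k⟦X⟧ ℕ (powersHom _ PowerSeries.X)) := by
  apply specialLinear_ext <;> simp [mapPoint_apply, lower, lowerPoint_apply]

/-- The evaluation of Laurent polynomials at a unit. -/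
def laurentEval {R : Type*} [CommRing R] [Algebra k R] (v : Rˣ) : AddMonoidAlgebra k ℤ →ₐ[k] R :=
  AddMonoidAlgebra.lift k R ℤ ((Units.coeHom R).comp (zpowersHom _ v))

@[simp]
theorem laurentEval_single {R : Type*} [CommRing R] [Algebra k R] (v : Rˣ) (h : ℤ) (c : k) :
    laurentEval v (.single h c) = c • ((v ^ h : Rˣ) : R) := by
  simp [-LaurentPolynomial.single_eq_C_mul_T, laurentEval]

theorem diagonal_eq_map : diagonal k = mapPoint diagPoint (laurentEval (k := k) (onePlusX k)) := by
  apply specialLinear_ext <;>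
    simp [-LaurentPolynomial.single_eq_C_mul_T, mapPoint_apply, diagonal, diagPoint_apply]
  · rfl
  · rfl

theorem divE_eq (n : ℕ) : divE k n = pointFunctional upperPoint (weightForm (Pi.single n 1)) := by
  change pointFunctional (upper k) (PowerSeries.coeff n) = _
  rw [upper_eq_map, pointFunctional_map]
  congr 1
  refine weightForm_eq fun m => ?_
  simp [PowerSeries.coeff_X_pow, Pi.single_apply, eq_comm]

theorem divF_eq (n : ℕ) : divF k n = pointFunctional lowerPoint (weightForm (Pi.single n 1)) := by
  change pointFunctional (lower k) (PowerSeries.coeff n) = _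
  rw [lower_eq_map, pointFunctional_map]
  congr 1
  refine weightForm_eq fun m => ?_
  simp [PowerSeries.coeff_X_pow, Pi.single_apply, eq_comm]

theorem binomH_eq (n : ℕ) : binomH k n = torusFunctional (zbinom k n) := by
  change pointFunctional (diagonal k) (PowerSeries.coeff n) = _
  rw [diagonal_eq_map, pointFunctional_map]
  unfold torusFunctional
  congr 1
  refine weightForm_eq fun m => ?_
  simp [-LaurentPolynomial.single_eq_C_mul_T]
  rfl

theorem torusFunctional_add (u u' : ℤ → k) :
    torusFunctional (u + u') = torusFunctional u + torusFunctional u' := by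
  have : weightForm (u + u') = weightForm u + weightForm u' :=
    (weightForm_eq fun m => by simp [-LaurentPolynomial.single_eq_C_mul_T]).symm
  rw [torusFunctional, this]
  rfl

theorem torusFunctional_smul (c : k) (u : ℤ → k) :
    torusFunctional (c • u) = c • torusFunctional u := by
  have : weightForm (c • u) = c • weightForm u :=
    (weightForm_eq fun m => by simp [-LaurentPolynomial.single_eq_C_mul_T]).symm
  rw [torusFunctional, this]
  rfl

/-- A character of weight h pulls back along the multiplication of the torus to weight (h, h); the
product weight form is thus restricted to the diagonal. -/
theorem torusFunctional_mul (u u' : ℤ → k) :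
    torusFunctional u * torusFunctional u' = torusFunctional (u * u') := by
  rw [torusFunctional, torusFunctional, pointFunctional_weight_mul]
  have : mapPoint diagPoint (AddMonoidAlgebra.mapDomainAlgHom k k (AddMonoidHom.inl ℤ ℤ)) *
      mapPoint diagPoint (AddMonoidAlgebra.mapDomainAlgHom k k (AddMonoidHom.inr ℤ ℤ)) =
      mapPoint diagPoint (AddMonoidAlgebra.mapDomainAlgHom k k
        ((AddMonoidHom.id ℤ).prod (AddMonoidHom.id ℤ))) := by
    apply specialLinear_ext <;>
      simp [-LaurentPolynomial.single_eq_C_mul_T, mapPoint_apply, specialLinear_mul_apply,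
        diagPoint_apply, AddMonoidAlgebra.single_mul_single]
  rw [this, pointFunctional_map, weightForm_map]
  rfl

theorem torusFunctional_one : torusFunctional (1 : ℤ → k) = 1 := by
  ext f
  have h : (evalAt 1 : CoordRing k →ₐ[k] k) = (laurentEval (1 : kˣ)).comp (evalAt diagPoint) := by
    rw [← evalAt_map]
    congr 1
    apply specialLinear_ext <;>
      simp [-LaurentPolynomial.single_eq_C_mul_T, mapPoint_apply, diagPoint_apply]
  have h2 : (laurentEval (1 : kˣ)).toLinearMap = weightForm (1 : ℤ → k) :=
    weightForm_eq fun m => by simp [-LaurentPolynomial.single_eq_C_mul_T]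
  rw [LinearMap.convOne_apply, counit_eq_evalAt, h, torusFunctional, pointFunctional_apply, ← h2]
  rfl

/-- This is the extraction of the coefficient of x^c y^c' from (x + y)^n; it produces the binomial
coefficient in products of divided powers. -/
theorem weightForm_add_pow (c c' n : ℕ) :
    weightForm (fun m : ℕ × ℕ => (Pi.single c 1 : ℕ → k) m.1 * (Pi.single c' 1 : ℕ → k) m.2)
      ((.single (1, 0) 1 + .single (0, 1) 1 : AddMonoidAlgebra k (ℕ × ℕ)) ^ n) =
      ((c + c').choose c : k) * (Pi.single (c + c') 1 : ℕ → k) n := by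
  have h : ∀ i ∈ Finset.range (n + 1), weightForm
      (fun m : ℕ × ℕ => (Pi.single c 1 : ℕ → k) m.1 * (Pi.single c' 1 : ℕ → k) m.2)
      ((.single (1, 0) 1 : AddMonoidAlgebra k (ℕ × ℕ)) ^ i * .single (0, 1) 1 ^ (n - i) *
        (n.choose i : AddMonoidAlgebra k (ℕ × ℕ))) =
      (n.choose i : k) * ((Pi.single c 1 : ℕ → k) i * (Pi.single c' 1 : ℕ → k) (n - i)) := by
    intro i _
    rw [mul_comm, ← nsmul_eq_mul, map_nsmul, AddMonoidAlgebra.single_pow,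
      AddMonoidAlgebra.single_pow, AddMonoidAlgebra.single_mul_single, weightForm_single,
      nsmul_eq_mul]
    simp
  rw [add_pow, map_sum, Finset.sum_congr rfl h]
  by_cases hn : n = c + c'
  · subst hn
    rw [Finset.sum_eq_single c]
    · simp
    · intro i _ hi
      simp [hi]
    · intro h
      simp at h
  · rw [Pi.single_eq_of_ne hn, mul_zero]
    refine Finset.sum_eq_zero fun i hi => ?_
    rw [Finset.mem_range] at hi
    by_cases hc : i = c
    · rw [Pi.single_eq_of_ne (i := c') (i' := n - i) (by lia)]
      simp
    · simp [hc]

theorem smul_pointFunctional {R : Type*} [CommRing R] [Algebra k R] (c : k)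
    (g : Matrix.SpecialLinearGroup (Fin 2) R) (l : R →ₗ[k] k) :
    c • pointFunctional g l = pointFunctional g (c • l) := rfl

theorem divE_mul_divE (c c' : ℕ) :
    divE k c * divE k c' = ((c + c').choose c : k) • divE k (c + c') := by
  rw [divE_eq, divE_eq, divE_eq, pointFunctional_weight_mul, smul_pointFunctional]
  have : mapPoint upperPoint (AddMonoidAlgebra.mapDomainAlgHom k k (AddMonoidHom.inl ℕ ℕ)) *
      mapPoint upperPoint (AddMonoidAlgebra.mapDomainAlgHom k k (AddMonoidHom.inr ℕ ℕ)) =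
      mapPoint upperPoint (AddMonoidAlgebra.lift k (AddMonoidAlgebra k (ℕ × ℕ)) ℕ
        (powersHom _ (.single (1, 0) 1 + .single (0, 1) 1))) := by
    apply specialLinear_ext <;>
      simp [mapPoint_apply, specialLinear_mul_apply, upperPoint_apply, add_comm]
  rw [this, pointFunctional_map]
  congr 1
  refine (weightForm_eq fun m => rfl).trans (weightForm_eq fun m => ?_).symm
  simp [weightForm_add_pow]

theorem divF_mul_divF (c c' : ℕ) :
    divF k c * divF k c' = ((c + c').choose c : k) • divF k (c + c') := by
  rw [divF_eq, divF_eq, divF_eq, pointFunctional_weight_mul, smul_pointFunctional]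
  have : mapPoint lowerPoint (AddMonoidAlgebra.mapDomainAlgHom k k (AddMonoidHom.inl ℕ ℕ)) *
      mapPoint lowerPoint (AddMonoidAlgebra.mapDomainAlgHom k k (AddMonoidHom.inr ℕ ℕ)) =
      mapPoint lowerPoint (AddMonoidAlgebra.lift k (AddMonoidAlgebra k (ℕ × ℕ)) ℕ
        (powersHom _ (.single (1, 0) 1 + .single (0, 1) 1))) := by
    apply specialLinear_ext <;>
      simp [mapPoint_apply, specialLinear_mul_apply, lowerPoint_apply]
  rw [this, pointFunctional_map]
  congr 1
  refine (weightForm_eq fun m => rfl).trans (weightForm_eq fun m => ?_).symm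
  simp [weightForm_add_pow]

theorem divE_zero : divE k 0 = 1 := by
  ext f
  have h : (evalAt 1 : CoordRing k →ₐ[k] k) =
      (AddMonoidAlgebra.lift k k ℕ (powersHom _ 0)).comp (evalAt upperPoint) := by
    rw [← evalAt_map]
    congr 1
    apply specialLinear_ext <;> simp [mapPoint_apply, upperPoint_apply]
  have h2 : (AddMonoidAlgebra.lift k k ℕ (powersHom _ 0)).toLinearMap =
      weightForm (Pi.single 0 1 : ℕ → k) :=
    weightForm_eq fun m => by simp [Pi.single_apply, zero_pow_eq]
  rw [LinearMap.convOne_apply, counit_eq_evalAt, h, divE_eq, pointFunctional_apply, ← h2]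
  rfl

theorem divF_zero : divF k 0 = 1 := by
  ext f
  have h : (evalAt 1 : CoordRing k →ₐ[k] k) =
      (AddMonoidAlgebra.lift k k ℕ (powersHom _ 0)).comp (evalAt lowerPoint) := by
    rw [← evalAt_map]
    congr 1
    apply specialLinear_ext <;> simp [mapPoint_apply, lowerPoint_apply]
  have h2 : (AddMonoidAlgebra.lift k k ℕ (powersHom _ 0)).toLinearMap =
      weightForm (Pi.single 0 1 : ℕ → k) :=
    weightForm_eq fun m => by simp [Pi.single_apply, zero_pow_eq]
  rw [LinearMap.convOne_apply, counit_eq_evalAt, h, divF_eq, pointFunctional_apply, ← h2]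
  rfl

/-- Conjugating the upper unipotent element t by the torus element z gives z²t. On monomials this is
the additive map `f` below, which adds twice the unipotent exponent to the weight. -/
theorem torusFunctional_mul_divE (u : ℤ → k) (c : ℕ) :
    torusFunctional u * divE k c = divE k c * torusFunctional fun h => u (h + 2 * c) := by
  rw [divE_eq, torusFunctional, torusFunctional, pointFunctional_weight_mul,
    pointFunctional_weight_mul]
  let f : ℕ × ℤ →+ ℤ × ℕ :=
    { toFun := fun m => (m.2 + 2 * m.1, m.1)
      map_zero' := by simp
      map_add' := fun m m' => by ext <;> simp; ring }
  have : mapPoint diagPoint (AddMonoidAlgebra.mapDomainAlgHom k k (AddMonoidHom.inl ℤ ℕ)) *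
      mapPoint upperPoint (AddMonoidAlgebra.mapDomainAlgHom k k (AddMonoidHom.inr ℤ ℕ)) =
      mapPoint (mapPoint upperPoint
          (AddMonoidAlgebra.mapDomainAlgHom k k (AddMonoidHom.inl ℕ ℤ)) *
        mapPoint diagPoint (AddMonoidAlgebra.mapDomainAlgHom k k (AddMonoidHom.inr ℕ ℤ)))
        (AddMonoidAlgebra.mapDomainAlgHom k k f) := by
    apply specialLinear_ext <;>
      simp [-LaurentPolynomial.single_eq_C_mul_T, mapPoint_apply, specialLinear_mul_apply,
        diagPoint_apply, upperPoint_apply, AddMonoidAlgebra.single_mul_single, f]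
  rw [this, pointFunctional_map, weightForm_map]
  congr 2
  funext m
  by_cases h : m.1 = c
  · simp [f, h]
  · simp [f, h]

theorem torusFunctional_mul_divF (u : ℤ → k) (a : ℕ) :
    torusFunctional u * divF k a = divF k a * torusFunctional fun h => u (h - 2 * a) := by
  rw [divF_eq, torusFunctional, torusFunctional, pointFunctional_weight_mul,
    pointFunctional_weight_mul]
  let f : ℕ × ℤ →+ ℤ × ℕ :=
    { toFun := fun m => (m.2 - 2 * m.1, m.1)
      map_zero' := by simp
      map_add' := fun m m' => by ext <;> simp; ring }
  have : mapPoint diagPoint (AddMonoidAlgebra.mapDomainAlgHom k k (AddMonoidHom.inl ℤ ℕ)) *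
      mapPoint lowerPoint (AddMonoidAlgebra.mapDomainAlgHom k k (AddMonoidHom.inr ℤ ℕ)) =
      mapPoint (mapPoint lowerPoint
          (AddMonoidAlgebra.mapDomainAlgHom k k (AddMonoidHom.inl ℕ ℤ)) *
        mapPoint diagPoint (AddMonoidAlgebra.mapDomainAlgHom k k (AddMonoidHom.inr ℕ ℤ)))
        (AddMonoidAlgebra.mapDomainAlgHom k k f) := by
    apply specialLinear_ext <;>
      simp [-LaurentPolynomial.single_eq_C_mul_T, mapPoint_apply, specialLinear_mul_apply,
        diagPoint_apply, lowerPoint_apply, AddMonoidAlgebra.single_mul_single, f]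
  rw [this, pointFunctional_map, weightForm_map]
  congr 2
  funext m
  by_cases h : m.1 = a
  · simp [f, h]
  · simp [f, h]

/-- The product lower · diagonal · upper is the universal point of the big cell. All normally
ordered products thereby become weight forms on one monoid algebra. -/
theorem divF_mul_torusFunctional_mul_divE (a : ℕ) (u : ℤ → k) (c : ℕ) :
    divF k a * torusFunctional u * divE k c = cellFunctional fun m =>
      (Pi.single a 1 : ℕ → k) m.1.1 * u m.1.2 * (Pi.single c 1 : ℕ → k) m.2 := by
  rw [divF_eq, torusFunctional, divE_eq, pointFunctional_weight_mul, pointFunctional_weight_mul,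
    cellFunctional]
  congr 1
  apply specialLinear_ext <;>
    simp [-LaurentPolynomial.single_eq_C_mul_T, mapPoint_apply, specialLinear_mul_apply,
      diagPoint_apply, lowerPoint_apply, upperPoint_apply, cellPoint_apply,
      AddMonoidAlgebra.single_mul_single]

end Generators

/-! ### The commutation formula of the divided powers of E and F. -/

section Commutation

variable {k : Type*} [Field k]

theorem cellFunctional_sum {ι : Type*} (s : Finset ι) (w : ι → (ℕ × ℤ) × ℕ → k) :
    cellFunctional (fun m => ∑ i ∈ s, w i m) = ∑ i ∈ s, cellFunctional (w i) := by
  have h : weightForm (fun m => ∑ i ∈ s, w i m) = ∑ i ∈ s, weightForm (w i) :=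
    (weightForm_eq fun m => by simp).symm
  rw [cellFunctional, h]
  ext f
  simp [pointFunctional_apply, cellFunctional]

open Polynomial in
/-- The substitution `X ↦ t X` from power series to power series with polynomial coefficients. -/
def rescaleVar : k⟦X⟧ →+* k[X]⟦X⟧ :=
  (PowerSeries.rescale (X : k[X])).comp (PowerSeries.map C)

theorem coeff_rescaleVar (n : ℕ) (f : k⟦X⟧) : PowerSeries.coeff n (rescaleVar f) =
    Polynomial.X ^ n * Polynomial.C (PowerSeries.coeff n f) := by
  simp [rescaleVar]

theorem rescaleVar_onePlusX : rescaleVar (onePlusX k : k⟦X⟧) =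
    1 + PowerSeries.X * PowerSeries.C Polynomial.X := by
  ext1 n
  simp only [coeff_rescaleVar, onePlusX_val, map_add, PowerSeries.coeff_mul_C,
    PowerSeries.coeff_X, PowerSeries.coeff_one]
  rcases n with _ | _ | n <;> simp

open Polynomial in
/-- The monomials of the big cell, evaluated at the product of an upper by a lower unipotent
element. -/
def cellEval : AddMonoidAlgebra k ((ℕ × ℤ) × ℕ) →ₐ[k] k[X]⟦X⟧ :=
  AddMonoidAlgebra.lift k _ _
    -- The product of the upper element t and the lower element s has torus coordinate 1 + st and
    -- unipotent coordinates s/(1 + st) and t/(1 + st), which explains the exponent h - a - c. Here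
    -- s is the power series variable and t the polynomial variable.
    { toFun := fun m => PowerSeries.X ^ m.toAdd.1.1 * PowerSeries.C (X ^ m.toAdd.2) *
        rescaleVar ((onePlusX k ^ (m.toAdd.1.2 - m.toAdd.1.1 - m.toAdd.2) : (k⟦X⟧)ˣ) : k⟦X⟧)
      map_one' := by simp
      map_mul' := fun m m' => by
        have h : (m * m').toAdd.1.2 - ((m * m').toAdd.1.1 : ℕ) - ((m * m').toAdd.2 : ℕ) =
            (m.toAdd.1.2 - m.toAdd.1.1 - m.toAdd.2) +
              (m'.toAdd.1.2 - m'.toAdd.1.1 - m'.toAdd.2) := by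
          simp
          ring
        rw [h, zpow_add, Units.val_mul, rescaleVar.map_mul]
        rw [toAdd_mul, Prod.fst_add, Prod.fst_add, Prod.snd_add, pow_add, pow_add,
          (PowerSeries.C (R := k[X])).map_mul]
        ring }

theorem cellEval_single (a : ℕ) (h : ℤ) (c : ℕ) :
    cellEval (.single ((a, h), c) (1 : k)) =
      PowerSeries.X ^ a * PowerSeries.C (Polynomial.X ^ c) *
        rescaleVar ((onePlusX k ^ (h - a - c) : (k⟦X⟧)ˣ) : k⟦X⟧) := by
  simp [cellEval]

/-- A coefficient of a power series with polynomial coefficients, as a linear form. -/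
def doubleCoeff (A C : ℕ) : (Polynomial k)⟦X⟧ →ₗ[k] k where
  toFun f := (PowerSeries.coeff A f).coeff C
  map_add' f g := by simp
  map_smul' c f := by simp

theorem doubleCoeff_apply (A C : ℕ) (f : (Polynomial k)⟦X⟧) :
    doubleCoeff A C f = (PowerSeries.coeff A f).coeff C := rfl

/-- The monomial becomes s^a t^c (1 + st)^(h - a - c). It contributes to s^A t^C only when A - a and
C - c are the same number K, with coefficient binom(h - a - c, K). -/
theorem doubleCoeff_cellEval (A C : ℕ) (m : (ℕ × ℤ) × ℕ) :
    doubleCoeff A C (cellEval (.single m (1 : k))) =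
      if m.1.1 ≤ A ∧ C + m.1.1 = A + m.2 then
        zbinom k (A - m.1.1) (m.1.2 - m.1.1 - m.2) else 0 := by
  obtain ⟨⟨a, h⟩, c⟩ := m
  rw [cellEval_single, doubleCoeff_apply, mul_assoc]
  by_cases ha : a ≤ A
  · obtain ⟨K, rfl⟩ := Nat.exists_eq_add_of_le' ha
    rw [PowerSeries.coeff_X_pow_mul, PowerSeries.coeff_C_mul, coeff_rescaleVar, ← mul_assoc,
      ← pow_add, Polynomial.coeff_mul_C, Polynomial.coeff_X_pow]
    by_cases hC : C = c + K
    · rw [if_pos hC, if_pos ⟨ha, by simp; lia⟩, one_mul, Nat.add_sub_cancel]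
      rfl
    · rw [if_neg hC, if_neg (fun h => hC (by have := h.2; simp at this; lia)), zero_mul]
  · rw [if_neg (fun h => ha h.1), PowerSeries.coeff_X_pow_mul', if_neg ha, Polynomial.coeff_zero]

-- Both sides read the coefficient of s^A t^C in a function evaluated at the product of the upper
-- element t and the lower element s, the right side after rewriting this product in the coordinates
-- of the big cell. With a = A - K and c = C - K the argument h - a - c becomes h - A - C + 2K.
open Polynomial in
theorem divE_mul_divF (C A : ℕ) :
    divE k C * divF k A = ∑ K ∈ Finset.range (min A C + 1), divF k (A - K) *
      torusFunctional (fun h => zbinom k K (h - A - C + 2 * K)) * divE k (C - K) := by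
  have hR : ∀ K ∈ Finset.range (min A C + 1), divF k (A - K) *
      torusFunctional (fun h => zbinom k K (h - A - C + 2 * K)) * divE k (C - K) = _ :=
    fun K _ => divF_mul_torusFunctional_mul_divE _ _ _
  rw [Finset.sum_congr rfl hR, ← cellFunctional_sum, divE_eq, divF_eq]
  let i : AddMonoidAlgebra k ℕ →ₐ[k] k[X]⟦X⟧ :=
    AddMonoidAlgebra.lift k _ ℕ (powersHom _ (PowerSeries.C X))
  let j : AddMonoidAlgebra k ℕ →ₐ[k] k[X]⟦X⟧ :=
    AddMonoidAlgebra.lift k _ ℕ (powersHom _ PowerSeries.X)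
  rw [pointFunctional_mul _ _ _ _ i j (doubleCoeff A C)]
  · have : mapPoint upperPoint i * mapPoint lowerPoint j = mapPoint cellPoint cellEval := by
      apply specialLinear_ext
      · simp [mapPoint_apply, specialLinear_mul_apply, upperPoint_apply, lowerPoint_apply,
          cellPoint_apply, cellEval_single, i, j, rescaleVar_onePlusX]
        ring
      · simp [mapPoint_apply, specialLinear_mul_apply, upperPoint_apply, lowerPoint_apply,
          cellPoint_apply, cellEval_single, i, j]
      · simp [mapPoint_apply, specialLinear_mul_apply, upperPoint_apply, lowerPoint_apply,
          cellPoint_apply, cellEval_single, i, j]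
      · have h : rescaleVar (onePlusX k : k⟦X⟧) *
            rescaleVar ((onePlusX k ^ (-1 : ℤ) : (k⟦X⟧)ˣ) : k⟦X⟧) = 1 := by
          rw [← map_mul, ← Units.val_mul]
          simp
        rw [rescaleVar_onePlusX] at h
        simp [mapPoint_apply, specialLinear_mul_apply, upperPoint_apply, lowerPoint_apply,
          cellPoint_apply, cellEval_single, i, j] at h ⊢
        linear_combination -h
    rw [this, pointFunctional_map, cellFunctional]
    congr 1
    refine weightForm_eq fun m => ?_
    rw [LinearMap.comp_apply, AlgHom.toLinearMap_apply, doubleCoeff_cellEval]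
    obtain ⟨⟨a, h⟩, c⟩ := m
    dsimp only
    split_ifs with hm
    · rw [Finset.sum_eq_single (A - a)]
      · rw [Nat.sub_sub_self hm.1, Pi.single_eq_same, one_mul,
          show C - (A - a) = c by lia, Pi.single_eq_same, mul_one]
        congr 1
        have := hm.1
        push_cast [hm.1]
        lia
      · intro K hK hKa
        rw [Pi.single_eq_of_ne (by rw [Finset.mem_range] at hK; lia), zero_mul, zero_mul]
      · intro h
        rw [Finset.mem_range] at h
        lia
    · refine (Finset.sum_eq_zero fun K hK => ?_).symm
      rw [Finset.mem_range] at hK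
      by_cases ha : a = A - K
      · rw [Pi.single_eq_of_ne (i' := c) (by lia), mul_zero]
      · rw [Pi.single_eq_of_ne ha, zero_mul, zero_mul]
  · intro x y
    induction x using AddMonoidAlgebra.induction_linear with
    | zero => simp
    | add x x' hx hx' => simp only [map_add, add_mul, hx, hx']
    | single m c =>
      induction y using AddMonoidAlgebra.induction_linear with
      | zero => simp
      | add x x' hx hx' => simp only [map_add, mul_add, hx, hx']
      | single m' c' =>
        simp only [i, j, AddMonoidAlgebra.lift_single, powersHom_apply, toAdd_ofAdd,
          smul_mul_smul_comm, map_smul, weightForm_single, doubleCoeff_apply, smul_eq_mul]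
        rw [← map_pow, PowerSeries.coeff_C_mul, PowerSeries.coeff_X_pow]
        by_cases hA : A = m'
        · by_cases hC : C = m
          · simp [hA, hC]
          · simp [hA, Polynomial.coeff_X_pow, hC, eq_comm]
        · simp [hA, Pi.single_apply, eq_comm]

end Commutation

/-! ### The filtration of functions on the weights by binomial degree. -/

section Difference

variable (k : Type*) [Field k]

/-- The span of the binomial functions of degree less than `n`. -/
def binomSpan (n : ℕ) : Submodule k (ℤ → k) := Submodule.span k (zbinom k '' Set.Iio n)

variable {k}

theorem binomSpan_mono {n n' : ℕ} (h : n ≤ n') : binomSpan k n ≤ binomSpan k n' :=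
  Submodule.span_mono (Set.image_mono (Set.Iio_subset_Iio h))

theorem zbinom_mem {j n : ℕ} (h : j < n) : zbinom k j ∈ binomSpan k n :=
  Submodule.subset_span ⟨j, h, rfl⟩

theorem binomSpan_zero : binomSpan k 0 = ⊥ := by
  simp [binomSpan]

theorem shift_mem_binomSpan {n : ℕ} (m : ℤ) {u : ℤ → k} (hu : u ∈ binomSpan k n) :
    (fun h => u (h + m)) ∈ binomSpan k n := by
  induction hu using Submodule.span_induction with
  | mem u hu =>
    obtain ⟨j, hj, rfl⟩ := hu
    have h : (fun h => zbinom k j (h + m)) =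
        ∑ ij ∈ Finset.HasAntidiagonal.antidiagonal j, zbinom k ij.2 m • zbinom k ij.1 := by
      funext h
      simp [zbinom_add, mul_comm]
    rw [h]
    refine Submodule.sum_mem _ fun ij hij => Submodule.smul_mem _ _ (zbinom_mem ?_)
    have := Finset.HasAntidiagonal.mem_antidiagonal.1 hij
    rw [Set.mem_Iio] at hj
    lia
  | zero => exact Submodule.zero_mem _
  | add u u' _ _ hu hu' => exact Submodule.add_mem _ hu hu'
  | smul c u _ hu => exact Submodule.smul_mem _ c hu

theorem eq_of_difference_eq {u u' : ℤ → k}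
    (h : ∀ h, u (h + 1) - u h = u' (h + 1) - u' h) (h0 : u 0 = u' 0) : u = u' := by
  funext n
  induction n using Int.induction_on with
  | zero => exact h0
  | succ n ih => have := h n; rw [ih] at this; exact sub_left_inj.1 this
  | pred n ih =>
    have := h (-n - 1)
    rw [sub_add_cancel, ih] at this
    exact sub_right_inj.1 this

/-- By Pascal's rule `zbinom k (j + 1)` is a discrete antiderivative of `zbinom k j`, and two
antiderivatives differ by a multiple of the constant `zbinom k 0`. -/
theorem mem_binomSpan_of_difference_mem {n : ℕ} {u : ℤ → k}
    (hu : (fun h => u (h + 1) - u h) ∈ binomSpan k n) : u ∈ binomSpan k (n + 1) := by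
  have key : ∀ d ∈ binomSpan k n, ∃ s ∈ binomSpan k (n + 1), ∀ h, s (h + 1) - s h = d h := by
    intro d hd
    induction hd using Submodule.span_induction with
    | mem u hu =>
      obtain ⟨j, hj, rfl⟩ := hu
      exact ⟨zbinom k (j + 1), zbinom_mem (Nat.succ_lt_succ hj), fun h => by
        rw [zbinom_succ, add_sub_cancel_left]⟩
    | zero => exact ⟨0, Submodule.zero_mem _, fun h => by simp⟩
    | add u u' _ _ hu hu' =>
      obtain ⟨s, hs, hsu⟩ := hu
      obtain ⟨s', hs', hsu'⟩ := hu'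
      exact ⟨s + s', Submodule.add_mem _ hs hs', fun h => by
        rw [Pi.add_apply, Pi.add_apply, Pi.add_apply, ← hsu, ← hsu']; ring⟩
    | smul c u _ hu =>
      obtain ⟨s, hs, hsu⟩ := hu
      exact ⟨c • s, Submodule.smul_mem _ c hs, fun h => by
        rw [Pi.smul_apply, Pi.smul_apply, Pi.smul_apply, ← hsu, smul_sub]⟩
  obtain ⟨s, hs, hsu⟩ := key _ hu
  have h : u = s + (u 0 - s 0) • zbinom k 0 := by
    refine eq_of_difference_eq (fun h => ?_) ?_
    · simp only [Pi.add_apply, Pi.smul_apply, zbinom_zero_left]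
      rw [← hsu]
      ring
    · simp [zbinom_zero_left]
  rw [h]
  exact Submodule.add_mem _ hs (Submodule.smul_mem _ _ (zbinom_mem n.succ_pos))

/-- Induction through differences: Δ(uv) = uΔv + vΔu + ΔuΔv splits the difference of the left side
into two instances of lower total degree and a product of still lower degree, Pascal's rule matching
the leading coefficients. The argument avoids division, so it works in every characteristic. -/
theorem zbinom_mul_sub_mem (a b : ℕ) :
    zbinom k a * zbinom k b - ((a + b).choose a : k) • zbinom k (a + b) ∈
      binomSpan k (a + b) := by
  have hz : zbinom k 0 = 1 := funext fun h => zbinom_zero_left k h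
  induction a generalizing b with
  | zero => simp [hz]
  | succ a iha =>
    induction b with
    | zero => simp [hz]
    | succ b ihb =>
      refine mem_binomSpan_of_difference_mem (n := a + 1 + b) ?_
      have h1 := iha (b + 1)
      have h2 := ihb
      have h3 : zbinom k a * zbinom k b ∈ binomSpan k (a + 1 + b) := by
        have := Submodule.add_mem _ (binomSpan_mono (show a + b ≤ a + 1 + b by lia) (iha b))
          (Submodule.smul_mem _ ((a + b).choose a : k)
            (zbinom_mem (k := k) (show a + b < a + 1 + b by lia)))
        simpa using this
      rw [show a + (b + 1) = a + 1 + b by ring] at h1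
      convert Submodule.add_mem _ (Submodule.add_mem _ h1 h2) h3 using 1
      funext h
      have hc : (a + 1 + b + 1).choose (a + 1) = (a + 1 + b).choose a +
          (a + 1 + b).choose (a + 1) := Nat.choose_succ_succ _ _
      simp only [Pi.sub_apply, Pi.add_apply, Pi.mul_apply, Pi.smul_apply, smul_eq_mul,
        ← add_assoc, hc, zbinom_succ, Nat.cast_add]
      ring

theorem zbinom_mul_mem (a b : ℕ) : zbinom k a * zbinom k b ∈ binomSpan k (a + b + 1) := by
  have := Submodule.add_mem _ (binomSpan_mono (Nat.le_succ _) (zbinom_mul_sub_mem (k := k) a b))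
    (Submodule.smul_mem _ ((a + b).choose a : k) (zbinom_mem (k := k) (Nat.lt_succ_self (a + b))))
  simpa using this

theorem mul_mem_binomSpan {n n' : ℕ} {u u' : ℤ → k} (hu : u ∈ binomSpan k n)
    (hu' : u' ∈ binomSpan k n') : u * u' ∈ binomSpan k (n + n') := by
  induction hu using Submodule.span_induction with
  | mem u hu =>
    obtain ⟨j, hj, rfl⟩ := hu
    induction hu' using Submodule.span_induction with
    | mem u hu =>
      obtain ⟨j', hj', rfl⟩ := hu
      rw [Set.mem_Iio] at hj hj'
      exact binomSpan_mono (by lia) (zbinom_mul_mem j j')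
    | zero => rw [mul_zero]; exact Submodule.zero_mem _
    | add u u' _ _ hu hu' => rw [mul_add]; exact Submodule.add_mem _ hu hu'
    | smul c u _ hu => rw [mul_smul_comm]; exact Submodule.smul_mem _ c hu
  | zero => rw [zero_mul]; exact Submodule.zero_mem _
  | add u u' _ _ hu hu' => rw [add_mul]; exact Submodule.add_mem _ hu hu'
  | smul c u _ hu => rw [smul_mul_assoc]; exact Submodule.smul_mem _ c hu

/-- `torusFunctional` as a morphism of algebras. -/
def torusAlgHom : (ℤ → k) →ₐ[k] Functional k (CoordRing k) :=
  AlgHom.ofLinearMap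
    { toFun := torusFunctional
      map_add' := torusFunctional_add
      map_smul' := torusFunctional_smul }
    torusFunctional_one fun u u' => (torusFunctional_mul u u').symm

theorem torusAlgHom_apply (u : ℤ → k) : torusAlgHom (k := k) u = torusFunctional u := rfl

end Difference

/-! ### Binomials modulo `p`, the indicator of the multiples of `p`, and Lucas' congruence. -/

section PrimeField

variable {p : ℕ} [Fact p.Prime]

/-- Over the prime field the p-th power of f(X) is f(X^p), the Frobenius being trivial on
coefficients. -/
theorem coeff_pow_prime (f : (ZMod p)⟦X⟧) (n : ℕ) :
    PowerSeries.coeff n (f ^ p) = if p ∣ n then PowerSeries.coeff (n / p) f else 0 := by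
  have hp : p ≠ 0 := (Fact.out : p.Prime).ne_zero
  have h : f ^ p = PowerSeries.expand p hp f := by
    have h := MvPowerSeries.map_frobenius_expand (R := ZMod p) (σ := Unit) p hp (f := f)
    rw [ZMod.frobenius_zmod, MvPowerSeries.map_id] at h
    exact h.symm
  rw [h, PowerSeries.coeff_expand]

theorem zbinom_prime_mul (n : ℕ) (h : ℤ) :
    zbinom (ZMod p) n (p * h) = if p ∣ n then zbinom (ZMod p) (n / p) h else 0 := by
  rw [zbinom, mul_comm, zpow_mul, zpow_natCast, Units.val_pow_eq_pow_val, coeff_pow_prime]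
  rfl

/-- The factor (1 + X)^(pq) is a power series in X^p, so below degree `p` it contributes only its
constant term. -/
theorem zbinom_eq_choose_of_lt {i : ℕ} (hi : i < p) (q : ℤ) (r : ℕ) :
    zbinom (ZMod p) i (p * q + r) = r.choose i := by
  rw [zbinom_add, Finset.sum_eq_single (0, i)]
  · simp [zbinom_zero_left, zbinom_natCast]
  · rintro ⟨a, b⟩ hab h0
    rw [Finset.HasAntidiagonal.mem_antidiagonal] at hab
    rw [zbinom_prime_mul, if_neg, zero_mul]
    intro hd
    have ha : a ≠ 0 := by
      rintro rfl
      exact h0 (by simpa using hab)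
    have := Nat.le_of_dvd (Nat.pos_of_ne_zero ha) hd
    dsimp only at hab
    lia
  · intro h
    simp at h

variable (p) in
/-- The indicator function of the multiples of `p`. -/
def primeIndicator : ℤ → ZMod p := fun h => if (p : ℤ) ∣ h then 1 else 0

/-- The sum depends only on the residue r of the weight, for which it is the alternating sum of the
binomial coefficients of r, namely 0^r. The idempotence of the norm follows. -/
theorem sum_zbinom_eq_primeIndicator :
    ∑ i ∈ Finset.range p, (-1 : ZMod p) ^ i • zbinom (ZMod p) i = primeIndicator p := by
  have hp : 0 < (p : ℤ) := Int.natCast_pos.2 (Fact.out : p.Prime).pos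
  funext h
  obtain ⟨r, hr⟩ := Int.eq_ofNat_of_zero_le (Int.emod_nonneg h hp.ne')
  have hrp : r < p := by have := Int.emod_lt_of_pos h hp; lia
  have hh : h = p * (h / p) + r := by rw [← hr, Int.mul_ediv_add_emod]
  have h1 : ∑ i ∈ Finset.range p, (-1 : ZMod p) ^ i * (r.choose i : ZMod p) =
      ((∑ i ∈ Finset.range (r + 1), (-1 : ℤ) ^ i * (r.choose i : ℤ) : ℤ) : ZMod p) := by
    push_cast
    refine (Finset.sum_subset (Finset.range_mono hrp) fun i _ hi => ?_).symm
    rw [Nat.choose_eq_zero_of_lt (by simpa using hi), Nat.cast_zero, mul_zero]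
  rw [Finset.sum_apply]
  have h2 : ∀ i ∈ Finset.range p, ((-1 : ZMod p) ^ i • zbinom (ZMod p) i) h =
      (-1 : ZMod p) ^ i * (r.choose i : ZMod p) := fun i hi => by
    rw [Pi.smul_apply, smul_eq_mul]
    conv_lhs => rw [hh]
    rw [zbinom_eq_choose_of_lt (Finset.mem_range.1 hi)]
  rw [Finset.sum_congr rfl h2, h1, Int.alternating_sum_range_choose, primeIndicator]
  have h3 : r = 0 ↔ (p : ℤ) ∣ h := by
    rw [Int.dvd_iff_emod_eq_zero, hr]
    simp
  by_cases hr0 : r = 0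
  · rw [if_pos hr0, if_pos (h3.1 hr0), Int.cast_one]
  · rw [if_neg hr0, if_neg (fun h => hr0 (h3.2 h)), Int.cast_zero]

theorem primeIndicator_mem : primeIndicator p ∈ binomSpan (ZMod p) p := by
  rw [← sum_zbinom_eq_primeIndicator]
  exact Submodule.sum_mem _ fun i hi =>
    Submodule.smul_mem _ _ (zbinom_mem (Finset.mem_range.1 hi))

theorem primeIndicator_mul_self : primeIndicator p * primeIndicator p = primeIndicator p := by
  funext h
  simp [primeIndicator]

variable (p) in
/-- The function on the weights divisible by `p` obtained by division by `p`, extended by zero. -/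
def stretch : (ℤ → ZMod p) →ₗ[ZMod p] (ℤ → ZMod p) where
  toFun u := fun h => if (p : ℤ) ∣ h then u (h / p) else 0
  map_add' u u' := by funext h; by_cases hd : (p : ℤ) ∣ h <;> simp [hd]
  map_smul' c u := by funext h; by_cases hd : (p : ℤ) ∣ h <;> simp [hd]

theorem stretch_apply (u : ℤ → ZMod p) (h : ℤ) :
    stretch p u h = if (p : ℤ) ∣ h then u (h / p) else 0 := rfl

theorem stretch_mul (u u' : ℤ → ZMod p) : stretch p (u * u') = stretch p u * stretch p u' := by
  funext h
  by_cases hd : (p : ℤ) ∣ h <;> simp [stretch_apply, hd]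

theorem stretch_one : stretch p 1 = primeIndicator p := rfl

theorem stretch_shift (u : ℤ → ZMod p) (m : ℤ) :
    stretch p (fun h => u (h + m)) = fun h => stretch p u (h + p * m) := by
  have hp : (p : ℤ) ≠ 0 := Int.natCast_ne_zero.2 (Fact.out : p.Prime).ne_zero
  funext h
  simp only [stretch_apply]
  by_cases hd : (p : ℤ) ∣ h
  · rw [if_pos hd, if_pos (dvd_add hd (dvd_mul_right _ _)), Int.add_mul_ediv_left _ _ hp]
  · rw [if_neg hd, if_neg (fun h' => hd ((dvd_add_left (dvd_mul_right _ _)).1 h'))]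

/-- This identifies the intrinsic rule of dividing the weight by `p` with the prescribed image of
binom(H, b). -/
theorem stretch_zbinom (b : ℕ) :
    stretch p (zbinom (ZMod p) b) = zbinom (ZMod p) (p * b) * primeIndicator p := by
  have hp : p ≠ 0 := (Fact.out : p.Prime).ne_zero
  funext h
  simp only [stretch_apply, Pi.mul_apply, primeIndicator]
  by_cases hd : (p : ℤ) ∣ h
  · obtain ⟨q, rfl⟩ := hd
    rw [if_pos (dvd_mul_right _ _), if_pos (dvd_mul_right _ _), mul_one, zbinom_prime_mul,
      if_pos (dvd_mul_right _ _), Nat.mul_div_cancel_left _ (Nat.pos_of_ne_zero hp),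
      Int.mul_ediv_cancel_left _ (Int.natCast_ne_zero.2 hp)]
  · rw [if_neg hd, if_neg hd, mul_zero]

theorem choose_prime_mul (n i : ℕ) : ((p * n).choose (p * i) : ZMod p) = n.choose i := by
  have hp : 0 < p := (Fact.out : p.Prime).pos
  have h := Choose.choose_modEq_choose_mod_mul_choose_div_nat (n := p * n) (k := p * i) (p := p)
  rw [Nat.mul_mod_right, Nat.mul_mod_right, Nat.mul_div_cancel_left _ hp,
    Nat.mul_div_cancel_left _ hp, Nat.choose_self, one_mul] at h
  exact (ZMod.natCast_eq_natCast_iff _ _ _).2 h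

theorem prime_not_dvd_choose {a b c d : ℕ} (ha : a < p) (hb : b ≤ a) (h : ¬ p ∣ c.choose d) :
    ¬ p ∣ (p * c + a).choose (p * d + b) := by
  have hp : 0 < p := (Fact.out : p.Prime).pos
  have h1 := Choose.choose_modEq_choose_mod_mul_choose_div_nat (n := p * c + a) (k := p * d + b)
    (p := p)
  rw [Nat.mul_add_mod, Nat.mul_add_mod, Nat.mod_eq_of_lt ha, Nat.mod_eq_of_lt (hb.trans_lt ha),
    Nat.mul_add_div hp, Nat.mul_add_div hp, Nat.div_eq_of_lt ha,
    Nat.div_eq_of_lt (hb.trans_lt ha), add_zero, add_zero] at h1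
  rw [h1.dvd_iff dvd_rfl, (Fact.out : p.Prime).dvd_mul, not_or]
  refine ⟨fun h2 => ?_, h⟩
  have h3 : p ∣ a.factorial := h2.trans
    ((Dvd.intro _ (by rw [← mul_assoc]; exact Nat.choose_mul_factorial_mul_factorial hb)))
  exact absurd ((Fact.out : p.Prime).dvd_factorial.1 h3) (not_le.2 ha)

/-- By Lucas a binomial coefficient is nonzero modulo `p` as soon as each base `p` digit of the
lower entry is at most that of the upper one. So digits of a, b, c are selected to add up to p^M, by
induction on the number of digits. -/
theorem exists_split (M : ℕ) : ∀ a b c : ℕ, p ^ M ≤ a + b + c → a + b + c < 2 * p ^ M →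
    ∃ a' ≤ a, ∃ b' ≤ b, ∃ c' ≤ c, a' + b' + c' = p ^ M ∧
      ¬ p ∣ a.choose a' ∧ ¬ p ∣ b.choose b' ∧ ¬ p ∣ c.choose c' := by
  have hp1 : 1 < p := (Fact.out : p.Prime).one_lt
  have hp : 0 < p := hp1.le
  have h1 : ∀ x, x = 1 → ¬ p ∣ x := fun x hx => by
    rw [hx, Nat.dvd_one]
    exact hp1.ne'
  induction M with
  | zero =>
    intro a b c h h'
    rw [pow_zero] at h h'
    refine ⟨a, le_rfl, b, le_rfl, c, le_rfl, ?_, h1 _ (Nat.choose_self _),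
      h1 _ (Nat.choose_self _), h1 _ (Nat.choose_self _)⟩
    rw [pow_zero]
    lia
  | succ M ih =>
    intro a b c h h'
    have ha := Nat.div_add_mod a p
    have hb := Nat.div_add_mod b p
    have hc := Nat.div_add_mod c p
    have ha' := Nat.mod_lt a hp
    have hb' := Nat.mod_lt b hp
    have hc' := Nat.mod_lt c hp
    generalize a / p = a1 at *
    generalize b / p = b1 at *
    generalize c / p = c1 at *
    generalize a % p = a0 at *
    generalize b % p = b0 at *
    generalize c % p = c0 at *
    subst ha hb hc
    rw [pow_succ'] at h h' ⊢
    by_cases hs : p ^ M ≤ a1 + b1 + c1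
    -- The quotients alone suffice, and the last digits are chosen to be zero.
    · obtain ⟨a', ha2, b', hb2, c', hc2, hsum, hda, hdb, hdc⟩ := ih a1 b1 c1 hs
        (by
          by_contra! hcon
          have := Nat.mul_le_mul_left p hcon
          lia)
      refine ⟨p * a' + 0, by gcongr; lia, p * b' + 0, by gcongr; lia, p * c' + 0, by gcongr; lia,
        ?_, prime_not_dvd_choose ha' (Nat.zero_le _) hda,
        prime_not_dvd_choose hb' (Nat.zero_le _) hdb, prime_not_dvd_choose hc' (Nat.zero_le _) hdc⟩
      rw [← hsum]
      ring
    · obtain ⟨r, hr⟩ := Nat.exists_eq_add_of_le (not_le.1 hs).le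
      rw [hr] at h ⊢
      have hsum : p * r ≤ a0 + b0 + c0 := by
        have : p * (a1 + b1 + c1 + r) = p * a1 + p * b1 + p * c1 + p * r := by ring
        lia
      -- The quotients are used entirely, and the missing amount pr is taken greedily from the last
      -- digits of a, b, c in this order; truncated subtraction gives zero once pr is exhausted.
      refine ⟨p * a1 + min a0 (p * r), by gcongr; exact min_le_left _ _,
        p * b1 + min b0 (p * r - a0), by gcongr; exact min_le_left _ _,
        p * c1 + (p * r - a0 - b0), by gcongr; lia, ?_,
        prime_not_dvd_choose ha' (min_le_left _ _) (h1 _ (Nat.choose_self _)),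
        prime_not_dvd_choose hb' (min_le_left _ _) (h1 _ (Nat.choose_self _)),
        prime_not_dvd_choose hc' (by lia) (h1 _ (Nat.choose_self _))⟩
      have : p * (a1 + b1 + c1 + r) = p * a1 + p * b1 + p * c1 + p * r := by ring
      rw [this]
      generalize p * r = t at *
      lia

end PrimeField

/-! ### Ordered monomials and a dual family of functions. -/

section DualMonomials

variable {k : Type*} [Field k]

/-- The ordered monomials in the divided powers and the binomials. -/
def pbw (t : ℕ × ℕ × ℕ) : Functional k (CoordRing k) :=
  divF k t.1 * binomH k t.2.1 * divE k t.2.2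

theorem pbw_mem (t : ℕ × ℕ × ℕ) :
    pbw (k := k) t ∈ distOrder k (CoordRing k) (t.1 + t.2.1 + t.2.2) :=
  mul_mem_distOrder (mul_mem_distOrder (divF_mem k _) (binomH_mem k _)) (divE_mem k _)

/-- Functions on `SL₂` that form a dual family of the ordered monomials. -/
def dualMonomial (q : ℕ) (t : ℕ × ℕ × ℕ) : CoordRing k :=
  -- On the big cell the entries are x₀₀ = z, x₁₀ = sz, x₀₁ = zt, so the power of x₀₀ normalizes the
  -- function to s^a t^c z^q (z - 1)^b when a + c ≤ q.
  univPoint k 1 0 ^ t.1 * univPoint k 0 1 ^ t.2.2 * univPoint k 0 0 ^ (q - t.1 - t.2.2) *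
    (univPoint k 0 0 - 1) ^ t.2.1

theorem weightForm_mul_torus (a' c' a c : ℕ) (u : ℤ → k) (g : AddMonoidAlgebra k ℤ) :
    weightForm (fun m : (ℕ × ℤ) × ℕ =>
        (Pi.single a' 1 : ℕ → k) m.1.1 * u m.1.2 * (Pi.single c' 1 : ℕ → k) m.2)
      (.single ((a, 0), c) 1 * AddMonoidAlgebra.mapDomainAlgHom k k
        ((AddMonoidHom.inl (ℕ × ℤ) ℕ).comp (AddMonoidHom.inr ℕ ℤ)) g) =
      (Pi.single a' 1 : ℕ → k) a * (Pi.single c' 1 : ℕ → k) c * weightForm u g := by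
  induction g using AddMonoidAlgebra.induction_linear with
  | zero => simp
  | add x y hx hy => simp only [map_add, mul_add, hx, hy]
  | single h e =>
    simp [-LaurentPolynomial.single_eq_C_mul_T, AddMonoidAlgebra.single_mul_single]
    ring

theorem weightForm_zbinom (b : ℕ) (g : AddMonoidAlgebra k ℤ) :
    weightForm (zbinom k b) g = PowerSeries.coeff b (laurentEval (onePlusX k) g) := by
  have h : PowerSeries.coeff b ∘ₗ (laurentEval (k := k) (onePlusX k)).toLinearMap =
      weightForm (zbinom k b) :=
    weightForm_eq fun m => by
      simp [-LaurentPolynomial.single_eq_C_mul_T]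
      rfl
  rw [← h]
  rfl

theorem evalAt_dualMonomial {q : ℕ} {t : ℕ × ℕ × ℕ} (h : t.1 + t.2.2 ≤ q) :
    evalAt cellPoint (dualMonomial (k := k) q t) =
      .single ((t.1, 0), t.2.2) 1 * AddMonoidAlgebra.mapDomainAlgHom k k
        ((AddMonoidHom.inl (ℕ × ℤ) ℕ).comp (AddMonoidHom.inr ℕ ℤ))
        (.single 1 1 ^ q * (.single 1 1 - 1) ^ t.2.1) := by
  have h1 : (t.1 : ℤ) + (t.2.2 : ℤ) + ((q - t.1 - t.2.2 : ℕ) : ℤ) = q := by lia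
  set ι := AddMonoidAlgebra.mapDomainAlgHom k k
    ((AddMonoidHom.inl (ℕ × ℤ) ℕ).comp (AddMonoidHom.inr ℕ ℤ))
  have h2 : ι (.single 1 1) = .single ((0, 1), 0) 1 := by
    simp [-LaurentPolynomial.single_eq_C_mul_T, ι]
  simp only [map_mul, map_pow, map_sub, map_one, h2, dualMonomial, evalAt_univPoint,
    cellPoint_apply]
  rw [← mul_assoc]
  congr 1
  simp [AddMonoidAlgebra.single_mul_single, AddMonoidAlgebra.single_pow, h1]

/-- The evaluation of functionals at a function. -/
def functionalEval (f : CoordRing k) : Functional k (CoordRing k) →ₗ[k] k where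
  toFun μ := μ f
  map_add' _ _ := rfl
  map_smul' _ _ := rfl

theorem functionalEval_apply (f : CoordRing k) (μ : Functional k (CoordRing k)) :
    functionalEval f μ = μ f := rfl

end DualMonomials

/-! ### The Poincaré–Birkhoff–Witt basis of the distributions. -/

section PrimeField

variable {p : ℕ} [Fact p.Prime]

instance : CharP (CoordRing (ZMod p)) p :=
  have : Nontrivial (CoordRing (ZMod p)) :=
    (evalAt (1 : Matrix.SpecialLinearGroup (Fin 2) (ZMod p))).toRingHom.domain_nontrivial
  charP_of_injective_algebraMap (algebraMap (ZMod p) (CoordRing (ZMod p))).injective p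

/-- With z = 1 + X and q = p^r one has z^q (z - 1)^b = X^b + X^(q + b), and the second term is out
of reach of a binomial of degree less than q. -/
theorem pbw_dualMonomial {r : ℕ} {t t' : ℕ × ℕ × ℕ} (h : t.1 + t.2.2 ≤ p ^ r)
    (h' : t'.2.1 < p ^ r) :
    pbw (k := ZMod p) t' (dualMonomial (p ^ r) t) = if t' = t then 1 else 0 := by
  rw [pbw, binomH_eq, divF_mul_torusFunctional_mul_divE, cellFunctional, pointFunctional_apply,
    evalAt_dualMonomial h, weightForm_mul_torus, weightForm_zbinom]
  have h2 : laurentEval (onePlusX (ZMod p)) (.single 1 1 ^ (p ^ r) * (.single 1 1 - 1) ^ t.2.1 :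
      AddMonoidAlgebra (ZMod p) ℤ) =
      PowerSeries.X ^ t.2.1 + PowerSeries.X ^ (p ^ r + t.2.1) := by
    have : CharP ((ZMod p)⟦X⟧) p :=
      charP_of_injective_algebraMap (algebraMap (ZMod p) ((ZMod p)⟦X⟧)).injective p
    rw [map_mul, map_pow, map_pow, map_sub, map_one, laurentEval_single, one_smul, zpow_one,
      onePlusX_val, add_pow_char_pow, one_pow, add_sub_cancel_left]
    ring
  rw [h2, map_add, PowerSeries.coeff_X_pow, PowerSeries.coeff_X_pow,
    if_neg (show ¬ t'.2.1 = p ^ r + t.2.1 by lia), add_zero]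
  obtain ⟨a, b, c⟩ := t
  obtain ⟨a', b', c'⟩ := t'
  by_cases ha : a = a'
  · by_cases hb : b = b'
    · by_cases hc : c = c'
      · simp [ha, hb, hc]
      · simp [hc, Ne.symm hc]
    · simp [Ne.symm hb]
  · simp [ha, Ne.symm ha]

theorem pbw_linearIndependent : LinearIndependent (ZMod p) (pbw (k := ZMod p)) := by
  rw [linearIndependent_iff']
  intro s g hs i hi
  let r := s.sup fun t => t.1 + t.2.1 + t.2.2
  have hr : ∀ t ∈ s, t.1 + t.2.1 + t.2.2 < p ^ r := fun t ht =>
    (Finset.le_sup (f := fun t : ℕ × ℕ × ℕ => t.1 + t.2.1 + t.2.2) ht).trans_lt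
      (Nat.lt_pow_self (Fact.out : p.Prime).one_lt)
  have h := congrArg (functionalEval (dualMonomial (p ^ r) i)) hs
  rw [map_sum, map_zero] at h
  simp only [map_smul, smul_eq_mul, functionalEval_apply] at h
  rw [Finset.sum_eq_single i] at h
  · rw [pbw_dualMonomial, if_pos rfl, mul_one] at h
    · exact h
    · have := hr i hi
      lia
    · have := hr i hi
      lia
  · intro t ht hti
    have := hr i hi
    have := hr t ht
    rw [pbw_dualMonomial (by lia) (by lia), if_neg hti, mul_zero]
  · exact fun h => absurd hi h

theorem univPoint_det (k : Type*) [CommRing k] :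
    univPoint k 0 0 * univPoint k 1 1 = 1 + univPoint k 0 1 * univPoint k 1 0 := by
  have h := (univPoint k).2
  rw [Matrix.det_fin_two] at h
  linear_combination h

theorem coordRing_subalgebra_eq_top {k : Type*} [CommRing k] {T : Subalgebra k (CoordRing k)}
    (h : ∀ i j, univPoint k i j ∈ T) (f : CoordRing k) : f ∈ T := by
  obtain ⟨P, rfl⟩ := Ideal.Quotient.mk_surjective f
  induction P using MvPolynomial.induction_on with
  | C c => exact T.algebraMap_mem c
  | add P Q hP hQ => rw [map_add]; exact T.add_mem hP hQ
  | mul_X P i hP => rw [map_mul]; exact T.mul_mem hP (h i.1 i.2)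

theorem univPoint_sub_mem {k : Type*} [CommRing k] (i j : Fin 2) :
    univPoint k i j - (1 : Matrix (Fin 2) (Fin 2) (CoordRing k)) i j ∈ augIdeal k (CoordRing k)
        := by
  change evalAt 1 _ = 0
  rw [map_sub, evalAt_univPoint]
  fin_cases i <;> fin_cases j <;> simp

theorem dualMonomial_mem {k : Type*} [Field k] (q : ℕ) (t : ℕ × ℕ × ℕ) {n : ℕ}
    (h : n ≤ t.1 + t.2.1 + t.2.2) : dualMonomial q t ∈ augIdeal k (CoordRing k) ^ n := by
  refine Ideal.pow_le_pow_right h ?_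
  have h10 : univPoint k 1 0 ∈ augIdeal k (CoordRing k) := by
    simpa using univPoint_sub_mem (k := k) 1 0
  have h01 : univPoint k 0 1 ∈ augIdeal k (CoordRing k) := by
    simpa using univPoint_sub_mem (k := k) 0 1
  have h00 : univPoint k 0 0 - 1 ∈ augIdeal k (CoordRing k) := by
    simpa using univPoint_sub_mem (k := k) 0 0
  have := Ideal.mul_mem_left _ (univPoint k 0 0 ^ (q - t.1 - t.2.2))
    (Ideal.mul_mem_mul (Ideal.mul_mem_mul (Ideal.pow_mem_pow h10 t.1) (Ideal.pow_mem_pow h00 t.2.1))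
    (Ideal.pow_mem_pow h01 t.2.2))
  rw [← pow_add, ← pow_add] at this
  convert this using 1
  rw [dualMonomial]
  ring

variable (p) in
/-- The span of the dual monomials of degree at most `n` and of a power of the ideal of the unit
element. -/
def dualSpan (q n : ℕ) : Submodule (ZMod p) (CoordRing (ZMod p)) :=
  Submodule.span (ZMod p) (dualMonomial q '' {t | t.1 + t.2.1 + t.2.2 ≤ n}) ⊔
    (augIdeal (ZMod p) (CoordRing (ZMod p)) ^ (n + 1)).restrictScalars (ZMod p)

theorem mem_dualSpan_of_mem_pow {q n : ℕ} {f : CoordRing (ZMod p)}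
    (hf : f ∈ augIdeal (ZMod p) (CoordRing (ZMod p)) ^ (n + 1)) : f ∈ dualSpan p q n :=
  Submodule.mem_sup_right hf

theorem dualMonomial_mem_dualSpan (q n : ℕ) (t : ℕ × ℕ × ℕ) :
    dualMonomial q t ∈ dualSpan p q n := by
  by_cases h : t.1 + t.2.1 + t.2.2 ≤ n
  · exact Submodule.mem_sup_left (Submodule.subset_span ⟨t, h, rfl⟩)
  · exact mem_dualSpan_of_mem_pow (dualMonomial_mem q t (by lia))

/-- Only dual monomials of degree at most `n` have to be tested; this bound is what keeps the
exponents of x₀₀ positive when coordinates are multiplied in. -/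
theorem mul_mem_dualSpan {q n : ℕ} {f : CoordRing (ZMod p)}
    (h : ∀ t : ℕ × ℕ × ℕ, t.1 + t.2.1 + t.2.2 ≤ n → f * dualMonomial q t ∈ dualSpan p q n)
    {s : CoordRing (ZMod p)} (hs : s ∈ dualSpan p q n) : f * s ∈ dualSpan p q n := by
  obtain ⟨x, hx, y, hy, rfl⟩ := Submodule.mem_sup.1 hs
  rw [mul_add]
  refine Submodule.add_mem _ ?_ (mem_dualSpan_of_mem_pow (Ideal.mul_mem_left _ _ hy))
  clear hs
  induction hx using Submodule.span_induction with
  | mem x hx => obtain ⟨t, ht, rfl⟩ := hx; exact h t ht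
  | zero => rw [mul_zero]; exact Submodule.zero_mem _
  | add u u' _ _ hu hu' =>
    rw [mul_add]
    exact Submodule.add_mem _ hu hu'
  | smul c u _ hu =>
    rw [mul_smul_comm]
    exact Submodule.smul_mem _ c hu

/-- The multipliers preserving the span form a subalgebra. It contains the four coordinates, and 1
lies in the span. -/
theorem dualSpan_eq_top {r n : ℕ} (hn : n < p ^ r) (f : CoordRing (ZMod p)) :
    f ∈ dualSpan p (p ^ r) n := by
  set x := univPoint (ZMod p) with hx
  set q := p ^ r with hq
  have h00 : ∀ t : ℕ × ℕ × ℕ, x 0 0 * dualMonomial q t =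
      dualMonomial q t + dualMonomial q (t.1, t.2.1 + 1, t.2.2) := fun t => by
    simp only [dualMonomial, ← hx]
    ring
  have m00 : ∀ s ∈ dualSpan p q n, x 0 0 * s ∈ dualSpan p q n := fun s =>
    mul_mem_dualSpan fun t _ => by
      rw [h00]
      exact Submodule.add_mem _ (dualMonomial_mem_dualSpan _ _ _) (dualMonomial_mem_dualSpan _ _ _)
  have m10 : ∀ s ∈ dualSpan p q n, x 1 0 * s ∈ dualSpan p q n := fun s =>
    mul_mem_dualSpan fun t ht => by
      -- Raising the exponent of x₁₀ costs one power of x₀₀, available because the degree is at most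
      -- n < q.
      have h : x 1 0 * dualMonomial q t = x 0 0 * dualMonomial q (t.1 + 1, t.2.1, t.2.2) := by
        simp only [dualMonomial, ← hx]
        rw [show q - t.1 - t.2.2 = (q - (t.1 + 1) - t.2.2) + 1 by lia]
        ring
      rw [h]
      exact m00 _ (dualMonomial_mem_dualSpan _ _ _)
  have m01 : ∀ s ∈ dualSpan p q n, x 0 1 * s ∈ dualSpan p q n := fun s =>
    mul_mem_dualSpan fun t ht => by
      have h : x 0 1 * dualMonomial q t = x 0 0 * dualMonomial q (t.1, t.2.1, t.2.2 + 1) := by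
        simp only [dualMonomial, ← hx]
        rw [show q - t.1 - t.2.2 = (q - t.1 - (t.2.2 + 1)) + 1 by lia]
        ring
      rw [h]
      exact m00 _ (dualMonomial_mem_dualSpan _ _ _)
  -- Modulo the relevant power of the ideal x₀₀ is invertible with inverse x₀₀^(q - 1), so the
  -- determinant equation expresses x₁₁ through the other coordinates.
  have hone : x 0 0 ^ q - 1 ∈ augIdeal (ZMod p) (CoordRing (ZMod p)) ^ (n + 1) := by
    have h : x 0 0 ^ q - 1 = (x 0 0 - 1) ^ q := by
      rw [hq, sub_pow_char_pow, one_pow]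
    rw [h]
    refine Ideal.pow_le_pow_right hn (Ideal.pow_mem_pow ?_ q)
    simpa using univPoint_sub_mem (k := ZMod p) 0 0
  have mpow : ∀ j, ∀ s ∈ dualSpan p q n, x 0 0 ^ j * s ∈ dualSpan p q n := fun j => by
    induction j with
    | zero => intro s hs; simpa using hs
    | succ j ih => intro s hs; rw [pow_succ, mul_assoc]; exact ih _ (m00 s hs)
  have m11 : ∀ s ∈ dualSpan p q n, x 1 1 * s ∈ dualSpan p q n := fun s hs => by
    have hq1 : q = (q - 1) + 1 := by lia
    have h : x 1 1 * s = (x 0 0 ^ (q - 1) * s + x 0 0 ^ (q - 1) * (x 0 1 * (x 1 0 * s))) -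
        (x 1 1 * s) * (x 0 0 ^ q - 1) := by
      have hdet := univPoint_det (ZMod p)
      rw [← hx] at hdet
      have : x 0 0 ^ q = x 0 0 ^ (q - 1) * x 0 0 := by rw [← pow_succ, ← hq1]
      rw [this]
      linear_combination (x 0 0 ^ (q - 1) * s) * hdet
    rw [h]
    exact Submodule.sub_mem _ (Submodule.add_mem _ (mpow _ _ hs) (mpow _ _ (m01 _ (m10 _ hs))))
      (mem_dualSpan_of_mem_pow (Ideal.mul_mem_left _ _ hone))
  let T : Subalgebra (ZMod p) (CoordRing (ZMod p)) :=
    { carrier := {f | ∀ s ∈ dualSpan p q n, f * s ∈ dualSpan p q n}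
      mul_mem' := fun {a b} ha hb s hs => by
        rw [mul_assoc]
        exact ha _ (hb _ hs)
      add_mem' := fun {a b} ha hb s hs => by
        rw [add_mul]
        exact Submodule.add_mem _ (ha _ hs) (hb _ hs)
      algebraMap_mem' := fun c s hs => by
        rw [← Algebra.smul_def]
        exact Submodule.smul_mem _ c hs }
  have hT : f ∈ T := coordRing_subalgebra_eq_top (fun i j => by
    fin_cases i <;> fin_cases j
    exacts [m00, m01, m10, m11]) f
  -- The dual monomial with exponents zero is x₀₀^q, which is congruent to 1.
  have h1 : (1 : CoordRing (ZMod p)) ∈ dualSpan p q n := by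
    have h := Submodule.sub_mem _ (dualMonomial_mem_dualSpan (p := p) q n (0, 0, 0))
      (mem_dualSpan_of_mem_pow (q := q) hone)
    simpa [dualMonomial, ← hx] using h
  simpa using hT 1 h1

/-- A distribution of order at most `n` is determined by its values on the dual monomials of degree
at most `n`, and these values are its coefficients. The exponent r = n is large enough since n <
p^n. -/
theorem distOrder_eq_span (n : ℕ) : distOrder (ZMod p) (CoordRing (ZMod p)) n =
    Submodule.span (ZMod p) (pbw '' {t | t.1 + t.2.1 + t.2.2 ≤ n}) := by
  refine le_antisymm (fun μ hμ => ?_) ?_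
  · have hn : n < p ^ n := Nat.lt_pow_self (Fact.out : p.Prime).one_lt
    let s : Finset (ℕ × ℕ × ℕ) := (Finset.range (n + 1) ×ˢ Finset.range (n + 1) ×ˢ
      Finset.range (n + 1)).filter fun t => t.1 + t.2.1 + t.2.2 ≤ n
    have hs : ∀ t, t ∈ s ↔ t.1 + t.2.1 + t.2.2 ≤ n := fun t => by
      simp only [s, Finset.mem_filter, Finset.mem_product, Finset.mem_range]
      lia
    have h : μ = ∑ t ∈ s, μ (dualMonomial (p ^ n) t) • pbw t := by
      set ν := ∑ t ∈ s, μ (dualMonomial (p ^ n) t) • pbw (k := ZMod p) t with hν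
      have hνn : ν ∈ distOrder (ZMod p) (CoordRing (ZMod p)) n := Submodule.sum_mem _ fun t ht =>
        Submodule.smul_mem _ _ (distOrder_mono ((hs t).1 ht) (pbw_mem (k := ZMod p) t))
      ext f
      obtain ⟨x, hx, y, hy, rfl⟩ := Submodule.mem_sup.1 (dualSpan_eq_top hn f)
      change μ.ofConv (x + y) = ν.ofConv (x + y)
      rw [map_add, map_add]
      congr 1
      · clear hνn
        induction hx using Submodule.span_induction with
        | mem x hx =>
          obtain ⟨t, ht, rfl⟩ := hx
          change t.1 + t.2.1 + t.2.2 ≤ n at ht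
          change _ = functionalEval (dualMonomial (p ^ n) t) ν
          rw [hν, map_sum, Finset.sum_eq_single t]
          · rw [map_smul, functionalEval_apply,
              pbw_dualMonomial (by lia) (by lia), if_pos rfl, smul_eq_mul, mul_one]
          · intro t' ht' htt
            have := (hs t').1 ht'
            rw [map_smul, functionalEval_apply, pbw_dualMonomial (by lia) (by lia), if_neg htt,
              smul_zero]
          · intro h
            exact absurd ((hs t).2 ht) h
        | zero => rw [map_zero, map_zero]
        | add u u' _ _ hu hu' => rw [map_add, map_add, hu, hu']
        | smul c u _ hu => rw [map_smul, map_smul, hu]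
      · exact (hμ y hy).trans (hνn y hy).symm
    rw [h]
    exact Submodule.sum_mem _ fun t ht =>
      Submodule.smul_mem _ _ (Submodule.subset_span ⟨t, (hs t).1 ht, rfl⟩)
  · rw [Submodule.span_le]
    rintro _ ⟨t, ht, rfl⟩
    exact distOrder_mono ht (pbw_mem t)

end PrimeField

/-! ### The splitting on distributions and its multiplicativity. -/

section FrobeniusSplitting

variable {p : ℕ} [Fact p.Prime]

theorem torusFunctional_mem_distOrder {k : Type*} [Field k] {n : ℕ} {u : ℤ → k}
    (hu : u ∈ binomSpan k (n + 1)) : torusFunctional u ∈ distOrder k (CoordRing k) n := by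
  have h : binomSpan k (n + 1) ≤ (distOrder k (CoordRing k) n).comap torusAlgHom.toLinearMap := by
    rw [binomSpan, Submodule.span_le]
    rintro _ ⟨j, hj, rfl⟩
    change torusFunctional (zbinom k j) ∈ distOrder k (CoordRing k) n
    rw [← binomH_eq]
    exact distOrder_mono (Nat.le_of_lt_succ hj) (binomH_mem k j)
  exact h hu

theorem divE_mul_torusFunctional {k : Type*} [Field k] (c : ℕ) (u : ℤ → k) :
    divE k c * torusFunctional u = torusFunctional (fun h => u (h - 2 * c)) * divE k c := by
  rw [torusFunctional_mul_divE]
  simp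

/-- The effect of moving `divE c` past a monomial, on the torus part. -/
def crossTerm {k : Type*} [Field k] (c a : ℕ) (u : ℤ → k) (K : ℕ) : ℤ → k :=
  fun h => zbinom k K (h - a - c + 2 * K) * u (h - 2 * (c - K : ℕ))

/-- Normal ordering: E^[c] first passes F^[a], and the remaining divided power of E then passes u,
which shifts the argument. -/
theorem divE_mul_monomial {k : Type*} [Field k] (c a : ℕ) (u : ℤ → k) (c' : ℕ) :
    divE k c * (divF k a * torusFunctional u * divE k c') =
      ∑ K ∈ Finset.range (min a c + 1), ((c - K + c').choose (c - K) : k) •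
        (divF k (a - K) * torusFunctional (crossTerm c a u K) * divE k (c - K + c')) := by
  rw [← mul_assoc, ← mul_assoc, divE_mul_divF, Finset.sum_mul, Finset.sum_mul]
  refine Finset.sum_congr rfl fun K _ => ?_
  rw [mul_assoc _ (divE k (c - K)), divE_mul_torusFunctional, mul_assoc, mul_assoc, mul_assoc,
    divE_mul_divE, mul_smul_comm, mul_smul_comm, mul_smul_comm,
    ← mul_assoc (torusFunctional _), torusFunctional_mul, mul_assoc]
  rfl

theorem divF_mul_torusFunctional_mul_monomial {k : Type*} [Field k] (a : ℕ) (u : ℤ → k)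
    (a' : ℕ) (u' : ℤ → k) (c : ℕ) :
    divF k a * torusFunctional u * (divF k a' * torusFunctional u' * divE k c) =
      ((a + a').choose a : k) • (divF k (a + a') *
        torusFunctional ((fun h => u (h - 2 * a')) * u') * divE k c) := by
  rw [← torusFunctional_mul, ← smul_mul_assoc, ← smul_mul_assoc, ← divF_mul_divF]
  simp only [mul_assoc]
  rw [← mul_assoc (torusFunctional u), torusFunctional_mul_divF]
  simp only [mul_assoc]

/-- Linear independence prescribes the map on the span of the monomials. The extension to all
functionals is arbitrary; it only spares carrying membership proofs. -/
theorem exists_frobSplit : ∃ f : Functional (ZMod p) (CoordRing (ZMod p)) →ₗ[ZMod p]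
    Functional (ZMod p) (CoordRing (ZMod p)), ∀ t, f (pbw t) = divF (ZMod p) (p * t.1) *
      torusFunctional (stretch p (zbinom (ZMod p) t.2.1)) * divE (ZMod p) (p * t.2.2) := by
  obtain ⟨f, hf⟩ := LinearMap.exists_extend
    ((Module.Basis.span (pbw_linearIndependent (p := p))).constr (ZMod p)
      fun t => divF (ZMod p) (p * t.1) * torusFunctional (stretch p (zbinom (ZMod p) t.2.1)) *
        divE (ZMod p) (p * t.2.2))
  refine ⟨f, fun t => ?_⟩
  have h := LinearMap.congr_fun hf (Module.Basis.span (pbw_linearIndependent (p := p)) t)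
  rw [Module.Basis.constr_basis] at h
  rw [← h, LinearMap.comp_apply, Submodule.subtype_apply, Module.Basis.span_apply]

variable (p) in
/-- A linear map on functionals that restricts to the splitting of the Frobenius morphism on
distributions. -/
def frobSplit : Functional (ZMod p) (CoordRing (ZMod p)) →ₗ[ZMod p]
    Functional (ZMod p) (CoordRing (ZMod p)) := exists_frobSplit.choose

theorem frobSplit_pbw (t : ℕ × ℕ × ℕ) : frobSplit p (pbw t) = divF (ZMod p) (p * t.1) *
    torusFunctional (stretch p (zbinom (ZMod p) t.2.1)) * divE (ZMod p) (p * t.2.2) :=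
  exists_frobSplit.choose_spec t

theorem pbw_eq {k : Type*} [Field k] (a b c : ℕ) :
    pbw (k := k) (a, b, c) = divF k a * torusFunctional (zbinom k b) * divE k c := by
  rw [pbw, binomH_eq]

/-- The restriction to combinations of binomials is needed because the chosen extension is
uncontrolled outside the distributions. -/
theorem frobSplit_monomial (a : ℕ) {n : ℕ} {u : ℤ → ZMod p} (hu : u ∈ binomSpan (ZMod p) n)
    (c : ℕ) : frobSplit p (divF (ZMod p) a * torusFunctional u * divE (ZMod p) c) =
      divF (ZMod p) (p * a) * torusFunctional (stretch p u) * divE (ZMod p) (p * c) := by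
  simp only [← torusAlgHom_apply]
  induction hu using Submodule.span_induction with
  | mem u hu =>
    obtain ⟨j, _, rfl⟩ := hu
    simp only [torusAlgHom_apply, ← pbw_eq, frobSplit_pbw]
  | zero => simp
  | add u u' _ _ hu hu' => simp only [map_add, mul_add, add_mul, hu, hu']
  | smul c u _ hu => simp only [map_smul, mul_smul_comm, smul_mul_assoc, hu]

theorem one_mem_binomSpan {k : Type*} [Field k] : (1 : ℤ → k) ∈ binomSpan k 1 := by
  have h : zbinom k 0 = 1 := funext fun h => zbinom_zero_left k h
  exact h ▸ zbinom_mem one_pos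

theorem frobSplit_divF_mul_torusFunctional (a : ℕ) {n : ℕ} {u : ℤ → ZMod p}
    (hu : u ∈ binomSpan (ZMod p) n) :
    frobSplit p (divF (ZMod p) a * torusFunctional u) =
      divF (ZMod p) (p * a) * torusFunctional (stretch p u) := by
  simpa [divE_zero] using frobSplit_monomial a hu 0

theorem frobSplit_divE (c : ℕ) : frobSplit p (divE (ZMod p) c) =
    torusFunctional (primeIndicator p) * divE (ZMod p) (p * c) := by
  have h := frobSplit_monomial (p := p) 0 one_mem_binomSpan c
  rwa [stretch_one, torusFunctional_one, mul_zero, divF_zero, one_mul, one_mul, one_mul] at h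

theorem primeIndicator_shift (m : ℤ) :
    (fun h => primeIndicator p (h + p * m)) = primeIndicator p := by
  rw [← stretch_one, ← stretch_shift]
  rfl

theorem crossTerm_mem {k : Type*} [Field k] (c a : ℕ) {n : ℕ} {u : ℤ → k}
    (hu : u ∈ binomSpan k n) (K : ℕ) : crossTerm c a u K ∈ binomSpan k (K + 1 + n) := by
  refine mul_mem_binomSpan ?_ ?_
  · convert shift_mem_binomSpan (-a - c + 2 * K) (zbinom_mem (k := k) (Nat.lt_succ_self K)) using 3
    ring
  · exact shift_mem_binomSpan (-(2 * ((c - K : ℕ) : ℤ))) hu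

theorem sum_range_prime_mul {G : Type*} [AddCommMonoid G] {q : ℕ} (hq : q ≠ 0) (n : ℕ) (f : ℕ → G)
    (hf : ∀ K, ¬ q ∣ K → f K = 0) :
    ∑ K ∈ Finset.range (q * n + 1), f K = ∑ K ∈ Finset.range (n + 1), f (q * K) := by
  have hinj : Set.InjOn (fun K => q * K) (Finset.range (n + 1) : Set ℕ) :=
    fun a _ b _ h => Nat.eq_of_mul_eq_mul_left (Nat.pos_of_ne_zero hq) h
  rw [← Finset.sum_image (f := f) hinj]
  refine (Finset.sum_subset ?_ fun K hK hK' => hf K ?_).symm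
  · intro K hK
    obtain ⟨i, hi, rfl⟩ := Finset.mem_image.1 hK
    rw [Finset.mem_range, Nat.lt_succ_iff] at hi ⊢
    exact Nat.mul_le_mul_left q hi
  · rintro ⟨i, rfl⟩
    refine hK' (Finset.mem_image.2 ⟨i, ?_, rfl⟩)
    rw [Finset.mem_range, Nat.lt_succ_iff] at hK ⊢
    exact Nat.le_of_mul_le_mul_left hK (Nat.pos_of_ne_zero hq)

/-- Where the indicator is nonzero, the argument of the binomial in `crossTerm` is a multiple of
`p`, and there a binomial of degree prime to `p` vanishes. -/
theorem indicator_mul_crossTerm (c a : ℕ) (u : ℤ → ZMod p) {K : ℕ} (hKa : K ≤ p * a)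
    (hK : ¬ p ∣ K) : (fun h => primeIndicator p (h - 2 * (p * a - K : ℕ))) *
      crossTerm (p * c) (p * a) (stretch p u) K = 0 := by
  funext h
  simp only [Pi.mul_apply, Pi.zero_apply, crossTerm, primeIndicator]
  split_ifs with hd
  · have h2 : (p : ℤ) ∣ h - (p * a : ℕ) - (p * c : ℕ) + 2 * K := by
      obtain ⟨e, he⟩ := hd
      rw [Nat.cast_sub hKa] at he
      refine ⟨e + a - c, ?_⟩
      push_cast at he ⊢
      linear_combination he
    obtain ⟨e, he⟩ := h2
    rw [he, zbinom_prime_mul, if_neg hK, zero_mul, mul_zero]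
  · rw [zero_mul]

theorem indicator_mul_crossTerm_prime_mul {c a : ℕ} (u : ℤ → ZMod p) (K : ℕ) :
    (fun h => primeIndicator p (h - 2 * (p * a - p * K : ℕ))) *
      crossTerm (p * c) (p * a) (stretch p u) (p * K) = stretch p (crossTerm c a u K) := by
  have hp : (p : ℤ) ≠ 0 := Int.natCast_ne_zero.2 (Fact.out : p.Prime).ne_zero
  funext h
  rw [← Nat.mul_sub, Pi.mul_apply, stretch_apply]
  unfold crossTerm
  rw [← Nat.mul_sub, stretch_apply, primeIndicator]
  by_cases hd : (p : ℤ) ∣ h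
  · obtain ⟨e, rfl⟩ := hd
    have h1 : (p : ℤ) * e - (p * a : ℕ) - (p * c : ℕ) + 2 * (p * K : ℕ) =
        p * (e - a - c + 2 * K) := by push_cast; ring
    have h2 : (p : ℤ) * e - 2 * (p * (c - K) : ℕ) = p * (e - 2 * (c - K : ℕ)) := by
      push_cast; ring
    have h3 : (p : ℤ) * e - 2 * (p * (a - K) : ℕ) = p * (e - 2 * (a - K : ℕ)) := by
      push_cast; ring
    rw [h1, h2, h3, if_pos (dvd_mul_right _ _), if_pos (dvd_mul_right _ _),
      if_pos (dvd_mul_right _ _), one_mul, zbinom_prime_mul, if_pos (dvd_mul_right _ _),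
      Nat.mul_div_cancel_left _ (Fact.out : p.Prime).pos, Int.mul_ediv_cancel_left _ hp,
      Int.mul_ediv_cancel_left _ hp]
  · rw [if_neg hd, if_neg, zero_mul]
    intro hd'
    rw [Nat.cast_mul] at hd'
    refine hd ((dvd_sub_left ?_).1 hd')
    exact Dvd.dvd.mul_left (dvd_mul_right _ _) _

/-- The commutation formula is applied before and after splitting. After splitting, the indicator
coming from E^[c] is moved past F and annihilates the terms with `K` not divisible by `p`; those
with index pK match the unsplit terms one by one, up to Lucas' congruence. -/
theorem frobSplit_divE_mul (c a : ℕ) {n : ℕ} {u : ℤ → ZMod p} (hu : u ∈ binomSpan (ZMod p) n)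
    (c' : ℕ) :
    frobSplit p (divE (ZMod p) c * (divF (ZMod p) a * torusFunctional u * divE (ZMod p) c')) =
      frobSplit p (divE (ZMod p) c) *
        frobSplit p (divF (ZMod p) a * torusFunctional u * divE (ZMod p) c') := by
  have hp : p ≠ 0 := (Fact.out : p.Prime).ne_zero
  rw [divE_mul_monomial, map_sum, frobSplit_divE, frobSplit_monomial a hu, mul_assoc,
    divE_mul_monomial, Nat.mul_min_mul_left, Finset.mul_sum]
  have h1 : ∀ K ∈ Finset.range (p * min a c + 1), torusFunctional (primeIndicator p) *
      ((p * c - K + p * c').choose (p * c - K) : ZMod p) • (divF (ZMod p) (p * a - K) *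
        torusFunctional (crossTerm (p * c) (p * a) (stretch p u) K) *
        divE (ZMod p) (p * c - K + p * c')) =
      if p ∣ K then ((p * c - K + p * c').choose (p * c - K) : ZMod p) •
        (divF (ZMod p) (p * a - K) * torusFunctional
        ((fun h => primeIndicator p (h - 2 * (p * a - K : ℕ))) *
          crossTerm (p * c) (p * a) (stretch p u) K) * divE (ZMod p) (p * c - K + p * c'))
      else 0 := by
    intro K hK
    have hKa : K ≤ p * a := (Nat.le_of_lt_succ (Finset.mem_range.1 hK)).trans
      (Nat.mul_le_mul_left p (min_le_left _ _))
    rw [mul_smul_comm, ← mul_assoc, ← mul_assoc, torusFunctional_mul_divF, mul_assoc (divF _ _),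
      torusFunctional_mul]
    split_ifs with hd
    · rfl
    · rw [indicator_mul_crossTerm c a u hKa hd, ← torusAlgHom_apply, map_zero, mul_zero, zero_mul,
        smul_zero]
  rw [Finset.sum_congr rfl h1, sum_range_prime_mul hp _ _ fun K hK => if_neg hK]
  refine Finset.sum_congr rfl fun K _ => ?_
  rw [if_pos (dvd_mul_right _ _), indicator_mul_crossTerm_prime_mul u K, map_smul,
    frobSplit_monomial _ (crossTerm_mem c a hu K), ← Nat.mul_sub, ← Nat.mul_sub, ← mul_add,
    choose_prime_mul]

theorem frobSplit_divF_mul (a : ℕ) {n : ℕ} {u : ℤ → ZMod p} (hu : u ∈ binomSpan (ZMod p) n)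
    (a' : ℕ) {n' : ℕ} {u' : ℤ → ZMod p} (hu' : u' ∈ binomSpan (ZMod p) n') (c : ℕ) :
    frobSplit p (divF (ZMod p) a * torusFunctional u *
        (divF (ZMod p) a' * torusFunctional u' * divE (ZMod p) c)) =
      frobSplit p (divF (ZMod p) a * torusFunctional u) *
        frobSplit p (divF (ZMod p) a' * torusFunctional u' * divE (ZMod p) c) := by
  have hshift : (fun h => u (h - 2 * a')) ∈ binomSpan (ZMod p) n :=
    shift_mem_binomSpan (-(2 * (a' : ℤ))) hu
  rw [divF_mul_torusFunctional_mul_monomial, map_smul,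
    frobSplit_monomial _ (mul_mem_binomSpan hshift hu'), frobSplit_divF_mul_torusFunctional a hu,
    frobSplit_monomial a' hu', divF_mul_torusFunctional_mul_monomial, stretch_mul, ← mul_add,
    choose_prime_mul]
  have h := stretch_shift u (-(2 * (a' : ℤ)))
  simp only [← sub_eq_add_neg] at h
  rw [h]
  have h' : ∀ z : ℤ, z + p * -(2 * (a' : ℤ)) = z - 2 * (p * a' : ℕ) := fun z => by
    push_cast
    ring
  simp only [h']

theorem mem_span_pbw {μ : Functional (ZMod p) (CoordRing (ZMod p))}
    (hμ : μ ∈ dist (ZMod p) (CoordRing (ZMod p))) :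
    μ ∈ Submodule.span (ZMod p) (Set.range (pbw (k := ZMod p))) := by
  obtain ⟨n, hn⟩ := hμ
  rw [distOrder_eq_span] at hn
  exact Submodule.span_mono (Set.image_subset_range _ _) hn

theorem frobSplit_mul_of_monomial {μ : Functional (ZMod p) (CoordRing (ZMod p))}
    (h : ∀ t, frobSplit p (μ * pbw t) = frobSplit p μ * frobSplit p (pbw t))
    {ν : Functional (ZMod p) (CoordRing (ZMod p))}
    (hν : ν ∈ dist (ZMod p) (CoordRing (ZMod p))) :
    frobSplit p (μ * ν) = frobSplit p μ * frobSplit p ν := by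
  have hs := mem_span_pbw hν
  clear hν
  induction hs using Submodule.span_induction with
  | mem ν hν => obtain ⟨t, rfl⟩ := hν; exact h t
  | zero => simp
  | add u u' _ _ hu hu' => simp only [mul_add, map_add, hu, hu']
  | smul c u _ hu => simp only [mul_smul_comm, map_smul, hu]

/-- An ordered monomial is F^[a] binom(H, b) times E^[c], and multiplicativity was proved for either
factor on the left; associativity combines the two. -/
theorem frobSplit_mul {μ ν : Functional (ZMod p) (CoordRing (ZMod p))}
    (hμ : μ ∈ dist (ZMod p) (CoordRing (ZMod p)))
    (hν : ν ∈ dist (ZMod p) (CoordRing (ZMod p))) :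
    frobSplit p (μ * ν) = frobSplit p μ * frobSplit p ν := by
  have key : ∀ t, frobSplit p (pbw t * ν) = frobSplit p (pbw t) * frobSplit p ν := by
    rintro ⟨a, b, c⟩
    have hb : zbinom (ZMod p) b ∈ binomSpan (ZMod p) (b + 1) := zbinom_mem (Nat.lt_succ_self b)
    have hE : ∀ ν ∈ dist (ZMod p) (CoordRing (ZMod p)), frobSplit p (divE (ZMod p) c * ν) =
        frobSplit p (divE (ZMod p) c) * frobSplit p ν := fun ν hν =>
      frobSplit_mul_of_monomial (fun t => by
        rw [pbw, binomH_eq]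
        exact frobSplit_divE_mul _ _ (zbinom_mem (Nat.lt_succ_self _)) _) hν
    have hF : ∀ ν ∈ dist (ZMod p) (CoordRing (ZMod p)),
        frobSplit p (divF (ZMod p) a * torusFunctional (zbinom (ZMod p) b) * ν) =
        frobSplit p (divF (ZMod p) a * torusFunctional (zbinom (ZMod p) b)) * frobSplit p ν :=
      fun ν hν => frobSplit_mul_of_monomial (fun t => by
        rw [pbw, binomH_eq]
        exact frobSplit_divF_mul _ hb _ (zbinom_mem (Nat.lt_succ_self _)) _) hν
    have hEmem : divE (ZMod p) c ∈ dist (ZMod p) (CoordRing (ZMod p)) := ⟨c, divE_mem _ c⟩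
    rw [pbw_eq, mul_assoc, hF _ (Subalgebra.mul_mem _ hEmem hν), hE _ hν, hF _ hEmem, mul_assoc]
  have hs := mem_span_pbw hμ
  clear hμ
  induction hs using Submodule.span_induction with
  | mem ν hν => obtain ⟨t, rfl⟩ := hν; exact key t
  | zero => simp
  | add u u' _ _ hu hu' => simp only [add_mul, map_add, hu, hu']
  | smul c u _ hu => simp only [smul_mul_assoc, map_smul, hu]

end FrobeniusSplitting

/-! ### The norm as an idempotent, and the values of the splitting on generators. -/

section TorusNorm

variable {p : ℕ} [Fact p.Prime]

variable (p) in
/-- The idempotent functional attached to the indicator function of the weights divisible by `p`,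
which is the norm of the torus. -/
def torusNorm : Functional (ZMod p) (CoordRing (ZMod p)) := torusFunctional (primeIndicator p)

theorem torusNorm_eq_sum :
    torusNorm p = ∑ i ∈ Finset.range p, (-1 : ZMod p) ^ i • binomH (ZMod p) i := by
  rw [torusNorm, ← sum_zbinom_eq_primeIndicator, ← torusAlgHom_apply, map_sum]
  simp only [map_smul, torusAlgHom_apply, binomH_eq]

theorem torusNorm_mem : torusNorm p ∈ distOrder (ZMod p) (CoordRing (ZMod p)) (p - 1) := by
  refine torusFunctional_mem_distOrder ?_
  rw [Nat.sub_add_cancel (Fact.out : p.Prime).one_le]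
  exact primeIndicator_mem

theorem torusNorm_mul_self : torusNorm p * torusNorm p = torusNorm p := by
  rw [torusNorm, torusFunctional_mul, primeIndicator_mul_self]

/-- Passing E^[pc] shifts the indicator by 2pc, a period of it. -/
theorem torusNorm_mul_divE (c : ℕ) :
    torusNorm p * divE (ZMod p) (p * c) = divE (ZMod p) (p * c) * torusNorm p := by
  have h := primeIndicator_shift (p := p) (2 * c)
  rw [torusNorm, torusFunctional_mul_divE, Nat.cast_mul, mul_left_comm, h]

theorem torusNorm_mul_divF (a : ℕ) :
    torusNorm p * divF (ZMod p) (p * a) = divF (ZMod p) (p * a) * torusNorm p := by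
  have h := primeIndicator_shift (p := p) (2 * -a)
  rw [torusNorm, torusFunctional_mul_divF, Nat.cast_mul, mul_left_comm]
  simp only [sub_eq_add_neg, ← mul_neg]
  rw [h]

theorem torusNorm_mul_torusFunctional (u : ℤ → ZMod p) :
    torusNorm p * torusFunctional u = torusFunctional u * torusNorm p := by
  rw [torusNorm, torusFunctional_mul, torusFunctional_mul, mul_comm]

theorem torusNorm_mul_pbw (a b c : ℕ) :
    torusNorm p * pbw (p * a, b, p * c) = pbw (p * a, b, p * c) * torusNorm p := by
  rw [pbw_eq, mul_assoc _ _ (torusNorm p), ← torusNorm_mul_divE, mul_assoc _ _ (_ * _),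
    ← mul_assoc _ (torusNorm p), ← torusNorm_mul_torusFunctional]
  simp only [← mul_assoc]
  rw [torusNorm_mul_divF]

theorem frobSplit_pbw_eq_mul (a b c : ℕ) :
    frobSplit p (pbw (a, b, c)) = pbw (p * a, p * b, p * c) * torusNorm p := by
  rw [frobSplit_pbw, stretch_zbinom, ← torusFunctional_mul, pbw_eq, mul_assoc _ _ (torusNorm p),
    ← torusNorm_mul_divE]
  simp only [mul_assoc]
  rfl

/-- Detaching the norm matters for the estimates of order: the cofactor has order at most pn, while
the product with the norm is only known to have order at most pn + p - 1. -/
theorem exists_frobSplit_eq_mul {μ : Functional (ZMod p) (CoordRing (ZMod p))} {n : ℕ}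
    (hμ : μ ∈ distOrder (ZMod p) (CoordRing (ZMod p)) n) :
    ∃ x ∈ distOrder (ZMod p) (CoordRing (ZMod p)) (p * n),
      frobSplit p μ = x * torusNorm p ∧ torusNorm p * x = x * torusNorm p := by
  rw [distOrder_eq_span] at hμ
  induction hμ using Submodule.span_induction with
  | mem μ hμ =>
    obtain ⟨⟨a, b, c⟩, ht, rfl⟩ := hμ
    refine ⟨pbw (p * a, p * b, p * c), distOrder_mono ?_ (pbw_mem _), frobSplit_pbw_eq_mul a b c,
      torusNorm_mul_pbw _ _ _⟩
    simpa only [mul_add] using Nat.mul_le_mul_left p ht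
  | zero => exact ⟨0, Submodule.zero_mem _, by simp, by simp⟩
  | add μ ν _ _ hμ hν =>
    obtain ⟨x, hx, h1, h2⟩ := hμ
    obtain ⟨y, hy, h3, h4⟩ := hν
    exact ⟨x + y, Submodule.add_mem _ hx hy, by rw [map_add, h1, h3, add_mul],
      by rw [mul_add, add_mul, h2, h4]⟩
  | smul c μ _ hμ =>
    obtain ⟨x, hx, h1, h2⟩ := hμ
    exact ⟨c • x, Submodule.smul_mem _ _ hx, by rw [map_smul, h1, smul_mul_assoc],
      by rw [mul_smul_comm, smul_mul_assoc, h2]⟩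

theorem frobSplit_mem {μ : Functional (ZMod p) (CoordRing (ZMod p))} {n : ℕ}
    (hμ : μ ∈ distOrder (ZMod p) (CoordRing (ZMod p)) n) :
    frobSplit p μ ∈ distOrder (ZMod p) (CoordRing (ZMod p)) (p * n + (p - 1)) := by
  obtain ⟨x, hx, h, -⟩ := exists_frobSplit_eq_mul hμ
  rw [h]
  exact mul_mem_distOrder hx torusNorm_mem

theorem frobSplit_one : frobSplit p 1 = torusNorm p := by
  have h := frobSplit_divE (p := p) 0
  rwa [mul_zero, divE_zero, mul_one] at h

theorem frobSplit_divE_eq (i : ℕ) :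
    frobSplit p (divE (ZMod p) i) = divE (ZMod p) (i * p) * torusNorm p := by
  rw [frobSplit_divE, mul_comm i, ← torusNorm_mul_divE, torusNorm]

theorem frobSplit_torusFunctional {n : ℕ} {u : ℤ → ZMod p} (hu : u ∈ binomSpan (ZMod p) n) :
    frobSplit p (torusFunctional u) = torusFunctional (stretch p u) := by
  simpa [divF_zero] using frobSplit_divF_mul_torusFunctional 0 hu

theorem frobSplit_divF_eq (i : ℕ) :
    frobSplit p (divF (ZMod p) i) = divF (ZMod p) (i * p) * torusNorm p := by
  have h := frobSplit_divF_mul_torusFunctional (p := p) i one_mem_binomSpan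
  rwa [stretch_one, torusFunctional_one, mul_one, mul_comm p] at h

theorem frobSplit_binomH (i : ℕ) :
    frobSplit p (binomH (ZMod p) i) = binomH (ZMod p) (i * p) * torusNorm p := by
  rw [binomH_eq, frobSplit_torusFunctional (zbinom_mem (Nat.lt_succ_self i)), stretch_zbinom,
    ← torusFunctional_mul, mul_comm p, binomH_eq, torusNorm]

end TorusNorm

/-! ### Strict bounds on the order. -/

section StrictOrder

variable {k A : Type*} [CommRing k] [CommRing A] [Bialgebra k A]

variable (k A) in
/-- Distributions of order less than `n`. -/
def distOrderLT (n : ℕ) : Submodule k (Functional k A) where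
  carrier := {μ | ∀ f ∈ augIdeal k A ^ n, μ f = 0}
  zero_mem' := fun f _ => rfl
  add_mem' := fun {μ ν} hμ hν f hf => by
    change μ f + ν f = 0
    rw [hμ f hf, hν f hf, add_zero]
  smul_mem' := fun c μ hμ f hf => by
    change c • μ f = 0
    rw [hμ f hf, smul_zero]

theorem distOrderLT_succ (n : ℕ) : distOrderLT k A (n + 1) = distOrder k A n := rfl

/-- The zeroth power of the ideal is the whole ring. Strict bounds thus give meaning to order -1,
where truncated subtraction would lose information. -/
theorem distOrderLT_zero : distOrderLT k A 0 = ⊥ := by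
  rw [eq_bot_iff]
  intro μ hμ
  refine (Submodule.mem_bot k).2 (WithConv.ext (LinearMap.ext fun f => hμ f ?_))
  simp

theorem mul_mem_distOrderLT {μ ν : Functional k A} {n n' : ℕ} (hμ : μ ∈ distOrderLT k A n)
    (hν : ν ∈ distOrder k A n') : μ * ν ∈ distOrderLT k A (n + n') := by
  cases n with
  | zero =>
    rw [distOrderLT_zero, Submodule.mem_bot] at hμ
    rw [hμ, zero_mul]
    exact Submodule.zero_mem _
  | succ n =>
    rw [add_right_comm]
    exact mul_mem_distOrder hμ hν

theorem mul_mem_distOrderLT' {μ ν : Functional k A} {n n' : ℕ} (hμ : μ ∈ distOrder k A n)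
    (hν : ν ∈ distOrderLT k A n') : μ * ν ∈ distOrderLT k A (n + n') := by
  cases n' with
  | zero =>
    rw [distOrderLT_zero, Submodule.mem_bot] at hν
    rw [hν, mul_zero]
    exact Submodule.zero_mem _
  | succ n' => exact mul_mem_distOrder hμ hν

/-- For f in the r-th power of the ideal, the comultiplication of f and its flip differ by an
element of the (r + 1)-st power. Two distributions of order 0 therefore commute. -/
theorem commutator_mem_distOrderLT {μ ν : Functional k A} {n n' : ℕ} (hμ : μ ∈ distOrder k A n)
    (hν : ν ∈ distOrder k A n') : μ * ν - ν * μ ∈ distOrderLT k A (n + n') := fun f hf => by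
  have hcomm : ∀ t : A ⊗[k] A, LinearMap.mul' k k (TensorProduct.map ν.ofConv μ.ofConv t) =
      LinearMap.mul' k k (TensorProduct.map μ.ofConv ν.ofConv
        (Algebra.TensorProduct.comm k A A t)) := by
    intro t
    induction t with
    | zero => simp
    | add x y hx hy => simp only [map_add, hx, hy]
    | tmul a b => simp [mul_comm]
  change (μ * ν) f - (ν * μ) f = 0
  rw [LinearMap.convMul_apply, LinearMap.convMul_apply, hcomm, ← map_sub, ← map_sub]
  exact map_eq_zero_of_mem hμ hν (comul_sub_comm_mem hf)

end StrictOrder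

/-! ### The associated graded algebra and factorization of distributions of high order. -/

section OrderSplit

variable {p : ℕ} [Fact p.Prime]

theorem torusFunctional_mem_distOrderLT {k : Type*} [Field k] {n : ℕ} {u : ℤ → k}
    (hu : u ∈ binomSpan k n) : torusFunctional u ∈ distOrderLT k (CoordRing k) n := by
  cases n with
  | zero =>
    rw [binomSpan_zero, Submodule.mem_bot] at hu
    rw [hu, ← torusAlgHom_apply, map_zero]
    exact Submodule.zero_mem _
  | succ n => exact torusFunctional_mem_distOrder hu

/-- The associated graded algebra is the divided power algebra in three variables. -/
theorem pbw_mul_pbw_sub_mem {k : Type*} [Field k] (a b c a' b' c' : ℕ) :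
    pbw (a, b, c) * pbw (a', b', c') -
      ((a + a').choose a * (b + b').choose b * (c + c').choose c : k) •
        pbw (a + a', b + b', c + c') ∈
      distOrderLT k (CoordRing k) (a + b + c + (a' + b' + c')) := by
  -- Reordering the six factors costs two commutators, E past F and H, then H past F; together with
  -- the lower terms of a product of binomials these are the three corrections `h1`, `h2`, `h3`.
  have h1 : divF k a * binomH k b *
      (divE k c * (divF k a' * binomH k b') - divF k a' * binomH k b' * divE k c) * divE k c' ∈
      distOrderLT k (CoordRing k) (a + b + c + (a' + b' + c')) := by
    have e : a + b + c + (a' + b' + c') = a + b + (c + (a' + b')) + c' := by ring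
    rw [e]
    exact mul_mem_distOrderLT (mul_mem_distOrderLT'
      (mul_mem_distOrder (divF_mem k a) (binomH_mem k b)) (commutator_mem_distOrderLT (divE_mem k c)
        (mul_mem_distOrder (divF_mem k a') (binomH_mem k b')))) (divE_mem k c')
  have h2 : divF k a * (binomH k b * divF k a' - divF k a' * binomH k b) *
      (binomH k b' * (divE k c * divE k c')) ∈
      distOrderLT k (CoordRing k) (a + b + c + (a' + b' + c')) := by
    have e : a + b + c + (a' + b' + c') = a + (b + a') + (b' + (c + c')) := by ring
    rw [e]
    exact mul_mem_distOrderLT (mul_mem_distOrderLT' (divF_mem k a)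
      (commutator_mem_distOrderLT (binomH_mem k b) (divF_mem k a')))
      (mul_mem_distOrder (binomH_mem k b') (mul_mem_distOrder (divE_mem k c) (divE_mem k c')))
  have h3 : (divF k a * divF k a') *
      (binomH k b * binomH k b' - ((b + b').choose b : k) • binomH k (b + b')) *
      (divE k c * divE k c') ∈ distOrderLT k (CoordRing k) (a + b + c + (a' + b' + c')) := by
    have h := torusFunctional_mem_distOrderLT (zbinom_mul_sub_mem (k := k) b b')
    rw [← torusAlgHom_apply, map_sub, map_mul, map_smul] at h
    simp only [torusAlgHom_apply, ← binomH_eq] at h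
    have e : a + b + c + (a' + b' + c') = a + a' + (b + b') + (c + c') := by ring
    rw [e]
    exact mul_mem_distOrderLT (mul_mem_distOrderLT'
      (mul_mem_distOrder (divF_mem k a) (divF_mem k a')) h)
      (mul_mem_distOrder (divE_mem k c) (divE_mem k c'))
  convert Submodule.add_mem _ (Submodule.add_mem _ h1 h2) h3 using 1
  have h4 : ((a + a').choose a * (b + b').choose b * (c + c').choose c : k) •
      pbw (a + a', b + b', c + c') = (divF k a * divF k a') *
        (((b + b').choose b : k) • binomH k (b + b')) * (divE k c * divE k c') := by
    rw [divF_mul_divF, divE_mul_divE, pbw]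
    simp only [smul_mul_assoc, mul_smul_comm, smul_smul, mul_assoc]
    congr 1
    ring
  rw [h4, pbw, pbw]
  simp only [mul_sub, sub_mul, mul_assoc]
  abel

/-- When its leading coefficient is invertible, a product of monomials gives the top monomial modulo
lower order, and the lower order is already in `S`. -/
theorem distOrder_succ_le {k : Type*} [Field k] {r s t : ℕ}
    {S : Submodule k (Functional k (CoordRing k))} (hS : distOrder k (CoordRing k) t ≤ S)
    (hmul : distOrder k (CoordRing k) r * distOrder k (CoordRing k) s ≤ S) {a b c a' b' c' : ℕ}
    (hr : a + b + c = r) (hs : a' + b' + c' = s) (ht : r + s = t + 1)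
    (hne : ((a + a').choose a * (b + b').choose b * (c + c').choose c : k) ≠ 0) :
    pbw (a + a', b + b', c + c') ∈ S := by
  have h := hS (distOrderLT_succ (k := k) (A := CoordRing k) t ▸ ht ▸ hr ▸ hs ▸
    pbw_mul_pbw_sub_mem (k := k) a b c a' b' c')
  have h' : pbw (a, b, c) * pbw (a', b', c') ∈ S :=
    hmul (Submodule.mul_mem_mul (hr ▸ pbw_mem (k := k) (a, b, c))
      (hs ▸ pbw_mem (k := k) (a', b', c')))
  exact (Submodule.smul_mem_iff _ hne).1 ((Submodule.sub_mem_iff_right _ h').1 h)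

/-- Induction on the order: a monomial of top degree is split by `exists_split` so that one factor
has degree exactly p^M and the leading coefficient is nonzero modulo `p`. -/
theorem distOrder_le_mul (M : ℕ) {t : ℕ} (h : p ^ M ≤ t) (h' : t < 2 * p ^ M) :
    distOrder (ZMod p) (CoordRing (ZMod p)) t ≤
      distOrder (ZMod p) (CoordRing (ZMod p)) (t - p ^ M) *
        distOrder (ZMod p) (CoordRing (ZMod p)) (p ^ M) ⊓
      distOrder (ZMod p) (CoordRing (ZMod p)) (p ^ M) *
        distOrder (ZMod p) (CoordRing (ZMod p)) (t - p ^ M) := by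
  induction t, h using Nat.le_induction with
  | base =>
    rw [Nat.sub_self]
    refine le_inf (fun μ hμ => ?_) (fun μ hμ => ?_)
    · rw [← one_mul μ]
      exact Submodule.mul_mem_mul (one_mem_distOrder 0) hμ
    · rw [← mul_one μ]
      exact Submodule.mul_mem_mul hμ (one_mem_distOrder 0)
  | succ t h ih =>
    have ih' := (ih (by lia)).trans (inf_le_inf
      (mul_le_mul' (distOrder_mono (Nat.sub_le_sub_right t.le_succ _)) le_rfl)
      (mul_le_mul' le_rfl (distOrder_mono (Nat.sub_le_sub_right t.le_succ _))))
    rw [distOrder_eq_span (t + 1), Submodule.span_le]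
    rintro _ ⟨⟨a, b, c⟩, habc, rfl⟩
    change a + b + c ≤ t + 1 at habc
    rcases Nat.lt_or_eq_of_le habc with hlt | heq
    · have hmem : pbw (a, b, c) ∈ distOrder (ZMod p) (CoordRing (ZMod p)) (a + b + c) :=
        pbw_mem (a, b, c)
      exact ih' (distOrder_mono (Nat.le_of_lt_succ hlt) hmem)
    · obtain ⟨a', ha, b', hb, c', hc, hsum, h1, h2, h3⟩ :=
        exists_split (p := p) M a b c (by lia) (by lia)
      obtain ⟨a, rfl⟩ := Nat.exists_eq_add_of_le ha
      obtain ⟨b, rfl⟩ := Nat.exists_eq_add_of_le hb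
      obtain ⟨c, rfl⟩ := Nat.exists_eq_add_of_le hc
      have hne : ((a' + a).choose a' * (b' + b).choose b' * (c' + c).choose c' : ZMod p) ≠ 0 :=
        mul_ne_zero (mul_ne_zero (mt (ZMod.natCast_eq_zero_iff _ p).1 h1)
          (mt (ZMod.natCast_eq_zero_iff _ p).1 h2)) (mt (ZMod.natCast_eq_zero_iff _ p).1 h3)
      refine ⟨?_, distOrder_succ_le (ih'.trans inf_le_right) le_rfl hsum (by lia) (by lia) hne⟩
      have hne' : ((a + a').choose a * (b + b').choose b * (c + c').choose c : ZMod p) ≠ 0 := by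
        rwa [Nat.choose_symm_add, Nat.choose_symm_add, Nat.choose_symm_add, add_comm a,
          add_comm b, add_comm c]
      rw [add_comm a', add_comm b', add_comm c']
      exact distOrder_succ_le (ih'.trans inf_le_left) le_rfl (by lia) hsum (by lia) hne'

end OrderSplit

/-! ### Linear maps that respect products and commutators of bounded order. -/

section PartialMultiplicativity

variable {p : ℕ} [Fact p.Prime] {B : Type*} [Ring B] [Algebra (ZMod p) B]

/-- A linear map that respects the products of orders `(N - 1, N)` and `(N, N - 1)` respects all
products of total order less than `2 N`, when `N` is a power of `p`. -/
theorem map_mul_of_add_lt {M : ℕ} {g : Functional (ZMod p) (CoordRing (ZMod p)) →ₗ[ZMod p] B}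
    (h1 : ∀ μ ∈ distOrder (ZMod p) (CoordRing (ZMod p)) (p ^ M - 1), ∀ ν ∈ distOrder (ZMod p)
        (CoordRing (ZMod p)) (p ^ M), g μ * g ν = g (μ * ν))
    (h2 : ∀ μ ∈ distOrder (ZMod p) (CoordRing (ZMod p)) (p ^ M), ∀ ν ∈ distOrder (ZMod p)
        (CoordRing (ZMod p)) (p ^ M - 1), g μ * g ν = g (μ * ν))
    {s t : ℕ} (hst : s + t < 2 * p ^ M) {μ ν : Functional (ZMod p) (CoordRing (ZMod p))}
        (hμ : μ ∈ distOrder (ZMod p) (CoordRing (ZMod p)) s)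
        (hν : ν ∈ distOrder (ZMod p) (CoordRing (ZMod p)) t) :
    g μ * g ν = g (μ * ν) := by
  rcases lt_or_ge s (p ^ M) with hs | hs
  · rcases le_or_gt t (p ^ M) with ht | ht
    · exact h1 _ (distOrder_mono (Nat.le_sub_one_of_lt hs) hμ) _ (distOrder_mono ht hν)
    -- Here ν is a sum of products yz with z of order p^M. The order of μy is at most s + t - p^M <
    -- p^M, so g(μ)g(y)g(z) can be contracted from the left by admissible products.
    · have hν' := (distOrder_le_mul M ht.le (by lia)).trans inf_le_left hν
      clear hν
      induction hν' using Submodule.mul_induction_on' with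
      | mem_mul_mem y hy z hz =>
        have hμ' : μ ∈ distOrder (ZMod p) (CoordRing (ZMod p)) (p ^ M - 1) := distOrder_mono
            (by lia) hμ
        have hy' : y ∈ distOrder (ZMod p) (CoordRing (ZMod p)) (p ^ M) := distOrder_mono (by lia) hy
        have hy'' : y ∈ distOrder (ZMod p) (CoordRing (ZMod p)) (p ^ M - 1) := distOrder_mono
            (by lia) hy
        have hμy : μ * y ∈ distOrder (ZMod p) (CoordRing (ZMod p)) (p ^ M - 1) := distOrder_mono
            (by lia) (mul_mem_distOrder hμ hy)
        rw [← h1 y hy'' z hz, ← mul_assoc, h1 μ hμ' y hy', h1 _ hμy z hz, mul_assoc]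
      | add x _ y _ hx hy => rw [map_add, mul_add, mul_add, map_add, hx, hy]
  · have hν' : ν ∈ distOrder (ZMod p) (CoordRing (ZMod p)) (p ^ M - 1) := distOrder_mono (by lia) hν
    have hμ' := (distOrder_le_mul M hs (by lia)).trans inf_le_right hμ
    clear hμ
    induction hμ' using Submodule.mul_induction_on' with
    | mem_mul_mem y hy z hz =>
      have hz' : z ∈ distOrder (ZMod p) (CoordRing (ZMod p)) (p ^ M) := distOrder_mono (by lia) hz
      have hz'' : z ∈ distOrder (ZMod p) (CoordRing (ZMod p)) (p ^ M - 1) := distOrder_mono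
          (by lia) hz
      have hzν : z * ν ∈ distOrder (ZMod p) (CoordRing (ZMod p)) (p ^ M - 1) := distOrder_mono
          (by lia) (mul_mem_distOrder hz hν)
      rw [← h2 y hy z hz'', mul_assoc, h2 z hz' ν hν', h2 y hy _ hzν, mul_assoc]
    | add x _ y _ hx hy => rw [map_add, add_mul, add_mul, map_add, hx, hy]

/-- The product yzν may have order 2p^M, out of reach of multiplicativity. The Leibniz rule avoids
it: a commutator with ν gains one order, so y[z, ν] and [y, ν]z stay below 2p^M. -/
theorem map_commutator_mul {M : ℕ} {g : Functional (ZMod p) (CoordRing (ZMod p)) →ₗ[ZMod p] B}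
    (h1 : ∀ μ ∈ distOrder (ZMod p) (CoordRing (ZMod p)) (p ^ M - 1), ∀ ν ∈ distOrder (ZMod p)
        (CoordRing (ZMod p)) (p ^ M), g μ * g ν = g (μ * ν))
    (h2 : ∀ μ ∈ distOrder (ZMod p) (CoordRing (ZMod p)) (p ^ M), ∀ ν ∈ distOrder (ZMod p)
        (CoordRing (ZMod p)) (p ^ M - 1), g μ * g ν = g (μ * ν))
    {s t : ℕ} (hst : s + t ≤ p ^ M) (hs : s < p ^ M) (ht : t < p ^ M)
        {y z ν : Functional (ZMod p) (CoordRing (ZMod p))}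
    (hy : y ∈ distOrder (ZMod p) (CoordRing (ZMod p)) s)
        (hz : z ∈ distOrder (ZMod p) (CoordRing (ZMod p)) t)
        (hν : ν ∈ distOrder (ZMod p) (CoordRing (ZMod p)) (p ^ M)) :
    g (y * z) * g ν - g ν * g (y * z) = g (y * z * ν - ν * (y * z)) := by
  have hmul {s t : ℕ} (hst : s + t < 2 * p ^ M) {μ ν : Functional (ZMod p) (CoordRing (ZMod p))}
      (hμ : μ ∈ distOrder (ZMod p) (CoordRing (ZMod p)) s)
      (hν : ν ∈ distOrder (ZMod p) (CoordRing (ZMod p)) t) :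
      g μ * g ν = g (μ * ν) := map_mul_of_add_lt h1 h2 hst hμ hν
  have hyν := commutator_mem_distOrder hy hν
  have hzν := commutator_mem_distOrder hz hν
  calc g (y * z) * g ν - g ν * g (y * z)
      = g y * (g z * g ν - g ν * g z) + (g y * g ν - g ν * g y) * g z := by
        rw [← hmul (by lia) hy hz]
        noncomm_ring
    _ = g y * g (z * ν - ν * z) + g (y * ν - ν * y) * g z := by
        rw [hmul (by lia) hz hν, hmul (by lia) hν hz, hmul (by lia) hy hν, hmul (by lia) hν hy,
          ← map_sub, ← map_sub]
    _ = g (y * (z * ν - ν * z) + (y * ν - ν * y) * z) := by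
        rw [hmul (by lia) hy hzν, hmul (by lia) hyν hz, map_add]
    _ = _ := by
        congr 1
        simp only [mul_sub, sub_mul, mul_assoc]
        abel

theorem binomH_zero {k : Type*} [Field k] : binomH k 0 = 1 := by
  rw [binomH_eq, ← torusFunctional_one]
  congr 1
  exact funext fun h => zbinom_zero_left _ h

/-- An ordered monomial of degree at most p^M either is a pure power F^[p^M], binom(H, p^M) or
E^[p^M], or factors into two parts of order less than p^M, to which the Leibniz rule applies. -/
theorem map_commutator_of_generators {M : ℕ} {g : Functional (ZMod p) (CoordRing (ZMod p))
    →ₗ[ZMod p] B}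
    (h1 : ∀ μ ∈ distOrder (ZMod p) (CoordRing (ZMod p)) (p ^ M - 1), ∀ ν ∈ distOrder (ZMod p)
        (CoordRing (ZMod p)) (p ^ M), g μ * g ν = g (μ * ν))
    (h2 : ∀ μ ∈ distOrder (ZMod p) (CoordRing (ZMod p)) (p ^ M), ∀ ν ∈ distOrder (ZMod p)
        (CoordRing (ZMod p)) (p ^ M - 1), g μ * g ν = g (μ * ν))
    {ν : Functional (ZMod p) (CoordRing (ZMod p))}
        (hν : ν ∈ distOrder (ZMod p) (CoordRing (ZMod p)) (p ^ M))
    (hF : g (divF (ZMod p) (p ^ M)) * g ν - g ν * g (divF (ZMod p) (p ^ M)) =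
      g (divF (ZMod p) (p ^ M) * ν - ν * divF (ZMod p) (p ^ M)))
    (hH : g (binomH (ZMod p) (p ^ M)) * g ν - g ν * g (binomH (ZMod p) (p ^ M)) =
      g (binomH (ZMod p) (p ^ M) * ν - ν * binomH (ZMod p) (p ^ M)))
    (hE : g (divE (ZMod p) (p ^ M)) * g ν - g ν * g (divE (ZMod p) (p ^ M)) =
      g (divE (ZMod p) (p ^ M) * ν - ν * divE (ZMod p) (p ^ M)))
    {μ : Functional (ZMod p) (CoordRing (ZMod p))}
        (hμ : μ ∈ distOrder (ZMod p) (CoordRing (ZMod p)) (p ^ M)) :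
    g μ * g ν - g ν * g μ = g (μ * ν - ν * μ) := by
  rw [distOrder_eq_span] at hμ
  induction hμ using Submodule.span_induction with
  | mem μ hμ =>
    obtain ⟨⟨a, b, c⟩, habc, rfl⟩ := hμ
    change a + b + c ≤ p ^ M at habc
    have hbc : binomH (ZMod p) b * divE (ZMod p) c ∈ distOrder (ZMod p) (CoordRing (ZMod p))
        (b + c) :=
      mul_mem_distOrder (binomH_mem (ZMod p) b) (divE_mem (ZMod p) c)
    rw [pbw, mul_assoc]
    rcases (show a ≤ p ^ M by lia).lt_or_eq with ha | rfl
    · rcases (show b + c ≤ p ^ M by lia).lt_or_eq with hbc' | hbc'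
      · exact map_commutator_mul h1 h2 (by lia) ha hbc' (divF_mem (ZMod p) a) hbc hν
      · obtain rfl : a = 0 := by lia
        rw [divF_zero, one_mul]
        rcases (show b ≤ p ^ M by lia).lt_or_eq with hb | rfl
        · rcases (show c ≤ p ^ M by lia).lt_or_eq with hc | rfl
          · exact map_commutator_mul h1 h2 (by lia) hb hc (binomH_mem (ZMod p) b)
              (divE_mem (ZMod p) c) hν
          · obtain rfl : b = 0 := by lia
            rwa [binomH_zero, one_mul]
        · obtain rfl : c = 0 := by lia
          rwa [divE_zero, mul_one]
    · obtain rfl : b = 0 := by lia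
      obtain rfl : c = 0 := by lia
      rwa [binomH_zero, divE_zero, mul_one, mul_one]
  | zero => simp
  | add x y _ _ hx hy =>
    simp only [map_add, map_sub, mul_add, add_mul] at hx hy ⊢
    rw [add_sub_add_comm, add_sub_add_comm, hx, hy]
  | smul c x _ hx =>
    simp only [map_smul, map_sub, mul_smul_comm, smul_mul_assoc] at hx ⊢
    rw [← smul_sub, ← smul_sub, hx]

end PartialMultiplicativity

/-! ### Multiplicativity in the enveloping algebra of level `m`. -/

section LevelOf

variable {p : ℕ} [Fact p.Prime]

theorem exists_levelOf (p : ℕ) [Fact p.Prime] (m : ℕ) : ∃ f : Functional (ZMod p)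
    (CoordRing (ZMod p)) →ₗ[ZMod p] U p m,
    f ∘ₗ (distOrder (ZMod p) (CoordRing (ZMod p)) (2 * p ^ m - 1)).subtype = LevelAlg.of p m :=
  LinearMap.exists_extend _

variable (p) in
/-- A linear extension to all functionals of the canonical map to the enveloping algebra of
level `m`. -/
def levelOf (m : ℕ) : Functional (ZMod p) (CoordRing (ZMod p)) →ₗ[ZMod p] U p m :=
    (exists_levelOf p m).choose

theorem levelOf_coe {m : ℕ} (μ : distOrder (ZMod p) (CoordRing (ZMod p)) (2 * p ^ m - 1)) :
    levelOf p m (μ : Functional (ZMod p) (CoordRing (ZMod p))) = LevelAlg.of p m μ :=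
  LinearMap.congr_fun (exists_levelOf p m).choose_spec μ

theorem levelOf_one (m : ℕ) : levelOf p m 1 = 1 :=
  (levelOf_coe ⟨1, one_mem_distOrder _⟩).trans (LevelAlg.of_one p m)

theorem levelOf_commutator {m : ℕ} {μ ν : Functional (ZMod p) (CoordRing (ZMod p))}
    (hμ : μ ∈ distOrder (ZMod p) (CoordRing (ZMod p)) (p ^ m))
    (hν : ν ∈ distOrder (ZMod p) (CoordRing (ZMod p)) (p ^ m)) :
    levelOf p m μ * levelOf p m ν - levelOf p m ν * levelOf p m μ =
      levelOf p m (μ * ν - ν * μ) := by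
  have hp : 0 < p ^ m := Nat.pow_pos (Fact.out : p.Prime).pos
  have h := LevelAlg.of_comm (p := p) (m := m) ⟨μ, distOrder_mono (by lia) hμ⟩
    ⟨ν, distOrder_mono (by lia) hν⟩
    ⟨μ * ν - ν * μ, distOrder_mono (by lia) (commutator_mem_distOrder hμ hν)⟩ hμ hν rfl
  simpa only [← levelOf_coe] using h

/-- The product relation is imposed only for orders p^m - 1 and p^m in this sequence; the commutator
relation supplies the opposite sequence, and factorization of high orders does the rest. -/
theorem levelOf_mul {m s t : ℕ} (hst : s + t < 2 * p ^ m)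
    {μ ν : Functional (ZMod p) (CoordRing (ZMod p))}
    (hμ : μ ∈ distOrder (ZMod p) (CoordRing (ZMod p)) s)
    (hν : ν ∈ distOrder (ZMod p) (CoordRing (ZMod p)) t) : levelOf p m μ * levelOf p m ν
        = levelOf p m (μ * ν) := by
  have hp : 0 < p ^ m := Nat.pow_pos (Fact.out : p.Prime).pos
  have h1 : ∀ μ ∈ distOrder (ZMod p) (CoordRing (ZMod p)) (p ^ m - 1), ∀ ν ∈ distOrder (ZMod p)
      (CoordRing (ZMod p)) (p ^ m),
      levelOf p m μ * levelOf p m ν = levelOf p m (μ * ν) := by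
    intro μ hμ ν hν
    have h := LevelAlg.of_mul (p := p) (m := m) ⟨μ, distOrder_mono (by lia) hμ⟩
      ⟨ν, distOrder_mono (by lia) hν⟩
      ⟨μ * ν, distOrder_mono (by lia) (mul_mem_distOrder hμ hν)⟩ hμ hν rfl
    simpa only [← levelOf_coe] using h
  refine map_mul_of_add_lt h1 (fun μ hμ ν hν => ?_) hst hμ hν
  have h := levelOf_commutator hμ (distOrder_mono (Nat.sub_le _ _) hν)
  rw [h1 ν hν μ hμ, map_sub] at h
  exact sub_left_injective h

end LevelOf

/-! ### The splitting at level `m` respects the defining relations. -/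

section LevelSplitting

variable {p : ℕ} [Fact p.Prime]

/-- In Vandermonde's expansion only the terms whose index in the pm factor is a multiple of `p`
survive, and index 0 cancels. The degree drops by `p`, leaving room for the norm, of order p - 1. -/
theorem shift_zbinom_sub_mem (n : ℕ) (m : ℤ) :
    (fun h => zbinom (ZMod p) (p * n) (h + p * m)) - zbinom (ZMod p) (p * n) ∈
      binomSpan (ZMod p) (p * n - p + 1) := by
  have h0 : (0, p * n) ∈ Finset.HasAntidiagonal.antidiagonal (p * n) := by simp
  have e : (fun h => zbinom (ZMod p) (p * n) (h + p * m)) - zbinom (ZMod p) (p * n) =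
      ∑ ij ∈ (Finset.HasAntidiagonal.antidiagonal (p * n)).erase (0, p * n),
        zbinom (ZMod p) ij.1 (p * m) • zbinom (ZMod p) ij.2 := by
    funext h
    rw [Pi.sub_apply, add_comm h, zbinom_add, ← Finset.add_sum_erase _ _ h0, zbinom_zero_left,
      one_mul, add_sub_cancel_left, Finset.sum_apply]
    rfl
  rw [e]
  refine Submodule.sum_mem _ fun ij hij => ?_
  obtain ⟨hne, hij⟩ := Finset.mem_erase.1 hij
  rw [Finset.HasAntidiagonal.mem_antidiagonal] at hij
  rw [zbinom_prime_mul]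
  split_ifs with hd
  · refine Submodule.smul_mem _ _ (zbinom_mem ?_)
    have h1 : ij.1 ≠ 0 := fun h => hne (Prod.ext h (by lia))
    have := Nat.le_of_dvd (Nat.pos_of_ne_zero h1) hd
    lia
  · rw [zero_smul]
    exact Submodule.zero_mem _

theorem divE_mul_torusNorm (c : ℕ) : divE (ZMod p) c * torusNorm p =
    torusFunctional (fun h => primeIndicator p (h - 2 * c)) * divE (ZMod p) c :=
  divE_mul_torusFunctional _ _

theorem primeIndicator_shift_mem (m : ℤ) :
    torusFunctional (fun h => primeIndicator p (h + m)) ∈ distOrder (ZMod p)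
        (CoordRing (ZMod p)) (p - 1) := by
  refine torusFunctional_mem_distOrder ?_
  rw [Nat.sub_add_cancel (Fact.out : p.Prime).one_le]
  exact shift_mem_binomSpan m primeIndicator_mem

/-- The torus parts that occur in the commutator of `E` and `F`. -/
def crossBinom (p a c K : ℕ) [Fact p.Prime] : ℤ → ZMod p :=
  fun h => zbinom (ZMod p) K (h - a - c + 2 * K)

theorem torusFunctional_crossBinom_mem (a c K : ℕ) :
    torusFunctional (crossBinom p a c K) ∈ distOrder (ZMod p) (CoordRing (ZMod p)) K := by
  refine torusFunctional_mem_distOrder ?_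
  convert shift_mem_binomSpan (-a - c + 2 * K : ℤ)
    (zbinom_mem (k := ZMod p) (Nat.lt_succ_self K)) using 3
  unfold crossBinom
  congr 1
  ring

theorem crossBinom_mul_primeIndicator {a c K : ℕ} (hK : ¬ p ∣ K) (hKa : K ≤ p * a) :
    crossBinom p (p * a) (p * c) K * (fun h => primeIndicator p (h - 2 * (p * a - K : ℕ))) = 0 := by
  funext h
  simp only [Pi.mul_apply, Pi.zero_apply, crossBinom, primeIndicator]
  split_ifs with hd
  · have h2 : (p : ℤ) ∣ h - (p * a : ℕ) - (p * c : ℕ) + 2 * K := by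
      obtain ⟨e, he⟩ := hd
      rw [Nat.cast_sub hKa] at he
      refine ⟨e + a - c, ?_⟩
      push_cast at he ⊢
      linear_combination he
    obtain ⟨e, he⟩ := h2
    rw [he, zbinom_prime_mul, if_neg hK, zero_mul]
  · rw [mul_zero]

/-- With q = p · p^m the left factor has order at most 2q - K. For K ≥ p the norm still fits below
2q. For 0 < K < p it does not, but then both sides vanish. -/
theorem levelOf_cross_mul_torusNorm (m : ℕ) {K : ℕ} (hK0 : 0 < K) (hK : K ≤ p * p ^ m) :
    levelOf p (m + 1) (divF (ZMod p) (p * p ^ m - K) *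
        torusFunctional (crossBinom p (p * p ^ m) (p * p ^ m) K) *
        divE (ZMod p) (p * p ^ m - K)) * levelOf p (m + 1) (torusNorm p) =
      levelOf p (m + 1) (divF (ZMod p) (p * p ^ m - K) *
        torusFunctional (crossBinom p (p * p ^ m) (p * p ^ m) K) *
        divE (ZMod p) (p * p ^ m - K) * torusNorm p) := by
  have hp : 1 < p := (Fact.out : p.Prime).one_lt
  have hN : p ≤ p * p ^ m := Nat.le_mul_of_pos_right p (Nat.pow_pos hp.le)
  have hq : p ^ (m + 1) = p * p ^ m := pow_succ' p m
  set q := p * p ^ m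
  have hF : divF (ZMod p) (q - K) * torusFunctional (crossBinom p q q K) ∈ distOrder (ZMod p)
      (CoordRing (ZMod p)) q :=
    distOrder_mono (by lia) (mul_mem_distOrder (divF_mem (ZMod p) (q - K))
      (torusFunctional_crossBinom_mem q q K))
  have hE := divE_mem (ZMod p) (q - K)
  rcases lt_or_ge K p with hlt | hge
  · have hd : ¬ p ∣ K := Nat.not_dvd_of_pos_of_lt hK0 hlt
    have hI := primeIndicator_shift_mem (p := p) (-(2 * (q - K : ℕ)))
    simp only [← sub_eq_add_neg] at hI
    have h0 : divF (ZMod p) (q - K) * torusFunctional (crossBinom p q q K) *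
        torusFunctional (fun h => primeIndicator p (h - 2 * (q - K : ℕ))) = 0 := by
      rw [mul_assoc, torusFunctional_mul, crossBinom_mul_primeIndicator hd hK, ← torusAlgHom_apply,
        map_zero, mul_zero]
    -- The norm is moved left past the E factor inside admissible products and becomes a shifted
    -- indicator, which annihilates the torus part.
    rw [mul_assoc _ _ (torusNorm p), ← levelOf_mul (by lia) hF hE, mul_assoc,
      levelOf_mul (by lia) hE torusNorm_mem, divE_mul_torusNorm,
      ← levelOf_mul (by lia) hI hE, ← mul_assoc, ← mul_assoc, levelOf_mul (by lia) hF hI, h0,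
      map_zero, zero_mul, zero_mul, map_zero]
  · refine levelOf_mul (s := q + (q - K)) ?_ (mul_mem_distOrder hF hE) torusNorm_mem
    lia

/-- The term K = 0 of the commutation formula is F E itself and cancels in the commutator; the
remaining terms are treated separately. -/
theorem levelOf_commutator_divE_divF_mul_torusNorm (m : ℕ) :
    levelOf p (m + 1) (divE (ZMod p) (p * p ^ m) * divF (ZMod p) (p * p ^ m) -
        divF (ZMod p) (p * p ^ m) * divE (ZMod p) (p * p ^ m)) * levelOf p (m + 1) (torusNorm p) =
      levelOf p (m + 1) ((divE (ZMod p) (p * p ^ m) * divF (ZMod p) (p * p ^ m) -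
        divF (ZMod p) (p * p ^ m) * divE (ZMod p) (p * p ^ m)) * torusNorm p) := by
  have h0 : torusFunctional (fun h => zbinom (ZMod p) 0
      (h - (p * p ^ m : ℕ) - (p * p ^ m : ℕ) + 2 * (0 : ℕ))) = 1 := by
    simp only [zbinom_zero_left]
    exact torusFunctional_one
  rw [divE_mul_divF, min_self, Finset.sum_range_succ', h0, Nat.sub_zero, mul_one,
    add_sub_cancel_right, Finset.sum_mul, map_sum, map_sum, Finset.sum_mul]
  exact Finset.sum_congr rfl fun K hK =>
    levelOf_cross_mul_torusNorm m K.succ_pos (Finset.mem_range.1 hK)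

theorem levelOf_mul_torusNorm_of_mem {m : ℕ} {n : ℕ} (hn : n + p ≤ 2 * (p * p ^ m))
    {μ : Functional (ZMod p) (CoordRing (ZMod p))}
    (hμ : μ ∈ distOrder (ZMod p) (CoordRing (ZMod p)) n) : levelOf p (m + 1) μ * levelOf p
        (m + 1) (torusNorm p) =
      levelOf p (m + 1) (μ * torusNorm p) := by
  have hp : 0 < p := (Fact.out : p.Prime).pos
  refine levelOf_mul ?_ hμ torusNorm_mem
  rw [pow_succ']
  lia

theorem commutator_binomH_divE_mem (n : ℕ) :
    binomH (ZMod p) (p * n) * divE (ZMod p) (p * n) - divE (ZMod p) (p * n) *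
      binomH (ZMod p) (p * n) ∈ distOrder (ZMod p) (CoordRing (ZMod p)) (p * n + (p * n - p)) := by
  have h := shift_zbinom_sub_mem (p := p) n (2 * n)
  have e : binomH (ZMod p) (p * n) * divE (ZMod p) (p * n) - divE (ZMod p) (p * n) *
      binomH (ZMod p) (p * n) = divE (ZMod p) (p * n) * torusFunctional
        ((fun h => zbinom (ZMod p) (p * n) (h + p * (2 * n))) - zbinom (ZMod p) (p * n)) := by
    rw [← torusAlgHom_apply, map_sub, torusAlgHom_apply, torusAlgHom_apply, mul_sub, binomH_eq,
      torusFunctional_mul_divE, Nat.cast_mul, mul_left_comm]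
  rw [e]
  exact mul_mem_distOrder (divE_mem (ZMod p) _) (torusFunctional_mem_distOrder h)

theorem commutator_binomH_divF_mem (n : ℕ) :
    binomH (ZMod p) (p * n) * divF (ZMod p) (p * n) - divF (ZMod p) (p * n) *
      binomH (ZMod p) (p * n) ∈ distOrder (ZMod p) (CoordRing (ZMod p)) (p * n + (p * n - p)) := by
  have h := shift_zbinom_sub_mem (p := p) n (-(2 * n))
  have e : binomH (ZMod p) (p * n) * divF (ZMod p) (p * n) - divF (ZMod p) (p * n) *
      binomH (ZMod p) (p * n) = divF (ZMod p) (p * n) * torusFunctional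
        ((fun h => zbinom (ZMod p) (p * n) (h + p * -(2 * n))) - zbinom (ZMod p) (p * n)) := by
    rw [← torusAlgHom_apply, map_sub, torusAlgHom_apply, torusAlgHom_apply, mul_sub, binomH_eq,
      torusFunctional_mul_divF, Nat.cast_mul, mul_left_comm]
    simp only [mul_neg, ← sub_eq_add_neg]
  rw [e]
  exact mul_mem_distOrder (divF_mem (ZMod p) _) (torusFunctional_mem_distOrder h)

/-- The values of the splitting at level `m`, on functionals. -/
def levelSplit (p : ℕ) [Fact p.Prime] (m : ℕ) : Functional (ZMod p) (CoordRing (ZMod p))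
    →ₗ[ZMod p] U p (m + 1) :=
  levelOf p (m + 1) ∘ₗ frobSplit p

theorem levelSplit_apply (m : ℕ) (μ : Functional (ZMod p) (CoordRing (ZMod p))) :
    levelSplit p m μ = levelOf p (m + 1) (frobSplit p μ) := rfl

theorem levelOf_torusNorm_mul_self (m : ℕ) :
    levelOf p (m + 1) (torusNorm p) * levelOf p (m + 1) (torusNorm p) =
      levelOf p (m + 1) (torusNorm p) := by
  have hp : 0 < p := (Fact.out : p.Prime).pos
  have hN : p ≤ p * p ^ m := Nat.le_mul_of_pos_right p (Nat.pow_pos hp)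
  rw [levelOf_mul_torusNorm_of_mem (by lia) torusNorm_mem, torusNorm_mul_self]

theorem mul_two_mul_sub_one_add (m : ℕ) : p * (2 * p ^ m - 1) + p = 2 * (p * p ^ m) := by
  have hN : 0 < p ^ m := Nat.pow_pos (Fact.out : p.Prime).pos
  rw [← Nat.mul_add_one, Nat.sub_add_cancel (by lia), mul_left_comm]

theorem levelSplit_mul_torusNorm {m : ℕ} {μ : Functional (ZMod p) (CoordRing (ZMod p))}
    (hμ : μ ∈ distOrder (ZMod p) (CoordRing (ZMod p)) (2 * p ^ m - 1)) :
    levelSplit p m μ * levelOf p (m + 1) (torusNorm p) = levelSplit p m μ := by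
  obtain ⟨x, hx, h, -⟩ := exists_frobSplit_eq_mul hμ
  rw [levelSplit_apply, h, ← levelOf_mul_torusNorm_of_mem (mul_two_mul_sub_one_add m).le hx,
    mul_assoc, levelOf_torusNorm_mul_self]

theorem torusNorm_mul_levelSplit {m : ℕ} {μ : Functional (ZMod p) (CoordRing (ZMod p))}
    (hμ : μ ∈ distOrder (ZMod p) (CoordRing (ZMod p)) (2 * p ^ m - 1)) :
    levelOf p (m + 1) (torusNorm p) * levelSplit p m μ = levelSplit p m μ := by
  have hp : 0 < p := (Fact.out : p.Prime).pos
  have hs := mul_two_mul_sub_one_add (p := p) m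
  obtain ⟨x, hx, h, h'⟩ := exists_frobSplit_eq_mul hμ
  rw [levelSplit_apply, h, ← h', ← levelOf_mul (by rw [pow_succ']; lia) torusNorm_mem hx,
    ← mul_assoc, levelOf_torusNorm_mul_self]

theorem frobSplit_mul_torusNorm {n : ℕ} {μ : Functional (ZMod p) (CoordRing (ZMod p))}
    (hμ : μ ∈ distOrder (ZMod p) (CoordRing (ZMod p)) n) :
    frobSplit p μ * torusNorm p = frobSplit p μ := by
  obtain ⟨x, -, h, -⟩ := exists_frobSplit_eq_mul hμ
  rw [h, mul_assoc, torusNorm_mul_self]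

theorem torusNorm_mul_frobSplit {n : ℕ} {μ : Functional (ZMod p) (CoordRing (ZMod p))}
    (hμ : μ ∈ distOrder (ZMod p) (CoordRing (ZMod p)) n) :
    torusNorm p * frobSplit p μ = frobSplit p μ := by
  obtain ⟨x, -, h, h'⟩ := exists_frobSplit_eq_mul hμ
  rw [h, ← h', ← mul_assoc, torusNorm_mul_self]

/-- The norm of the second factor is absorbed by the first. What remains has orders at most p^(m+1)
- 1 and p^(m+1), an admissible product at level m + 1. -/
theorem levelSplit_mul_left (m : ℕ) : ∀ μ ∈ distOrder (ZMod p) (CoordRing (ZMod p)) (p ^ m - 1),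
    ∀ ν ∈ distOrder (ZMod p) (CoordRing (ZMod p)) (p ^ m),
    levelSplit p m μ * levelSplit p m ν = levelSplit p m (μ * ν) := by
  intro μ hμ ν hν
  have hp : 0 < p := (Fact.out : p.Prime).pos
  have hN : 0 < p ^ m := Nat.pow_pos hp
  have hs : p * (p ^ m - 1) + p = p * p ^ m := by
    rw [← Nat.mul_add_one, Nat.sub_add_cancel hN]
  obtain ⟨x, hx, h, h'⟩ := exists_frobSplit_eq_mul hν
  have h1 : levelSplit p m ν = levelOf p (m + 1) (torusNorm p) * levelOf p (m + 1) x := by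
    rw [levelSplit_apply, h, ← h', levelOf_mul (by rw [pow_succ']; lia) torusNorm_mem hx]
  have h2 : frobSplit p (μ * ν) = frobSplit p μ * x := by
    rw [frobSplit_mul ⟨_, hμ⟩ ⟨_, hν⟩, h, ← h', ← mul_assoc, frobSplit_mul_torusNorm hμ]
  rw [h1, ← mul_assoc, levelSplit_mul_torusNorm (distOrder_mono (by lia) hμ), levelSplit_apply,
    levelSplit_apply, h2]
  refine levelOf_mul ?_ (frobSplit_mem hμ) hx
  rw [pow_succ']
  lia

theorem levelSplit_mul_right (m : ℕ) : ∀ μ ∈ distOrder (ZMod p) (CoordRing (ZMod p)) (p ^ m),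
    ∀ ν ∈ distOrder (ZMod p) (CoordRing (ZMod p)) (p ^ m - 1),
    levelSplit p m μ * levelSplit p m ν = levelSplit p m (μ * ν) := by
  intro μ hμ ν hν
  have hp : 0 < p := (Fact.out : p.Prime).pos
  have hN : 0 < p ^ m := Nat.pow_pos hp
  have hs : p * (p ^ m - 1) + p = p * p ^ m := by
    rw [← Nat.mul_add_one, Nat.sub_add_cancel hN]
  obtain ⟨x, hx, h, -⟩ := exists_frobSplit_eq_mul hμ
  have h1 : levelSplit p m μ = levelOf p (m + 1) x * levelOf p (m + 1) (torusNorm p) := by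
    rw [levelSplit_apply, h, levelOf_mul_torusNorm_of_mem (by lia) hx]
  have h2 : frobSplit p (μ * ν) = x * frobSplit p ν := by
    rw [frobSplit_mul ⟨_, hμ⟩ ⟨_, hν⟩, h, mul_assoc, torusNorm_mul_frobSplit hν]
  rw [h1, mul_assoc, torusNorm_mul_levelSplit (distOrder_mono (by lia) hν), levelSplit_apply,
    levelSplit_apply, h2]
  refine levelOf_mul ?_ hx (frobSplit_mem hν)
  rw [pow_succ']
  lia

/-- Since the norm e is a commuting idempotent, the commutator of xe and ye is [x, y]e, both for
distributions and in the enveloping algebra. So only the compatibility `hxy` of [x, y] with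
multiplication by e remains. -/
theorem levelSplit_commutator_of_eq_mul {m : ℕ} {μ ν x y : Functional (ZMod p)
    (CoordRing (ZMod p))} (hμ : μ ∈ distOrder (ZMod p) (CoordRing (ZMod p)) (p ^ m))
    (hν : ν ∈ distOrder (ZMod p) (CoordRing (ZMod p)) (p ^ m))
        (hx : x ∈ distOrder (ZMod p) (CoordRing (ZMod p)) (p * p ^ m))
        (hy : y ∈ distOrder (ZMod p) (CoordRing (ZMod p)) (p * p ^ m))
    (hμx : frobSplit p μ = x * torusNorm p) (hνy : frobSplit p ν = y * torusNorm p)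
    (hx' : torusNorm p * x = x * torusNorm p) (hy' : torusNorm p * y = y * torusNorm p)
    (hxy : levelOf p (m + 1) (x * y - y * x) * levelOf p (m + 1) (torusNorm p) =
      levelOf p (m + 1) ((x * y - y * x) * torusNorm p)) :
    levelSplit p m μ * levelSplit p m ν - levelSplit p m ν * levelSplit p m μ =
      levelSplit p m (μ * ν - ν * μ) := by
  have hp : 0 < p := (Fact.out : p.Prime).pos
  have hN : p ≤ p * p ^ m := Nat.le_mul_of_pos_right p (Nat.pow_pos hp)
  have hcomm {x : Functional (ZMod p) (CoordRing (ZMod p))}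
      (hx : x ∈ distOrder (ZMod p) (CoordRing (ZMod p)) (p * p ^ m))
      (hx' : torusNorm p * x = x * torusNorm p) :
      levelOf p (m + 1) (torusNorm p) * levelOf p (m + 1) x =
        levelOf p (m + 1) x * levelOf p (m + 1) (torusNorm p) := by
    rw [levelOf_mul_torusNorm_of_mem (by lia) hx,
      levelOf_mul (by rw [pow_succ']; lia) torusNorm_mem hx, hx']
  have hkey {R : Type} [Ring R] {a b e : R} (hb : e * b = b * e) (he : e * e = e) :
      a * e * (b * e) = a * b * e := by
    rw [mul_assoc, ← mul_assoc e, hb, mul_assoc b, he, mul_assoc]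
  rw [levelSplit_apply, levelSplit_apply, levelSplit_apply, map_sub,
    frobSplit_mul ⟨_, hμ⟩ ⟨_, hν⟩, frobSplit_mul ⟨_, hν⟩ ⟨_, hμ⟩, hμx, hνy,
    hkey hy' torusNorm_mul_self, hkey hx' torusNorm_mul_self, ← sub_mul, ← hxy,
    ← levelOf_mul_torusNorm_of_mem (by lia) hx, ← levelOf_mul_torusNorm_of_mem (by lia) hy,
    hkey (hcomm hy hy') (levelOf_torusNorm_mul_self m),
    hkey (hcomm hx hx') (levelOf_torusNorm_mul_self m), ← sub_mul,
    levelOf_commutator (by rwa [pow_succ']) (by rwa [pow_succ'])]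

theorem torusNorm_mul_binomH (b : ℕ) :
    torusNorm p * binomH (ZMod p) b = binomH (ZMod p) b * torusNorm p := by
  rw [binomH_eq, torusNorm_mul_torusFunctional]

theorem levelSplit_commutator_divE_divF (m : ℕ) :
    levelSplit p m (divE (ZMod p) (p ^ m)) * levelSplit p m (divF (ZMod p) (p ^ m)) -
      levelSplit p m (divF (ZMod p) (p ^ m)) * levelSplit p m (divE (ZMod p) (p ^ m)) =
      levelSplit p m (divE (ZMod p) (p ^ m) * divF (ZMod p) (p ^ m) -
        divF (ZMod p) (p ^ m) * divE (ZMod p) (p ^ m)) := by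
  have hE := frobSplit_divE_eq (p := p) (p ^ m)
  have hF := frobSplit_divF_eq (p := p) (p ^ m)
  rw [mul_comm _ p] at hE hF
  exact levelSplit_commutator_of_eq_mul (divE_mem (ZMod p) (p ^ m)) (divF_mem (ZMod p) (p ^ m))
    (divE_mem (ZMod p) (p * p ^ m)) (divF_mem (ZMod p) (p * p ^ m)) hE hF
    (torusNorm_mul_divE (p ^ m)) (torusNorm_mul_divF (p ^ m))
    (levelOf_commutator_divE_divF_mul_torusNorm m)

theorem levelSplit_commutator_binomH_divE (m : ℕ) :
    levelSplit p m (binomH (ZMod p) (p ^ m)) * levelSplit p m (divE (ZMod p) (p ^ m)) -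
      levelSplit p m (divE (ZMod p) (p ^ m)) * levelSplit p m (binomH (ZMod p) (p ^ m)) =
      levelSplit p m (binomH (ZMod p) (p ^ m) * divE (ZMod p) (p ^ m) -
        divE (ZMod p) (p ^ m) * binomH (ZMod p) (p ^ m)) := by
  have hN : p ≤ p * p ^ m :=
    Nat.le_mul_of_pos_right p (Nat.pow_pos (Fact.out : p.Prime).pos)
  have hE := frobSplit_divE_eq (p := p) (p ^ m)
  have hH := frobSplit_binomH (p := p) (p ^ m)
  rw [mul_comm _ p] at hE hH
  exact levelSplit_commutator_of_eq_mul (binomH_mem (ZMod p) (p ^ m)) (divE_mem (ZMod p) (p ^ m))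
    (binomH_mem (ZMod p) (p * p ^ m)) (divE_mem (ZMod p) (p * p ^ m)) hH hE
    (torusNorm_mul_binomH (p * p ^ m)) (torusNorm_mul_divE (p ^ m))
    (levelOf_mul_torusNorm_of_mem (by lia) (commutator_binomH_divE_mem (p ^ m)))

theorem levelSplit_commutator_binomH_divF (m : ℕ) :
    levelSplit p m (binomH (ZMod p) (p ^ m)) * levelSplit p m (divF (ZMod p) (p ^ m)) -
      levelSplit p m (divF (ZMod p) (p ^ m)) * levelSplit p m (binomH (ZMod p) (p ^ m)) =
      levelSplit p m (binomH (ZMod p) (p ^ m) * divF (ZMod p) (p ^ m) -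
        divF (ZMod p) (p ^ m) * binomH (ZMod p) (p ^ m)) := by
  have hN : p ≤ p * p ^ m :=
    Nat.le_mul_of_pos_right p (Nat.pow_pos (Fact.out : p.Prime).pos)
  have hF := frobSplit_divF_eq (p := p) (p ^ m)
  have hH := frobSplit_binomH (p := p) (p ^ m)
  rw [mul_comm _ p] at hF hH
  exact levelSplit_commutator_of_eq_mul (binomH_mem (ZMod p) (p ^ m)) (divF_mem (ZMod p) (p ^ m))
    (binomH_mem (ZMod p) (p * p ^ m)) (divF_mem (ZMod p) (p * p ^ m)) hH hF
    (torusNorm_mul_binomH (p * p ^ m)) (torusNorm_mul_divF (p ^ m))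
    (levelOf_mul_torusNorm_of_mem (by lia) (commutator_binomH_divF_mem (p ^ m)))

theorem levelSplit_commutator_swap {m : ℕ} {μ ν : Functional (ZMod p) (CoordRing (ZMod p))}
    (h : levelSplit p m μ * levelSplit p m ν - levelSplit p m ν * levelSplit p m μ =
      levelSplit p m (μ * ν - ν * μ)) :
    levelSplit p m ν * levelSplit p m μ - levelSplit p m μ * levelSplit p m ν =
      levelSplit p m (ν * μ - μ * ν) := by
  rw [← neg_sub, h, ← map_neg, neg_sub]

theorem levelSplit_commutator_self (m : ℕ) (μ : Functional (ZMod p) (CoordRing (ZMod p))) :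
    levelSplit p m μ * levelSplit p m μ - levelSplit p m μ * levelSplit p m μ =
      levelSplit p m (μ * μ - μ * μ) := by
  rw [sub_self, sub_self, map_zero]

/-- The reduction to generators is applied twice: with a generator fixed on the right and the other
argument arbitrary, then, after exchanging the arguments, with both arbitrary. -/
theorem levelSplit_commutator {m : ℕ} {μ ν : Functional (ZMod p) (CoordRing (ZMod p))}
    (hμ : μ ∈ distOrder (ZMod p) (CoordRing (ZMod p)) (p ^ m))
    (hν : ν ∈ distOrder (ZMod p) (CoordRing (ZMod p)) (p ^ m)) :
    levelSplit p m μ * levelSplit p m ν - levelSplit p m ν * levelSplit p m μ =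
      levelSplit p m (μ * ν - ν * μ) := by
  have h1 := levelSplit_mul_left (p := p) m
  have h2 := levelSplit_mul_right (p := p) m
  have hEF := levelSplit_commutator_divE_divF (p := p) m
  have hHE := levelSplit_commutator_binomH_divE (p := p) m
  have hHF := levelSplit_commutator_binomH_divF (p := p) m
  have hF := map_commutator_of_generators h1 h2 (divF_mem (ZMod p) (p ^ m))
    (levelSplit_commutator_self m _) hHF hEF hν
  have hH := map_commutator_of_generators h1 h2 (binomH_mem (ZMod p) (p ^ m))
    (levelSplit_commutator_swap hHF) (levelSplit_commutator_self m _)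
    (levelSplit_commutator_swap hHE) hν
  have hE := map_commutator_of_generators h1 h2 (divE_mem (ZMod p) (p ^ m))
    (levelSplit_commutator_swap hEF) hHE (levelSplit_commutator_self m _) hν
  exact map_commutator_of_generators h1 h2 hν (levelSplit_commutator_swap hF)
    (levelSplit_commutator_swap hH) (levelSplit_commutator_swap hE) hμ

end LevelSplitting

/-! ### Evaluation and induction for the enveloping algebra. -/

section LevelInduction

variable {k A : Type*} [CommRing k] [CommRing A] [Bialgebra k A] {p m : ℕ}

theorem LevelAlg.lift_of {B : Type*} [Ring B] [Algebra k B]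
    (g : distOrder k A (2 * p ^ m - 1) →ₗ[k] B) (h1 hcomm hmul)
    (μ : distOrder k A (2 * p ^ m - 1)) :
    LevelAlg.lift g h1 hcomm hmul (LevelAlg.of p m μ) = g μ := by
  refine (RingQuot.liftAlgHom_mkAlgHom_apply k _ _ _).trans ?_
  exact TensorAlgebra.lift_ι_apply g μ

/-- Scalars are multiples of the counit, hence generators. No case for constants is needed, so the
principle applies to morphisms that are not unital. -/
theorem LevelAlg.induction {P : LevelAlg k A p m → Prop} (of : ∀ μ, P (LevelAlg.of p m μ))
    (add : ∀ u v, P u → P v → P (u + v)) (mul : ∀ u v, P u → P v → P (u * v))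
    (u : LevelAlg k A p m) : P u := by
  obtain ⟨t, rfl⟩ : ∃ t, LevelAlg.mk k A p m t = u := RingQuot.mkAlgHom_surjective k _ u
  induction t using TensorAlgebra.induction with
  | algebraMap c =>
    rw [LevelAlg.mk_rel (LevelRel.unit c)]
    exact of _
  | ι μ => exact of μ
  | mul x y hx hy => rw [map_mul]; exact mul _ _ hx hy
  | add x y hx hy => rw [map_add]; exact add _ _ hx hy

end LevelInduction

/-! ### Construction of the splitting at level `m` from a unital morphism. -/

section LevelHom

variable {p : ℕ} [Fact p.Prime]

/-- The value at the constant function `1`. -/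
def augmentation (p : ℕ) [Fact p.Prime] : Functional (ZMod p) (CoordRing (ZMod p))
    →ₗ[ZMod p] ZMod p where
  toFun μ := μ.ofConv 1
  map_add' _ _ := rfl
  map_smul' _ _ := rfl

theorem augmentation_mul (μ ν : Functional (ZMod p) (CoordRing (ZMod p))) :
    augmentation p (μ * ν) = augmentation p μ * augmentation p ν := by
  change (μ * ν) 1 = μ 1 * ν 1
  rw [LinearMap.convMul_apply, Bialgebra.comul_one, Algebra.TensorProduct.one_def,
    TensorProduct.map_tmul, LinearMap.mul'_apply]

theorem augmentation_one : augmentation p (1 : Functional (ZMod p) (CoordRing (ZMod p))) = 1 := by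
  change (1 : Functional (ZMod p) (CoordRing (ZMod p))) 1 = 1
  rw [LinearMap.convOne_apply, Bialgebra.counit_one, map_one]

/-- The linear map that induces a unital extension of the splitting at level `m`. -/
def levelSplitUnit (p : ℕ) [Fact p.Prime] (m : ℕ) : Functional (ZMod p) (CoordRing (ZMod p))
    →ₗ[ZMod p] U p (m + 1) :=
  levelSplit p m + (augmentation p).smulRight (1 - levelOf p (m + 1) (torusNorm p))

theorem levelSplitUnit_apply (m : ℕ) (μ : Functional (ZMod p) (CoordRing (ZMod p)))
    : levelSplitUnit p m μ =
    levelSplit p m μ + augmentation p μ • (1 - levelOf p (m + 1) (torusNorm p)) := rfl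

/-- The values of `levelSplit` absorb the norm e on both sides, so cross terms with 1 - e vanish.
The summand with 1 - e is multiplicative because evaluation at the function 1 is. -/
theorem levelSplitUnit_mul {m : ℕ} {μ ν : Functional (ZMod p) (CoordRing (ZMod p))}
    (hμ : μ ∈ distOrder (ZMod p) (CoordRing (ZMod p)) (2 * p ^ m - 1))
    (hν : ν ∈ distOrder (ZMod p) (CoordRing (ZMod p)) (2 * p ^ m - 1))
        : levelSplitUnit p m μ * levelSplitUnit p m ν =
      levelSplit p m μ * levelSplit p m ν +
        augmentation p (μ * ν) • (1 - levelOf p (m + 1) (torusNorm p)) := by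
  rw [levelSplitUnit_apply, levelSplitUnit_apply, augmentation_mul, mul_add, add_mul, add_mul]
  simp only [mul_smul_comm, smul_mul_assoc, mul_sub, sub_mul, mul_one, one_mul, smul_smul,
    levelSplit_mul_torusNorm hμ, torusNorm_mul_levelSplit hν, levelOf_torusNorm_mul_self, sub_self,
    sub_zero, smul_zero, add_zero, zero_add]
  rw [mul_comm (augmentation p ν)]

variable (p) in
/-- The unital extension of the splitting at level `m`. -/
def levelUnitalHom (m : ℕ) : U p m →ₐ[ZMod p] U p (m + 1) :=
  have hN : 0 < p ^ m := Nat.pow_pos (Fact.out : p.Prime).pos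
  LevelAlg.lift (levelSplitUnit p m ∘ₗ (distOrder (ZMod p) (CoordRing (ZMod p))
      (2 * p ^ m - 1)).subtype)
    (by
      rw [LinearMap.comp_apply, Submodule.subtype_apply, levelSplitUnit_apply, augmentation_one,
        levelSplit_apply, frobSplit_one, one_smul, add_sub_cancel])
    (fun μ μ' ν hμ hμ' hν => by
      simp only [LinearMap.comp_apply, Submodule.subtype_apply]
      rw [levelSplitUnit_mul μ.2 μ'.2, levelSplitUnit_mul μ'.2 μ.2, add_sub_add_comm, ← sub_smul,
        ← map_sub, levelSplit_commutator hμ hμ', levelSplitUnit_apply, hν])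
    (fun μ μ' ν hμ hμ' hν => by
      simp only [LinearMap.comp_apply, Submodule.subtype_apply]
      rw [levelSplitUnit_mul μ.2 μ'.2, levelSplit_mul_left m _ hμ _ hμ', levelSplitUnit_apply, hν])

theorem levelUnitalHom_of {m : ℕ} (μ : distOrder (ZMod p) (CoordRing (ZMod p)) (2 * p ^ m - 1)) :
    levelUnitalHom p m (LevelAlg.of p m μ) = levelSplitUnit p m μ := by
  rw [levelUnitalHom, LevelAlg.lift_of]
  rfl

theorem levelUnitalHom_mul_torusNorm {m : ℕ} (μ : distOrder (ZMod p) (CoordRing (ZMod p))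
    (2 * p ^ m - 1)) :
    levelUnitalHom p m (LevelAlg.of p m μ) * levelOf p (m + 1) (torusNorm p) =
      levelSplit p m μ := by
  rw [levelUnitalHom_of, levelSplitUnit_apply, add_mul, levelSplit_mul_torusNorm μ.2,
    smul_mul_assoc, sub_mul, one_mul, levelOf_torusNorm_mul_self, sub_self, smul_zero, add_zero]

/-- Centrality of the idempotent over the image is what makes u ↦ (image of u) · e multiplicative.
-/
theorem torusNorm_mul_levelUnitalHom (m : ℕ) (u : U p m) :
    levelOf p (m + 1) (torusNorm p) * levelUnitalHom p m u =
      levelUnitalHom p m u * levelOf p (m + 1) (torusNorm p) := by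
  induction u using LevelAlg.induction with
  | of μ =>
    rw [levelUnitalHom_mul_torusNorm, levelUnitalHom_of, levelSplitUnit_apply, mul_add,
      torusNorm_mul_levelSplit μ.2, mul_smul_comm, mul_sub, mul_one, levelOf_torusNorm_mul_self,
      sub_self, smul_zero, add_zero]
  | add u v hu hv => rw [map_add, mul_add, add_mul, hu, hv]
  | mul u v hu hv => rw [map_mul, ← mul_assoc, hu, mul_assoc, hv, mul_assoc]

variable (p) in
/-- The splitting of the Frobenius morphism at level `m`. -/
def levelHom (m : ℕ) : U p m →ₙₐ[ZMod p] U p (m + 1) where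
  toFun u := levelUnitalHom p m u * levelOf p (m + 1) (torusNorm p)
  map_smul' c u := by rw [map_smul, smul_mul_assoc, MonoidHom.id_apply]
  map_zero' := by rw [map_zero, zero_mul]
  map_add' u v := by rw [map_add, add_mul]
  map_mul' u v := by
    rw [mul_assoc _ _ (_ * _), ← mul_assoc _ (levelUnitalHom p m v), torusNorm_mul_levelUnitalHom,
      mul_assoc _ _ (levelOf _ _ _), levelOf_torusNorm_mul_self, ← mul_assoc, map_mul]

theorem levelHom_of {m : ℕ} (μ : distOrder (ZMod p) (CoordRing (ZMod p)) (2 * p ^ m - 1)) :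
    levelHom p m (LevelAlg.of p m μ) = levelOf p (m + 1) (frobSplit p μ) :=
  levelUnitalHom_mul_torusNorm μ

theorem levelHom_levelOf {m : ℕ} {μ : Functional (ZMod p) (CoordRing (ZMod p))}
    (hμ : μ ∈ distOrder (ZMod p) (CoordRing (ZMod p)) (2 * p ^ m - 1)) :
    levelHom p m (levelOf p m μ) = levelOf p (m + 1) (frobSplit p μ) :=
  (congrArg _ (levelOf_coe ⟨μ, hμ⟩)).trans (levelHom_of ⟨μ, hμ⟩)

theorem levelHom_one (m : ℕ) : levelHom p m 1 = levelOf p (m + 1) (torusNorm p) := by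
  rw [← levelOf_one, levelHom_levelOf (one_mem_distOrder _), frobSplit_one]

theorem frobSplit_mem_level {m : ℕ} {μ : Functional (ZMod p) (CoordRing (ZMod p))}
    (hμ : μ ∈ distOrder (ZMod p) (CoordRing (ZMod p)) (2 * p ^ m - 1)) :
    frobSplit p μ ∈ distOrder (ZMod p) (CoordRing (ZMod p)) (2 * p ^ (m + 1) - 1) := by
  have hp : 0 < p := (Fact.out : p.Prime).pos
  have h := mul_two_mul_sub_one_add (p := p) m
  refine distOrder_mono ?_ (frobSplit_mem hμ)
  rw [pow_succ']
  lia

theorem next_levelOf {m : ℕ} {μ : Functional (ZMod p) (CoordRing (ZMod p))}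
    (hμ : μ ∈ distOrder (ZMod p) (CoordRing (ZMod p)) (2 * p ^ m - 1)) :
    LevelAlg.next p m (levelOf p m μ) = levelOf p (m + 1) μ := by
  have h : LevelAlg.next p m (LevelAlg.of p m ⟨μ, hμ⟩) = LevelAlg.of p (m + 1)
      (distOrder.incl (LevelAlg.next_aux' p m) ⟨μ, hμ⟩) := LevelAlg.lift_of _ _ _ _ _
  rwa [← levelOf_coe, ← levelOf_coe] at h

theorem toDist_levelOf {m : ℕ} {μ : Functional (ZMod p) (CoordRing (ZMod p))}
    (hμ : μ ∈ distOrder (ZMod p) (CoordRing (ZMod p)) (2 * p ^ m - 1)) :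
    LevelAlg.toDist p m (levelOf p m μ) = ⟨μ, _, hμ⟩ := by
  have h : LevelAlg.toDist p m (LevelAlg.of p m ⟨μ, hμ⟩) =
      distOrder.toDist (2 * p ^ m - 1) ⟨μ, hμ⟩ := LevelAlg.lift_of _ _ _ _ _
  rwa [← levelOf_coe] at h

theorem frLevel_levelOf {m : ℕ} {μ : Functional (ZMod p) (CoordRing (ZMod p))}
    (hμ : μ ∈ distOrder (ZMod p) (CoordRing (ZMod p)) (2 * p ^ (m + 1) - 1)) :
    frLevel p m (levelOf p (m + 1) μ) = levelOf p m (frFunctional p _ μ) := by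
  rw [levelOf_coe ⟨μ, hμ⟩, frLevel, LevelAlg.lift_of, LinearMap.comp_apply, ← levelOf_coe]
  rfl

theorem levelHom_next (m : ℕ) (u : U p m) :
    levelHom p (m + 1) (LevelAlg.next p m u) = LevelAlg.next p (m + 1) (levelHom p m u) := by
  induction u using LevelAlg.induction with
  | of μ =>
    rw [levelHom_of, next_levelOf (frobSplit_mem_level μ.2), ← levelOf_coe, next_levelOf μ.2,
      levelHom_levelOf (distOrder_mono (LevelAlg.next_aux' p m) μ.2)]
  | add u v hu hv => simp only [map_add, hu, hv]
  | mul u v hu hv => simp only [map_mul, hu, hv]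

end LevelHom

/-! ### The splitting on distributions and its compatibility with the levels. -/

section DistHom

variable {p : ℕ} [Fact p.Prime]

variable (p) in
/-- The splitting of the Frobenius morphism on distributions. -/
def distHom : DistAlg p →ₙₐ[ZMod p] DistAlg p where
  toFun μ := ⟨frobSplit p μ, by
    obtain ⟨n, hn⟩ := μ.2
    exact ⟨_, frobSplit_mem hn⟩⟩
  map_smul' c μ := Subtype.ext (map_smul (frobSplit p) c
      (μ : Functional (ZMod p) (CoordRing (ZMod p))))
  map_zero' := Subtype.ext (map_zero (frobSplit p))
  map_add' μ ν := Subtype.ext (map_add (frobSplit p)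
      (μ : Functional (ZMod p) (CoordRing (ZMod p))) ν)
  map_mul' μ ν := Subtype.ext (frobSplit_mul μ.2 ν.2)

theorem coe_distHom (μ : DistAlg p) : (distHom p μ : Functional (ZMod p) (CoordRing (ZMod p)))
    = frobSplit p μ := rfl

theorem distHom_toDist (m : ℕ) (u : U p m) :
    distHom p (LevelAlg.toDist p m u) = LevelAlg.toDist p (m + 1) (levelHom p m u) := by
  induction u using LevelAlg.induction with
  | of μ =>
    rw [levelHom_of, toDist_levelOf (frobSplit_mem_level μ.2), ← levelOf_coe, toDist_levelOf μ.2]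
    rfl
  | add u v hu hv => simp only [map_add, hu, hv]
  | mul u v hu hv => simp only [map_mul, hu, hv]

end DistHom

/-! ### Values of the Frobenius morphism, and the norm is not the unit. -/

section FrobeniusValues

variable {p : ℕ} [Fact p.Prime]

theorem frFunctional_coeffAt (g : Matrix.SpecialLinearGroup (Fin 2) (ZMod p)⟦X⟧) (n : ℕ) :
    frFunctional p (CoordRing (ZMod p)) (coeffAt g n) =
      if p ∣ n then coeffAt g (n / p) else 0 := by
  refine WithConv.ext (LinearMap.ext fun f => ?_)
  have h : frFunctional p (CoordRing (ZMod p)) (coeffAt g n) f =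
      if p ∣ n then PowerSeries.coeff (n / p) (evalAt g f) else 0 := by
    rw [frFunctional_apply, ← coeff_pow_prime, ← map_pow]
    rfl
  refine h.trans ?_
  split_ifs <;> rfl

theorem frFunctional_coeffAt_prime_mul (g : Matrix.SpecialLinearGroup (Fin 2) (ZMod p)⟦X⟧)
    (n : ℕ) : frFunctional p (CoordRing (ZMod p)) (coeffAt g (p * n)) = coeffAt g n := by
  rw [frFunctional_coeffAt, if_pos (dvd_mul_right p n),
    Nat.mul_div_cancel_left n (Fact.out : p.Prime).pos]

/-- Frobenius kills binom(H, i) for 0 < i < p, so only the term i = 0 is left. -/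
theorem frFunctional_torusNorm : frFunctional p (CoordRing (ZMod p)) (torusNorm p) = 1 := by
  rw [torusNorm_eq_sum, map_sum, Finset.sum_eq_single 0]
  · rw [pow_zero, one_smul, binomH_zero, map_one]
  · intro i hi h0
    have hd : ¬ p ∣ i := Nat.not_dvd_of_pos_of_lt (Nat.pos_of_ne_zero h0) (Finset.mem_range.1 hi)
    rw [map_smul, binomH, frFunctional_coeffAt, if_neg hd, smul_zero]
  · intro h
    exact absurd (Finset.mem_range.2 (Fact.out : p.Prime).pos) h

theorem frFunctional_frobSplit {μ : Functional (ZMod p) (CoordRing (ZMod p))}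
    (hμ : μ ∈ dist (ZMod p) (CoordRing (ZMod p))) :
    frFunctional p (CoordRing (ZMod p)) (frobSplit p μ) = μ := by
  have hs := mem_span_pbw hμ
  clear hμ
  induction hs using Submodule.span_induction with
  | mem μ hμ =>
    obtain ⟨⟨a, b, c⟩, rfl⟩ := hμ
    rw [frobSplit_pbw_eq_mul, map_mul, frFunctional_torusNorm, mul_one, pbw, pbw, map_mul, map_mul]
    simp only [divE, divF, binomH, frFunctional_coeffAt_prime_mul]
  | zero => simp
  | add x y _ _ hx hy => rw [map_add, map_add, hx, hy]
  | smul c x _ hx => rw [map_smul, map_smul, hx]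

theorem coe_frDist (μ : DistAlg p) :
    (frDist p μ : Functional (ZMod p) (CoordRing (ZMod p))) = frFunctional p
        (CoordRing (ZMod p)) μ := rfl

theorem frDist_distHom (μ : DistAlg p) : frDist p (distHom p μ) = μ :=
  Subtype.ext (frFunctional_frobSplit μ.2)

theorem frLevel_levelHom (m : ℕ) (u : U p m) : frLevel p m (levelHom p m u) = u := by
  induction u using LevelAlg.induction with
  | of μ =>
    rw [levelHom_of, frLevel_levelOf (frobSplit_mem_level μ.2), frFunctional_frobSplit ⟨_, μ.2⟩,
      levelOf_coe]
  | add u v hu hv => simp only [map_add, hu, hv]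
  | mul u v hu hv => simp only [map_mul, hu, hv]

theorem frDist_coeffAt {g : Matrix.SpecialLinearGroup (Fin 2) (ZMod p)⟦X⟧} {d : ℕ → DistAlg p}
    (hd : ∀ n, (d n : Functional (ZMod p) (CoordRing (ZMod p))) = coeffAt g n) (n : ℕ) :
    frDist p (d n) = if p ∣ n then d (n / p) else 0 := by
  refine Subtype.ext ?_
  rw [coe_frDist, hd, frFunctional_coeffAt]
  split_ifs
  · rw [hd]
  · rfl

theorem levelE_eq {m n : ℕ} (hn : n < 2 * p ^ m) :
    levelE p m hn = levelOf p m (divE (ZMod p) n) :=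
  (levelOf_coe ⟨divE (ZMod p) n, _⟩).symm

theorem levelF_eq {m n : ℕ} (hn : n < 2 * p ^ m) :
    levelF p m hn = levelOf p m (divF (ZMod p) n) :=
  (levelOf_coe ⟨divF (ZMod p) n, _⟩).symm

theorem levelH_eq {m n : ℕ} (hn : n < 2 * p ^ m) :
    levelH p m hn = levelOf p m (binomH (ZMod p) n) :=
  (levelOf_coe ⟨binomH (ZMod p) n, _⟩).symm

theorem frLevel_levelE {m n : ℕ} (hn : n < 2 * p ^ (m + 1)) :
    frLevel p m (levelE p (m + 1) hn) = if p ∣ n then levelE p m (div_prime_lt hn) else 0 := by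
  rw [levelE_eq, levelE_eq, frLevel_levelOf (distOrder_mono (by lia) (divE_mem (ZMod p) n)), divE,
    frFunctional_coeffAt]
  split_ifs
  · rfl
  · exact map_zero _

theorem frLevel_levelF {m n : ℕ} (hn : n < 2 * p ^ (m + 1)) :
    frLevel p m (levelF p (m + 1) hn) = if p ∣ n then levelF p m (div_prime_lt hn) else 0 := by
  rw [levelF_eq, levelF_eq, frLevel_levelOf (distOrder_mono (by lia) (divF_mem (ZMod p) n)), divF,
    frFunctional_coeffAt]
  split_ifs
  · rfl
  · exact map_zero _

theorem levelNorm_eq (m : ℕ) : levelNorm p m = levelOf p (m + 1) (torusNorm p) := by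
  rw [levelNorm, torusNorm_eq_sum, map_sum, Finset.sum_range]
  simp only [levelH_eq, map_smul]

theorem coe_distNorm : (distNorm p : Functional (ZMod p) (CoordRing (ZMod p))) = torusNorm p := by
  rw [distNorm, torusNorm_eq_sum, ← Subalgebra.val_apply, map_sum]
  rfl

theorem torusFunctional_univPoint {k : Type*} [Field k] (u : ℤ → k) :
    torusFunctional u (univPoint k 0 0) = u 1 := by
  change weightForm u (evalAt diagPoint (univPoint k 0 0)) = u 1
  rw [evalAt_univPoint]
  simp [-LaurentPolynomial.single_eq_C_mul_T, diagPoint_apply, weightForm_single]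

/-- The coordinate function x₀₀ restricts to the character of weight 1: the norm takes the value 0
there, the counit the value 1. -/
theorem torusNorm_ne_one : torusNorm p ≠ 1 := by
  intro h
  have h1 := torusFunctional_univPoint (primeIndicator p)
  have h2 := torusFunctional_univPoint (1 : ℤ → ZMod p)
  rw [torusFunctional_one, ← h, torusNorm, h1, primeIndicator, if_neg, Pi.one_apply] at h2
  · exact zero_ne_one h2
  · intro hd
    exact (Fact.out : p.Prime).one_lt.not_ge (Int.ofNat_le.1 (by
      simpa using Int.le_of_dvd one_pos hd))

theorem distNorm_ne_one : distNorm p ≠ 1 := fun h =>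
  torusNorm_ne_one (coe_distNorm (p := p) ▸ congrArg Subtype.val h)

theorem levelNorm_ne_one (m : ℕ) : levelNorm p m ≠ 1 := by
  intro h
  have hp : 0 < p := (Fact.out : p.Prime).pos
  have hN : p ≤ p * p ^ m := Nat.le_mul_of_pos_right p (Nat.pow_pos hp)
  have hmem : torusNorm p ∈ distOrder (ZMod p) (CoordRing (ZMod p)) (2 * p ^ (m + 1) - 1) :=
    distOrder_mono (by rw [pow_succ']; lia) torusNorm_mem
  have h' := congrArg (LevelAlg.toDist p (m + 1)) h
  rw [levelNorm_eq, toDist_levelOf hmem, map_one] at h'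
  exact torusNorm_ne_one (congrArg Subtype.val h')

end FrobeniusValues

/-! ### The prescribed formulas and the uniqueness of the splittings. -/

section Uniqueness

variable {p : ℕ} [Fact p.Prime]

theorem levelHom_formulas (m : ℕ) : LevelFormulas p m (levelHom p m) := by
  intro i hi
  have hp : 0 < p := (Fact.out : p.Prime).pos
  have hip : i * p + p ≤ 2 * (p * p ^ m) := by
    rw [← Nat.succ_mul, mul_left_comm, mul_comm p]
    exact Nat.mul_le_mul_right p hi
  rw [levelE_eq, levelF_eq, levelH_eq, levelE_eq, levelF_eq, levelH_eq, levelNorm_eq]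
  refine ⟨?_, ?_, ?_⟩
  · rw [levelHom_levelOf (distOrder_mono (by lia) (divE_mem (ZMod p) i)), frobSplit_divE_eq,
      levelOf_mul_torusNorm_of_mem hip (divE_mem (ZMod p) _)]
  · rw [levelHom_levelOf (distOrder_mono (by lia) (divF_mem (ZMod p) i)), frobSplit_divF_eq,
      levelOf_mul_torusNorm_of_mem hip (divF_mem (ZMod p) _)]
  · rw [levelHom_levelOf (distOrder_mono (by lia) (binomH_mem (ZMod p) i)), frobSplit_binomH,
      levelOf_mul_torusNorm_of_mem hip (binomH_mem (ZMod p) _)]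

/-- An ordered monomial of degree at most 2p^m - 1 is, by `levelOf_mul`, also in the enveloping
algebra the product of its three factors; such monomials span the generating module. -/
theorem level_hom_ext {m : ℕ} {B : Type*} [NonUnitalRing B] [Module (ZMod p) B]
    {ψ ψ' : U p m →ₙₐ[ZMod p] B}
    (hE : ∀ (i : ℕ) (hi : i < 2 * p ^ m), ψ (levelE p m hi) = ψ' (levelE p m hi))
    (hF : ∀ (i : ℕ) (hi : i < 2 * p ^ m), ψ (levelF p m hi) = ψ' (levelF p m hi))
    (hH : ∀ (i : ℕ) (hi : i < 2 * p ^ m), ψ (levelH p m hi) = ψ' (levelH p m hi)) : ψ = ψ' := by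
  have hN : 0 < p ^ m := Nat.pow_pos (Fact.out : p.Prime).pos
  simp only [levelE_eq, levelF_eq, levelH_eq] at hE hF hH
  have key : ∀ μ ∈ distOrder (ZMod p) (CoordRing (ZMod p)) (2 * p ^ m - 1), ψ (levelOf p m μ)
      = ψ' (levelOf p m μ) := by
    intro μ hμ
    rw [distOrder_eq_span] at hμ
    induction hμ using Submodule.span_induction with
    | mem μ hμ =>
      obtain ⟨⟨a, b, c⟩, habc, rfl⟩ := hμ
      change a + b + c ≤ 2 * p ^ m - 1 at habc
      rw [pbw, ← levelOf_mul (by lia) (mul_mem_distOrder (divF_mem (ZMod p) a)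
          (binomH_mem (ZMod p) b))
        (divE_mem (ZMod p) c), ← levelOf_mul (by lia) (divF_mem (ZMod p) a) (binomH_mem (ZMod p) b)]
      simp only [map_mul]
      rw [hE c (by lia), hF a (by lia), hH b (by lia)]
    | zero => simp only [map_zero]
    | add x y _ _ hx hy => simp only [map_add, hx, hy]
    | smul c x _ hx => simp only [map_smul, hx]
  ext u
  induction u using LevelAlg.induction with
  | of μ => rw [← levelOf_coe]; exact key μ μ.2
  | add u v hu hv => simp only [map_add, hu, hv]
  | mul u v hu hv => simp only [map_mul, hu, hv]

theorem distHom_formulas : DistFormulas p (distHom p) := by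
  intro i
  refine ⟨Subtype.ext ?_, Subtype.ext ?_, Subtype.ext ?_⟩
  · rw [coe_distHom, Subalgebra.coe_mul, coe_distNorm]
    exact frobSplit_divE_eq i
  · rw [coe_distHom, Subalgebra.coe_mul, coe_distNorm]
    exact frobSplit_divF_eq i
  · rw [coe_distHom, Subalgebra.coe_mul, coe_distNorm]
    exact frobSplit_binomH i

theorem distHom_one : distHom p 1 = distNorm p := by
  refine Subtype.ext ?_
  rw [coe_distHom, coe_distNorm]
  exact frobSplit_one

theorem dist_hom_ext {B : Type*} [NonUnitalRing B] [Module (ZMod p) B]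
    {ψ ψ' : DistAlg p →ₙₐ[ZMod p] B} (hE : ∀ i, ψ (distE p i) = ψ' (distE p i))
    (hF : ∀ i, ψ (distF p i) = ψ' (distF p i)) (hH : ∀ i, ψ (distH p i) = ψ' (distH p i)) :
    ψ = ψ' := by
  -- Membership in the subalgebra is part of the conclusion, so that the span induction can run in
  -- the ambient space of functionals.
  have key : ∀ (μ : Functional (ZMod p) (CoordRing (ZMod p))), μ ∈ Submodule.span (ZMod p)
      (Set.range (pbw (k := ZMod p))) →
      ∃ h : μ ∈ dist (ZMod p) (CoordRing (ZMod p)), ψ ⟨μ, h⟩ = ψ' ⟨μ, h⟩ := by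
    intro μ hμ
    induction hμ using Submodule.span_induction with
    | mem μ hμ =>
      obtain ⟨⟨a, b, c⟩, rfl⟩ := hμ
      refine ⟨(distF p a * distH p b * distE p c).2, ?_⟩
      change ψ (distF p a * distH p b * distE p c) = ψ' (distF p a * distH p b * distE p c)
      simp only [map_mul, hE, hF, hH]
    | zero => exact ⟨Subalgebra.zero_mem _, (map_zero ψ).trans (map_zero ψ').symm⟩
    | add x y _ _ hx hy =>
      obtain ⟨hx, hx'⟩ := hx
      obtain ⟨hy, hy'⟩ := hy
      refine ⟨Subalgebra.add_mem _ hx hy, (map_add ψ ⟨x, hx⟩ ⟨y, hy⟩).trans ?_⟩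
      rw [hx', hy']
      exact (map_add ψ' ⟨x, hx⟩ ⟨y, hy⟩).symm
    | smul c x _ hx =>
      obtain ⟨hx, hx'⟩ := hx
      refine ⟨Subalgebra.smul_mem _ hx c, (map_smul ψ c ⟨x, hx⟩).trans ?_⟩
      rw [hx']
      exact (map_smul ψ' c ⟨x, hx⟩).symm
  ext μ
  exact (key μ (mem_span_pbw μ.2)).2

end Uniqueness

end DistSL2

end

open DistSL2 in
theorem proposition2p2p1 (p : ℕ) [Fact p.Prime] (hp : 2 < p) :
    -- the Frobenius morphisms take the expected values on the divided powers
    (∀ n : ℕ, frDist p (distE p n) = (if p ∣ n then distE p (n / p) else 0) ∧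
      frDist p (distF p n) = (if p ∣ n then distF p (n / p) else 0)) ∧
    (∀ (m n : ℕ) (hn : n < 2 * p ^ (m + 1)),
      frLevel p m (levelE p (m + 1) hn) =
        (if p ∣ n then levelE p m (div_prime_lt hn) else 0) ∧
      frLevel p m (levelF p (m + 1) hn) =
        (if p ∣ n then levelF p m (div_prime_lt hn) else 0)) ∧
    ∃ (φ : ∀ m : ℕ, U p m →ₙₐ[ZMod p] U p (m + 1)) (Φ : DistAlg p →ₙₐ[ZMod p] DistAlg p),
      -- at each level the formulas define exactly one algebra morphism; it is not unital,
      -- and it splits the Frobenius morphism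
      (∀ m : ℕ, LevelFormulas p m (φ m) ∧
        (∀ ψ : U p m →ₙₐ[ZMod p] U p (m + 1), LevelFormulas p m ψ → ψ = φ m) ∧
        φ m 1 = levelNorm p m ∧ levelNorm p m ≠ 1 ∧
        ∀ u : U p m, frLevel p m (φ m u) = u) ∧
      -- the same on the algebra of distributions
      (DistFormulas p Φ ∧
        (∀ ψ : DistAlg p →ₙₐ[ZMod p] DistAlg p, DistFormulas p ψ → ψ = Φ) ∧
        Φ 1 = distNorm p ∧ distNorm p ≠ 1 ∧
        ∀ μ : DistAlg p, frDist p (Φ μ) = μ) ∧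
      -- the morphisms are compatible with the inductive system and with its limit
      (∀ (m : ℕ) (u : U p m), φ (m + 1) (LevelAlg.next p m u) = LevelAlg.next p (m + 1) (φ m u)) ∧
      (∀ (m : ℕ) (u : U p m), Φ (LevelAlg.toDist p m u) = LevelAlg.toDist p (m + 1) (φ m u)) := by
  refine ⟨fun n => ⟨frDist_coeffAt (fun _ => rfl) n, frDist_coeffAt (fun _ => rfl) n⟩,
    fun m n hn => ⟨frLevel_levelE hn, frLevel_levelF hn⟩, levelHom p, distHom p, fun m => ?_, ?_,
    levelHom_next, distHom_toDist⟩
  · refine ⟨levelHom_formulas m, fun ψ hψ => ?_, ?_, levelNorm_ne_one m, frLevel_levelHom m⟩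
    · have h := levelHom_formulas (p := p) m
      exact level_hom_ext (fun i hi => (hψ i hi).1.trans (h i hi).1.symm)
        (fun i hi => (hψ i hi).2.1.trans (h i hi).2.1.symm)
        (fun i hi => (hψ i hi).2.2.trans (h i hi).2.2.symm)
    · rw [levelHom_one, levelNorm_eq]
  · refine ⟨distHom_formulas, fun ψ hψ => ?_, distHom_one, distNorm_ne_one, frDist_distHom⟩
    have h := distHom_formulas (p := p)
    exact dist_hom_ext (p := p) (B := DistAlg p) (ψ := ψ) (ψ' := distHom p)
      (fun i => (hψ i).1.trans (h i).1.symm)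
      (fun i => (hψ i).2.1.trans (h i).2.1.symm) (fun i => (hψ i).2.2.trans (h i).2.2.symm)
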